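/- Let $q$ be a prime power, regarded as a constant. In the entrywise $\ell_0$-rank-$k$ approximation problem over the field $\mathbb F_q$, the input is a matrix $A\in\mathbb F_q^{n\times d}$ (with $n,d\ge 1$) and a positive integer $k$. An algorithm for this problem is an $\alpha$-approximation if, on every input, it outputs matrices $U\in\mathbb F_q^{n\times k}$ and $V\in\mathbb F_q^{k\times d}$ such that $$\|A-UV\|_0\le \alpha\cdot\min_{U'\in\mathbb F_q^{n\times k},\,V'\in\mathbb F_q^{k\times d}}\|A-U'V'\|_0 ,$$ where $\|M\|_0$ denotes the number of non-zero entries of $M$. Theorem. For every $q$ there is a polynomial $P$ such that for every $\varepsilon\in(0,1)$ there is a (deterministic) $(1+\varepsilon)$-approximation algorithm for the entrywise $\ell_0$-rank-$k$ approximation problem over $\mathbb F_q$ whose running time on a unit-cost random access machine is at most $$n\cdot \max(d,2)^{P(k/\varepsilon)}$$ for every $n\times d$ matrix $A$ over $\mathbb F_q$ and every positive integer $k$. -/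

import Mathlib

open scoped Polynomial

/-! ### A unit-cost random access machine

The machine has registers holding natural numbers and finitely many (as many as the program
text mentions) unbounded arrays of natural numbers, which are accessed by indirect addressing.
The only arithmetic operations are addition and truncated subtraction. Every executed basic
instruction and every evaluated branch or loop test costs one unit of time. -/

namespace RAM

/-- A memory configuration: `reg x` is the content of register `x`, and `arr a i` is the content
of the cell with index `i` of array `a`. -/
@[ext]
structure State where
  reg : ℕ → ℕ
  arr : ℕ → ℕ → ℕ

/-- The state after writing `v` into register `x`. -/
def State.setReg (s : State) (x v : ℕ) : State :=
  { s with reg := Function.update s.reg x v }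

/-- The state after writing `v` into cell `i` of array `a`. -/
def State.setArr (s : State) (a i v : ℕ) : State :=
  { s with arr := Function.update s.arr a (Function.update (s.arr a) i v) }

/-- Programs. Register names `x y z`, array names `a` and constants `c` are part of the program
text. -/
inductive Program where
  /-- do nothing -/
  | skip : Program
  /-- `reg x := c` -/
  | const (x c : ℕ) : Program
  /-- `reg x := reg y + reg z` -/
  | add (x y z : ℕ) : Program
  /-- `reg x := reg y - reg z`, truncated at `0` -/
  | sub (x y z : ℕ) : Program
  /-- `reg x := arr a (reg y)` -/
  | load (x a y : ℕ) : Program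
  /-- `arr a (reg y) := reg x` -/
  | store (a y x : ℕ) : Program
  /-- first `p`, then `r` -/
  | seq (p r : Program) : Program
  /-- if `reg x ≠ 0` then `p` else `r` -/
  | ite (x : ℕ) (p r : Program) : Program
  /-- while `reg x ≠ 0` do `p` -/
  | loop (x : ℕ) (p : Program) : Program

/-- `Exec p s t s'`: started in state `s`, the program `p` halts after exactly `t` time units in
state `s'`. -/
inductive Exec : Program → State → ℕ → State → Prop where
  | skip (s : State) : Exec .skip s 1 s
  | const (s : State) (x c : ℕ) : Exec (.const x c) s 1 (s.setReg x c)
  | add (s : State) (x y z : ℕ) : Exec (.add x y z) s 1 (s.setReg x (s.reg y + s.reg z))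
  | sub (s : State) (x y z : ℕ) : Exec (.sub x y z) s 1 (s.setReg x (s.reg y - s.reg z))
  | load (s : State) (x a y : ℕ) : Exec (.load x a y) s 1 (s.setReg x (s.arr a (s.reg y)))
  | store (s : State) (a y x : ℕ) : Exec (.store a y x) s 1 (s.setArr a (s.reg y) (s.reg x))
  | seq {p r : Program} {s s₁ s₂ : State} {t₁ t₂ : ℕ} :
      Exec p s t₁ s₁ → Exec r s₁ t₂ s₂ → Exec (.seq p r) s (t₁ + t₂) s₂
  | ite_true {x : ℕ} {p r : Program} {s s' : State} {t : ℕ} :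
      s.reg x ≠ 0 → Exec p s t s' → Exec (.ite x p r) s (t + 1) s'
  | ite_false {x : ℕ} {p r : Program} {s s' : State} {t : ℕ} :
      s.reg x = 0 → Exec r s t s' → Exec (.ite x p r) s (t + 1) s'
  | loop_done {x : ℕ} {p : Program} {s : State} :
      s.reg x = 0 → Exec (.loop x p) s 1 s
  | loop_step {x : ℕ} {p : Program} {s s₁ s₂ : State} {t₁ t₂ : ℕ} :
      s.reg x ≠ 0 → Exec p s t₁ s₁ → Exec (.loop x p) s₁ t₂ s₂ →
      Exec (.loop x p) s (t₁ + t₂ + 1) s₂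

/-- The machine is deterministic: the running time and the final state are determined by the
program and the initial state. -/
theorem Exec.deterministic {p : Program} {s s₁ s₂ : State} {t₁ t₂ : ℕ}
    (h₁ : Exec p s t₁ s₁) (h₂ : Exec p s t₂ s₂) : t₁ = t₂ ∧ s₁ = s₂ := by
  induction h₁ generalizing t₂ s₂ with
  | skip | const | add | sub | load | store => cases h₂; exact ⟨rfl, rfl⟩
  | seq _ _ ih₁ ih₂ =>
    cases h₂ with
    | seq a b =>
      obtain ⟨rfl, rfl⟩ := ih₁ a
      obtain ⟨rfl, rfl⟩ := ih₂ b
      exact ⟨rfl, rfl⟩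
  | ite_true hx _ ih =>
    cases h₂ with
    | ite_true _ a =>
      obtain ⟨rfl, rfl⟩ := ih a
      exact ⟨rfl, rfl⟩
    | ite_false h0 _ => exact absurd h0 hx
  | ite_false hx _ ih =>
    cases h₂ with
    | ite_true h0 _ => exact absurd hx h0
    | ite_false _ a =>
      obtain ⟨rfl, rfl⟩ := ih a
      exact ⟨rfl, rfl⟩
  | loop_done hx =>
    cases h₂ with
    | loop_done => exact ⟨rfl, rfl⟩
    | loop_step h0 _ _ => exact absurd hx h0
  | loop_step hx _ _ ih₁ ih₂ =>
    cases h₂ with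
    | loop_done h0 => exact absurd h0 hx
    | loop_step _ a b =>
      obtain ⟨rfl, rfl⟩ := ih₁ a
      obtain ⟨rfl, rfl⟩ := ih₂ b
      exact ⟨rfl, rfl⟩

end RAM

/-! ### Entrywise low rank approximation over a finite field -/

namespace LowRank

/-- The number of non-zero entries of a matrix. -/
noncomputable def l0Norm {F : Type*} [Zero F] {n d : ℕ} (M : Matrix (Fin n) (Fin d) F) : ℕ :=
  {p : Fin n × Fin d | M p.1 p.2 ≠ 0}.ncard

/-- `(U, V)` is an `α`-approximate solution of the entrywise `ℓ₀` rank-`k` approximation problem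
for `A`: its cost is at most `α` times the cost of every pair `(U', V')` of the same format, that
is, at most `α` times the minimum cost. -/
def IsApproxSolution {F : Type*} [Field F] {n d k : ℕ} (α : ℝ) (A : Matrix (Fin n) (Fin d) F)
    (U : Matrix (Fin n) (Fin k) F) (V : Matrix (Fin k) (Fin d) F) : Prop :=
  ∀ (U' : Matrix (Fin n) (Fin k) F) (V' : Matrix (Fin k) (Fin d) F),
    (l0Norm (A - U * V) : ℝ) ≤ α * (l0Norm (A - U' * V') : ℝ)

/-- Array `a` of the state `s` stores the matrix `M` row by row, a field element `x` being
represented by its number `e x` in an enumeration `e` of the field. -/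
def Stores {F : Type*} {q n d : ℕ} (e : F ≃ Fin q) (s : RAM.State) (a : ℕ)
    (M : Matrix (Fin n) (Fin d) F) : Prop :=
  ∀ (i : Fin n) (j : Fin d), s.arr a ((i : ℕ) * d + j) = (e (M i j) : ℕ)

/-- The initial state on input `(A, k)` for an `n × d` matrix `A`: registers `0, 1, 2` hold
`n, d, k`, array `0` holds `A` row by row, and everything else is `0`. -/
def inputState {F : Type*} {q n d : ℕ} (e : F ≃ Fin q) (A : Matrix (Fin n) (Fin d) F) (k : ℕ) :
    RAM.State where
  reg x := if x = 0 then n else if x = 1 then d else if x = 2 then k else 0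
  arr a m :=
    if h : a = 0 ∧ m / d < n ∧ 0 < d then
      (e (A ⟨m / d, h.2.1⟩ ⟨m % d, Nat.mod_lt m h.2.2⟩) : ℕ)
    else 0

/-- On input `(A, k)` the program `p` halts within `T` time units, with matrices `U` (in array
`1`) and `V` (in array `2`) that form an `α`-approximate solution. -/
def SolvesWithin {F : Type*} [Field F] {q n d : ℕ} (e : F ≃ Fin q) (p : RAM.Program) (α : ℝ)
    (A : Matrix (Fin n) (Fin d) F) (k : ℕ) (T : ℝ) : Prop :=
  ∃ (t : ℕ) (s : RAM.State) (U : Matrix (Fin n) (Fin k) F) (V : Matrix (Fin k) (Fin d) F),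
    RAM.Exec p (inputState e A k) t s ∧ (t : ℝ) ≤ T ∧
      Stores e s 1 U ∧ Stores e s 2 V ∧ IsApproxSolution α A U V

end LowRank

/-! Fix a competitor `(U', V')`. For fixed `V'` the problem splits into `n` nearest-codeword
problems for the linear code of all `u * V'`, of dimension at most `k`. The idea is to replace the
`d` coordinates by `t` weighted sampled ones, with `t` polynomial in `k / ε` and independent of `n`,
and to solve each row by brute force over the `q ^ k` vectors `u`. Neither `V'` nor the right
samples are known, so the algorithm tries every guess of `t` column indices, `t` weights in `0, …,
d` and `t` columns of `V'`. Each guess yields some `U`; an optimal partner of `U` is then found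
column by column, and the best pair seen is kept. There are `d ^ t * (d + 1) ^ t * q ^ (t * k)`
guesses, and each costs time linear in `n`. No randomness is used: only the existence of one good
guess has to be proved.

The existence proof is sensitivity sampling. By `exists_sensitivities`, coordinates carry integers
`m j` such that a codeword nonzero at `j` has weight at least `m j`, while the sum of the `1 / m j`
is at most `k + 1`. Sampling `j` with probability proportional to `1 / m j` and weighting its error
by `m j` estimates, up to scale, differences of distances without bias. Relative to the distance of
the two codewords compared, the estimate is bounded by about `k`, so an exponential-moment bound and
a union bound over `q ^ k` vectors make one row reliable (`expect_deviation`, `expect_misjudges`).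

A union bound over the `n` rows would make `t` depend on `n`. Instead, the samples need only judge
the code itself correctly, a condition that does not involve the rows. Under it, even a misjudged
row costs at most a constant times its true and sampled errors (`dist_le_of_samples`), and the
expectation of that cost restricted to misjudgement is a small multiple of the optimal row cost.
This is why the deviation inequality carries an extra weight factor. Summing over rows and averaging
gives one choice of samples good for the total (`exists_samples`), and `exists_guess` reads off the
guess.

On the machine side, `runs_regress` is the brute-force step, `runs_search` covers all guesses, and
`lowRankTime_le_pow` bounds the cost. -/

namespace RAM

/-! ### Frame rule and time bounds for programs -/

@[simp] theorem State.setReg_reg (s : State) (x v y : ℕ) :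
    (s.setReg x v).reg y = if y = x then v else s.reg y := by
  simp [State.setReg, Function.update_apply]

@[simp] theorem State.setReg_arr (s : State) (x v : ℕ) : (s.setReg x v).arr = s.arr := rfl

@[simp] theorem State.setArr_reg (s : State) (a i v : ℕ) : (s.setArr a i v).reg = s.reg := rfl

@[simp] theorem State.setArr_arr (s : State) (a i v b j : ℕ) :
    (s.setArr a i v).arr b j = if b = a ∧ j = i then v else s.arr b j := by
  by_cases hb : b = a
  · subst hb; simp [State.setArr, Function.update_apply]
  · simp [State.setArr, hb]

/-- The registers that a program may write. -/
def Program.wr : Program → ℕ → Bool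
  | .skip, _ => false
  | .const x _, y => y == x
  | .add x _ _, y => y == x
  | .sub x _ _, y => y == x
  | .load x _ _, y => y == x
  | .store _ _ _, _ => false
  | .seq p r, y => p.wr y || r.wr y
  | .ite _ p r, y => p.wr y || r.wr y
  | .loop _ p, y => p.wr y

/-- The arrays that a program may write. -/
def Program.wa : Program → ℕ → Bool
  | .skip, _ => false
  | .const _ _, _ => false
  | .add _ _ _, _ => false
  | .sub _ _ _, _ => false
  | .load _ _ _, _ => false
  | .store a _ _, b => b == a
  | .seq p r, y => p.wa y || r.wa y
  | .ite _ p r, y => p.wa y || r.wa y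
  | .loop _ p, y => p.wa y

/-- The states `s` and `s'` agree on everything that the program `p` does not write. -/
structure Frame (p : Program) (s s' : State) : Prop where
  reg : ∀ x, p.wr x = false → s'.reg x = s.reg x
  arr : ∀ a, p.wa a = false → s'.arr a = s.arr a

theorem Frame.refl (p : Program) (s : State) : Frame p s s := ⟨fun _ _ => rfl, fun _ _ => rfl⟩

theorem Frame.trans {p : Program} {s s' s'' : State} (h : Frame p s s') (h' : Frame p s' s'') :
    Frame p s s'' :=
  ⟨fun x hx => (h'.reg x hx).trans (h.reg x hx), fun a ha => (h'.arr a ha).trans (h.arr a ha)⟩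

theorem Frame.mono {p r : Program} {s s' : State} (h : Frame p s s')
    (hr : ∀ x, r.wr x = false → p.wr x = false) (ha : ∀ a, r.wa a = false → p.wa a = false) :
    Frame r s s' :=
  ⟨fun x hx => h.reg x (hr x hx), fun a hx => h.arr a (ha a hx)⟩

/-- The write sets are syntactic and Boolean, so for concrete programs the side conditions of this
frame rule mostly hold by computation (`rfl`). -/
theorem Exec.frame {p : Program} {s s' : State} {t : ℕ} (h : Exec p s t s') : Frame p s s' := by
  induction h with
  | skip => exact .refl _ _
  | const | add | sub | load =>
    refine ⟨fun y hy => ?_, fun _ _ => rfl⟩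
    simp only [Program.wr, beq_eq_false_iff_ne] at hy
    simp [hy]
  | store =>
    refine ⟨fun _ _ => rfl, fun b hb => ?_⟩
    simp only [Program.wa, beq_eq_false_iff_ne] at hb
    funext j
    simp [hb]
  | seq _ _ ih₁ ih₂ =>
    exact (ih₁.mono (by simp +contextual [Program.wr]) (by simp +contextual [Program.wa])).trans
      (ih₂.mono (by simp +contextual [Program.wr]) (by simp +contextual [Program.wa]))
  | ite_true _ _ ih =>
    exact ih.mono (by simp +contextual [Program.wr]) (by simp +contextual [Program.wa])
  | ite_false _ _ ih =>
    exact ih.mono (by simp +contextual [Program.wr]) (by simp +contextual [Program.wa])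
  | loop_done => exact .refl _ _
  | loop_step _ _ _ ih₁ ih₂ =>
    exact (ih₁.mono (by simp [Program.wr]) (by simp [Program.wa])).trans ih₂

/-- Started in `s`, the program `p` halts within `T` time units in the state `s'`. -/
def Runs (p : Program) (s : State) (T : ℕ) (s' : State) : Prop := ∃ t ≤ T, Exec p s t s'

section Runs

variable {p r : Program} {s s₁ s₂ : State} {T T₁ T₂ : ℕ}

theorem Runs.frame (h : Runs p s T s₁) : Frame p s s₁ := by
  obtain ⟨_, _, h⟩ := h
  exact h.frame

theorem Runs.mono (h : Runs p s T₁ s₁) (hT : T₁ ≤ T₂) : Runs p s T₂ s₁ := by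
  obtain ⟨t, ht, h⟩ := h
  exact ⟨t, ht.trans hT, h⟩

theorem Runs.seq (h₁ : Runs p s T₁ s₁) (h₂ : Runs r s₁ T₂ s₂) :
    Runs (.seq p r) s (T₁ + T₂) s₂ := by
  obtain ⟨t₁, ht₁, h₁⟩ := h₁
  obtain ⟨t₂, ht₂, h₂⟩ := h₂
  exact ⟨t₁ + t₂, by omega, .seq h₁ h₂⟩

theorem runs_skip (s : State) : Runs .skip s 1 s := ⟨1, le_rfl, .skip s⟩

theorem runs_const (s : State) (x c : ℕ) : Runs (.const x c) s 1 (s.setReg x c) :=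
  ⟨1, le_rfl, .const s x c⟩

theorem runs_add (s : State) (x y z : ℕ) :
    Runs (.add x y z) s 1 (s.setReg x (s.reg y + s.reg z)) := ⟨1, le_rfl, .add s x y z⟩

theorem runs_sub (s : State) (x y z : ℕ) :
    Runs (.sub x y z) s 1 (s.setReg x (s.reg y - s.reg z)) := ⟨1, le_rfl, .sub s x y z⟩

theorem runs_load (s : State) (x a y : ℕ) :
    Runs (.load x a y) s 1 (s.setReg x (s.arr a (s.reg y))) := ⟨1, le_rfl, .load s x a y⟩

theorem runs_store (s : State) (a y x : ℕ) :
    Runs (.store a y x) s 1 (s.setArr a (s.reg y) (s.reg x)) := ⟨1, le_rfl, .store s a y x⟩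

theorem Runs.ite_true {x : ℕ} (hx : s.reg x ≠ 0) (h : Runs p s T s₁) :
    Runs (.ite x p r) s (T + 1) s₁ := by
  obtain ⟨t, ht, h⟩ := h
  exact ⟨t + 1, by omega, .ite_true hx h⟩

theorem Runs.ite_false {x : ℕ} (hx : s.reg x = 0) (h : Runs r s T s₁) :
    Runs (.ite x p r) s (T + 1) s₁ := by
  obtain ⟨t, ht, h⟩ := h
  exact ⟨t + 1, by omega, .ite_false hx h⟩

end Runs

/-! ### Loops, multiplication, and enumeration of digit sequences -/

/-- Copy register `y` to register `x`, where `x ≠ y`. -/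
def mov (x y : ℕ) : Program := .seq (.const x 0) (.add x x y)

theorem runs_mov (s : State) {x y : ℕ} (h : y ≠ x) : Runs (mov x y) s 2 (s.setReg x (s.reg y)) := by
  have := (runs_const s x 0).seq (runs_add _ x x y)
  have h' : s.setReg x (s.reg y) = (s.setReg x 0).setReg x
      ((s.setReg x 0).reg x + (s.setReg x 0).reg y) := by
    ext z
    · by_cases hz : z = x <;> simp [hz, h]
    · simp
  rwa [h']

/-- Run `body` with register `i` holding `0, 1, …, reg N - 1` in turn; register `11` is used for
the loop test. -/
def forLoop (i N : ℕ) (body : Program) : Program :=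
  .seq (.const i 0) (.seq (.sub 11 N i) (.loop 11
    (.seq body (.seq (.const 11 1) (.seq (.add i i 11) (.sub 11 N i))))))

theorem forLoop_wr {i N x : ℕ} {body : Program} (h : (forLoop i N body).wr x = false) :
    x ≠ i ∧ x ≠ 11 ∧ body.wr x = false := by
  simp [forLoop, Program.wr] at h
  tauto

theorem forLoop_wa {i N a : ℕ} {body : Program} (h : (forLoop i N body).wa a = false) :
    body.wa a = false := by
  simpa [forLoop, Program.wa] using h

/-- Invariant rule for counted loops. `hI` demands that the invariant ignore the counter and
register `11`, which the loop control overwrites. Each round adds three control instructions and one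
test to the body; initialisation and the final test account for the `3`. -/
theorem runs_forLoop {i N n T : ℕ} {body : Program} {s₀ : State} (I : ℕ → State → Prop)
    (hn : s₀.reg N = n) (hi : i ≠ 11) (hiN : N ≠ i) (hN : N ≠ 11)
    (hbi : body.wr i = false) (hbN : body.wr N = false)
    (hI : ∀ j s s', (∀ x, x ≠ i → x ≠ 11 → s'.reg x = s.reg x) → s'.arr = s.arr → I j s → I j s')
    (h0 : I 0 s₀)
    (hstep : ∀ j < n, ∀ s, Frame (forLoop i N body) s₀ s → s.reg i = j → I j s →
      ∃ s', Runs body s T s' ∧ I (j + 1) s') :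
    ∃ s', Runs (forLoop i N body) s₀ (n * (T + 4) + 3) s' ∧ I n s' := by
  have key : ∀ m j s, m + j = n → Frame (forLoop i N body) s₀ s → s.reg i = j → s.reg 11 = m →
      s.reg N = n → I j s →
      ∃ s', Runs (.loop 11 (.seq body (.seq (.const 11 1) (.seq (.add i i 11) (.sub 11 N i)))))
        s (m * (T + 4) + 1) s' ∧ I n s' := by
    intro m
    induction m with
    | zero =>
      intro j s hj hF hsi hs11 _ hIj
      refine ⟨s, ⟨1, by omega, .loop_done hs11⟩, ?_⟩
      have : j = n := by omega
      rwa [← this]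
    | succ m ih =>
      intro j s hj hF hsi hs11 hsN hIj
      obtain ⟨s', hr, hI'⟩ := hstep j (by omega) s hF hsi hIj
      have hr2 := hr.seq ((runs_const s' 11 1).seq ((runs_add _ i i 11).seq (runs_sub _ 11 N i)))
      have hF' := hr.frame
      have h1 : s'.reg i = j := by rw [hF'.reg i hbi, hsi]
      have h2 : s'.reg N = n := by rw [hF'.reg N hbN, hsN]
      set s₂ := (((s'.setReg 11 1).setReg i ((s'.setReg 11 1).reg i +
        (s'.setReg 11 1).reg 11)).setReg 11
        (((s'.setReg 11 1).setReg i ((s'.setReg 11 1).reg i + (s'.setReg 11 1).reg 11)).reg N -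
        ((s'.setReg 11 1).setReg i ((s'.setReg 11 1).reg i + (s'.setReg 11 1).reg 11)).reg i))
        with hs₂
      have h3 : ∀ x, x ≠ i → x ≠ 11 → s₂.reg x = s'.reg x := fun x hx hx' => by
        simp [hs₂, hx, hx']
      have hfr : Frame (forLoop i N body) s₀ s₂ :=
        (hF.trans (hF'.mono (fun x h => (forLoop_wr h).2.2) (fun a h => forLoop_wa h))).trans
          ⟨fun x h => h3 x (forLoop_wr h).1 (forLoop_wr h).2.1, fun _ _ => rfl⟩
      obtain ⟨s'', hr3, hI3⟩ := ih (j + 1) s₂ (by omega) hfr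
        (by simp [hs₂, hi, h1]) (by simp [hs₂, hiN, hN, h2, h1, hi]; omega)
        (by rw [h3 N hiN hN, h2]) (hI _ _ _ h3 rfl hI')
      obtain ⟨t₁, ht₁, hr2⟩ := hr2
      obtain ⟨t₂, ht₂, hr3⟩ := hr3
      refine ⟨s'', ⟨t₁ + t₂ + 1, ?_, .loop_step (by omega) hr2 hr3⟩, hI3⟩
      rw [add_mul]; omega
  set s₂ := (s₀.setReg i 0).setReg 11 ((s₀.setReg i 0).reg N - (s₀.setReg i 0).reg i) with hs₂
  have h3 : ∀ x, x ≠ i → x ≠ 11 → s₂.reg x = s₀.reg x := fun x hx hx' => by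
    simp [hs₂, hx, hx']
  obtain ⟨s', hr, hI'⟩ := key n 0 s₂ (by omega)
    ⟨fun x h => h3 x (forLoop_wr h).1 (forLoop_wr h).2.1, fun _ _ => rfl⟩
    (by simp [hs₂, hi]) (by simp [hs₂, hiN, hn]) (by rw [h3 N hiN hN, hn]) (hI _ _ _ h3 rfl h0)
  exact ⟨s', ((runs_const s₀ i 0).seq ((runs_sub _ 11 N i).seq hr)).mono (by omega), hI'⟩

/-- `reg z := reg x * reg y`, in time linear in `reg y`; register `12` is used as a counter. -/
def mul (z x y : ℕ) : Program := .seq (.const z 0) (forLoop 12 y (.add z z x))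

theorem runs_mul (s : State) {z x y : ℕ} (hzx : x ≠ z) (hzy : y ≠ z) (hz : z ≠ 11) (hz' : z ≠ 12)
    (hx : x ≠ 11) (hx' : x ≠ 12) (hy : y ≠ 11) (hy' : y ≠ 12) :
    ∃ s', Runs (mul z x y) s (5 * s.reg y + 4) s' ∧ s'.reg z = s.reg x * s.reg y := by
  obtain ⟨s', hr, hI⟩ := runs_forLoop (i := 12) (N := y) (n := s.reg y) (T := 1)
    (body := .add z z x) (s₀ := s.setReg z 0) (fun j s' => s'.reg z = s.reg x * j)
    (by simp [hzy]) (by decide) hy' hy (by simp [Program.wr, hz'.symm])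
    (by simp [Program.wr, hzy]) (fun j s₁ s₂ h _ hI => by rw [h z hz' hz, hI])
    (by simp)
    (fun j _ s₁ hF _ hI => ⟨_, runs_add _ _ _ _, by
      have : s₁.reg x = s.reg x := by
        rw [hF.reg x (by simp [forLoop, Program.wr, hx, hx', hzx])]; simp [hzx]
      simp [hI, this]; ring⟩)
  exact ⟨s', ((runs_const s z 0).seq hr).mono (by omega), hI⟩

/-- Adding one propagates a carry into digit `i` exactly when `b ^ i ∣ c + 1`; the three cases are
carry absorbed, carry passed on, and no carry. -/
theorem succ_div_pow_mod (c i : ℕ) {b : ℕ} (hb : 0 < b) :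
    (b ^ i ∣ c + 1 → c / b ^ i % b + 1 < b →
      (c + 1) / b ^ i % b = c / b ^ i % b + 1 ∧ ¬ b ^ (i + 1) ∣ c + 1) ∧
    (b ^ i ∣ c + 1 → ¬ c / b ^ i % b + 1 < b →
      (c + 1) / b ^ i % b = 0 ∧ b ^ (i + 1) ∣ c + 1) ∧
    (¬ b ^ i ∣ c + 1 → (c + 1) / b ^ i % b = c / b ^ i % b ∧ ¬ b ^ (i + 1) ∣ c + 1) := by
  have hp : 0 < b ^ i := by positivity
  have hd : b ^ i ∣ c + 1 → (b ^ (i + 1) ∣ c + 1 ↔ (c + 1) / b ^ i % b = 0) := by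
    rintro ⟨g, hg⟩
    rw [hg, Nat.mul_div_cancel_left _ hp, pow_succ, Nat.mul_dvd_mul_iff_left hp,
      Nat.dvd_iff_mod_eq_zero]
  have hlt : c / b ^ i % b < b := Nat.mod_lt _ hb
  refine ⟨fun h h' => ?_, fun h h' => ?_, fun h => ⟨?_, fun h' => h ?_⟩⟩
  · have : (c + 1) / b ^ i % b = c / b ^ i % b + 1 := by
      rw [Nat.succ_div_of_dvd h, ← Nat.mod_add_mod, Nat.mod_eq_of_lt h']
    exact ⟨this, by rw [hd h]; omega⟩
  · have : (c + 1) / b ^ i % b = 0 := by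
      have hq : c / b ^ i % b + 1 = b := by omega
      rw [Nat.succ_div_of_dvd h, ← Nat.mod_add_mod, hq, Nat.mod_self]
    exact ⟨this, (hd h).2 this⟩
  · rw [Nat.succ_div_of_not_dvd h]
  · exact (pow_dvd_pow b (Nat.le_succ i)).trans h'

/-- Registers that are not used as scratch space by the subroutines. -/
def Keep (x : ℕ) : Prop := x < 11 ∨ 16 < x

instance (x : ℕ) : Decidable (Keep x) := inferInstanceAs (Decidable (_ ∨ _))

theorem Keep.ne {x : ℕ} (h : Keep x) :
    x ≠ 11 ∧ x ≠ 12 ∧ x ≠ 13 ∧ x ≠ 14 ∧ x ≠ 15 ∧ x ≠ 16 := by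
  unfold Keep at h; omega

/-- Increment the number whose digits to the base `reg base` are the first `reg len` cells of
array `a`. -/
def incr (a len base : ℕ) : Program :=
  .seq (.const 14 1) (forLoop 13 len
    (.ite 14
      (.seq (.load 15 a 13) (.seq (.const 16 1) (.seq (.add 15 15 16) (.seq (.sub 16 base 15)
        (.ite 16 (.seq (.store a 13 15) (.const 14 0))
          (.seq (.const 15 0) (.store a 13 15)))))))
      .skip))

theorem incr_wr {a len base x : ℕ} (h : Keep x) : (incr a len base).wr x = false := by
  simp [incr, forLoop, Program.wr, h.ne]

theorem incr_wa {a len base x : ℕ} (h : x ≠ a) : (incr a len base).wa x = false := by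
  simp [incr, forLoop, Program.wa, h]

theorem runs_incr {a len base ℓ b c : ℕ} {s : State} (hlen : Keep len) (hbase : Keep base)
    (hℓ : s.reg len = ℓ) (hb : s.reg base = b) (hb0 : 0 < b)
    (h : ∀ i < ℓ, s.arr a i = c / b ^ i % b) :
    ∃ s', Runs (incr a len base) s (12 * ℓ + 4) s' ∧
      ∀ i < ℓ, s'.arr a i = (c + 1) / b ^ i % b := by
  have hl := hlen.ne
  have hbs := hbase.ne
  obtain ⟨s', hr, hI, -⟩ := runs_forLoop (i := 13) (N := len) (n := ℓ) (T := 8)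
    (s₀ := s.setReg 14 1)
    (body := .ite 14
      (.seq (.load 15 a 13) (.seq (.const 16 1) (.seq (.add 15 15 16) (.seq (.sub 16 base 15)
        (.ite 16 (.seq (.store a 13 15) (.const 14 0))
          (.seq (.const 15 0) (.store a 13 15))))))) .skip)
    -- Digits below `i` are already those of `c + 1`, the others still those of `c`, and register
    -- `14` is the carry into position `i`.
    (fun i s' => (∀ j < i, s'.arr a j = (c + 1) / b ^ j % b) ∧
      (∀ j, i ≤ j → j < ℓ → s'.arr a j = c / b ^ j % b) ∧
      (b ^ i ∣ c + 1 → s'.reg 14 = 1) ∧ (¬ b ^ i ∣ c + 1 → s'.reg 14 = 0))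
    (by simp [hl, hℓ]) (by decide) hl.2.2.1 hl.1 (by simp [Program.wr]) (by simp [Program.wr, hl])
    (fun i s₁ s₂ hreg harr hI => by simpa [harr, hreg 14] using hI)
    (by simpa using h) (by
      intro i hi s₁ hF hs13 ⟨h1, h2, h3, h4⟩
      have hB : s₁.reg base = b := by
        rw [hF.reg base (by simp [forLoop, Program.wr, hbs])]; simp [hbs, hb]
      obtain ⟨d1, d2, d3⟩ := succ_div_pow_mod c i hb0
      have hcell := h2 i le_rfl hi
      by_cases hd : b ^ i ∣ c + 1
      · have h14 := h3 hd
        by_cases hlt : c / b ^ i % b + 1 < b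
        · obtain ⟨e1, e2⟩ := d1 hd hlt
          refine ⟨_, (Runs.ite_true (by omega) ((runs_load _ 15 a 13).seq ((runs_const _ 16 1).seq
            ((runs_add _ 15 15 16).seq ((runs_sub _ 16 base 15).seq (Runs.ite_true ?_
            ((runs_store _ a 13 15).seq (runs_const _ 14 0)))))))).mono (by omega), ?_, ?_, ?_, ?_⟩
          · simp [hs13, hcell, hbs, hB]; omega
          · intro j hj
            rcases Nat.lt_succ_iff_lt_or_eq.1 hj with hj | rfl
            · simp [hs13, h1 j hj, hj.ne]
            · simp [hs13, hcell, e1]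
          · intro j hj hjl
            have : j ≠ i := by omega
            simp [hs13, this, h2 j (by omega) hjl]
          · intro h; exact absurd h e2
          · simp
        · obtain ⟨e1, e2⟩ := d2 hd hlt
          refine ⟨_, (Runs.ite_true (by omega) ((runs_load _ 15 a 13).seq ((runs_const _ 16 1).seq
            ((runs_add _ 15 15 16).seq ((runs_sub _ 16 base 15).seq (Runs.ite_false ?_
            ((runs_const _ 15 0).seq (runs_store _ a 13 15)))))))).mono (by omega), ?_, ?_, ?_, ?_⟩
          · simp [hs13, hcell, hbs, hB]; omega
          · intro j hj
            rcases Nat.lt_succ_iff_lt_or_eq.1 hj with hj | rfl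
            · simp [hs13, h1 j hj, hj.ne]
            · simp [hs13, e1]
          · intro j hj hjl
            have : j ≠ i := by omega
            simp [hs13, this, h2 j (by omega) hjl]
          · simp [h14]
          · intro h; exact absurd e2 h
      · obtain ⟨e1, e2⟩ := d3 hd
        refine ⟨_, (Runs.ite_false (h4 hd) (runs_skip _)).mono (by omega), ?_, ?_, ?_, ?_⟩
        · intro j hj
          rcases Nat.lt_succ_iff_lt_or_eq.1 hj with hj | rfl
          · exact h1 j hj
          · rw [hcell, e1]
        · exact fun j hj => h2 j (by omega)
        · exact fun h => absurd h e2
        · exact fun _ => h4 hd)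
  exact ⟨s', ((runs_const s 14 1).seq hr).mono (by omega), hI⟩

/-- Run `body` with the first `reg len` cells of array `a` running through all sequences of
numbers below `reg base`; registers `N` and `c` hold the number of these sequences and a
counter. -/
def enumerate (a len base N c : ℕ) (body : Program) : Program :=
  .seq (.const N 1) (.seq
    (forLoop 13 len (.seq (mul 15 N base) (.seq (mov N 15) (.seq (.const 15 0) (.store a 13 15)))))
    (forLoop c N (.seq body (incr a len base))))

theorem enumerate_wr {a len base N c x : ℕ} {body : Program} (hx : Keep x) (hN : x ≠ N)
    (hc : x ≠ c) (h : body.wr x = false) : (enumerate a len base N c body).wr x = false := by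
  simp [enumerate, forLoop, mul, mov, Program.wr, incr_wr, hx, hx.ne, hN, hc, h]

theorem enumerate_wr' {a len base N c x : ℕ} {body : Program}
    (h : (enumerate a len base N c body).wr x = false) :
    Keep x ∧ x ≠ N ∧ x ≠ c ∧ body.wr x = false := by
  simp [enumerate, forLoop, mul, mov, Program.wr, incr] at h
  unfold Keep
  refine ⟨by omega, by tauto, by tauto, by tauto⟩

theorem enumerate_wa' {a len base N c x : ℕ} {body : Program}
    (h : (enumerate a len base N c body).wa x = false) : x ≠ a ∧ body.wa x = false := by
  simp [enumerate, forLoop, mul, mov, Program.wa, incr] at h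
  tauto

/-- The running time of `enumerate` with `ℓ` digits to the base `b` and a body of running
time `T`. -/
def enumerateTime (ℓ b T : ℕ) : ℕ := b ^ ℓ * (T + 12 * ℓ + 8) + ℓ * (5 * b + 12) + 7

/-- `Vis i v` is to be read as "candidate `i` has been taken into account once the record in
register `r` is `v`". The record never decreases and `Vis` is monotone in it, so what each round
achieves survives to the end. `Inv` may not depend on the scratch registers or on the digit array.
-/
theorem runs_enumerate {a len base N c ℓ b T : ℕ} {body : Program} {s₀ : State} (r : ℕ)
    (Inv : State → Prop) (Vis : ℕ → ℕ → Prop)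
    (hℓ : s₀.reg len = ℓ) (hb : s₀.reg base = b) (hb0 : 0 < b)
    (hlen : Keep len) (hbase : Keep base) (hN : Keep N) (hc : Keep c) (hr : Keep r)
    (hNc : N ≠ c) (hlN : len ≠ N) (hlc : len ≠ c) (hbN : base ≠ N) (hbc : base ≠ c)
    (hrN : r ≠ N) (hrc : r ≠ c)
    (wN : body.wr N = false) (wc : body.wr c = false) (wlen : body.wr len = false)
    (wbase : body.wr base = false) (wa : body.wa a = false)
    (hInv : ∀ s s', (∀ x, Keep x → x ≠ N → x ≠ c → s'.reg x = s.reg x) →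
      (∀ x, x ≠ a → s'.arr x = s.arr x) → Inv s → Inv s')
    (hVis : ∀ i v w, v ≤ w → Vis i v → Vis i w)
    (h0 : Inv s₀)
    (hstep : ∀ i < b ^ ℓ, ∀ s, Frame (enumerate a len base N c body) s₀ s →
      (∀ j < ℓ, s.arr a j = i / b ^ j % b) → Inv s →
      ∃ s', Runs body s T s' ∧ Inv s' ∧ s.reg r ≤ s'.reg r ∧ Vis i (s'.reg r)) :
    ∃ s', Runs (enumerate a len base N c body) s₀ (enumerateTime ℓ b T) s' ∧ Inv s' ∧
      s₀.reg r ≤ s'.reg r ∧ ∀ i < b ^ ℓ, Vis i (s'.reg r) := by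
  have nN := hN.ne
  have nc := hc.ne
  have nl := hlen.ne
  have nb := hbase.ne
  have nr := hr.ne
  obtain ⟨s₁, hr₁, hN₁, hz₁⟩ := runs_forLoop (i := 13) (N := len) (n := ℓ) (T := 5 * b + 8)
    (s₀ := s₀.setReg N 1)
    (body := .seq (mul 15 N base) (.seq (mov N 15) (.seq (.const 15 0) (.store a 13 15))))
    (fun i s => s.reg N = b ^ i ∧ ∀ j < i, s.arr a j = 0)
    (by simp [hlN, hℓ]) (by decide) nl.2.2.1 nl.1 (by simp [Program.wr, mul, mov, forLoop, nN.2.2.1.symm])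
    (by simp [Program.wr, mul, mov, forLoop, nl, hlN])
    (fun i s s' hreg harr hI => by simpa [harr, hreg N nN.2.2.1 nN.1] using hI)
    (by simp) (by
      intro i hi s hF hs13 ⟨hs1, hs2⟩
      obtain ⟨s', hr, hv⟩ := runs_mul s (z := 15) (x := N) (y := base) nN.2.2.2.2.1 nb.2.2.2.2.1
        (by decide) (by decide) nN.1 nN.2.1 nb.1 nb.2.1
      have hB : s.reg base = b := by
        rw [hF.reg base (by simp [forLoop, mul, mov, Program.wr, nb, hbN])]; simp [hbN, hb]
      have h13 : s'.reg 13 = i := by rw [hr.frame.reg 13 rfl, hs13]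
      refine ⟨_, (hr.seq ((runs_mov s' (x := N) (y := 15) nN.2.2.2.2.1.symm).seq ((runs_const _ 15 0).seq
        (runs_store _ a 13 15)))).mono (by rw [hB]), ?_, ?_⟩
      · simp [nN, hv, hs1, hB, pow_succ]
      · intro j hj
        have := hs2 j
        have h4 : s'.arr a j = s.arr a j := by rw [hr.frame.arr a rfl]
        simp only [State.setReg_reg, State.setArr_arr, State.setReg_arr]
        simp [nN.2.2.1.symm, h13, h4]
        intro hji
        exact this (by omega))
  have hF₁ := hr₁.frame
  have f₁ : ∀ x, Keep x → x ≠ N → s₁.reg x = s₀.reg x := fun x hx hxN => by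
    rw [hF₁.reg x (by simp [forLoop, mul, mov, Program.wr, hx.ne, hxN])]; simp [hxN]
  have g₁ : ∀ x, x ≠ a → s₁.arr x = s₀.arr x := fun x hx => by
    rw [hF₁.arr x (by simp [forLoop, mul, mov, Program.wa, hx])]; simp
  obtain ⟨s₂, hr₂, -, hI₂, hrr, hV⟩ := runs_forLoop (i := c) (N := N) (n := b ^ ℓ)
    (T := T + (12 * ℓ + 4)) (s₀ := s₁) (body := .seq body (incr a len base))
    (fun i s => (∀ j < ℓ, s.arr a j = i / b ^ j % b) ∧ Inv s ∧ s₀.reg r ≤ s.reg r ∧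
      ∀ i' < i, Vis i' (s.reg r))
    hN₁ nc.1 hNc nN.1 (by simp [Program.wr, wc, incr_wr hc]) (by simp [Program.wr, wN, incr_wr hN])
    (fun i s s' hreg harr ⟨h1, h2, h3, h4⟩ => by
      rw [harr, hreg r hrc nr.1]
      exact ⟨h1, hInv s s' (fun x hx _ hx' => hreg x hx' hx.ne.1) (fun x _ => by rw [harr]) h2,
        h3, h4⟩)
    ⟨fun j hj => by simp [hz₁ j hj], hInv s₀ s₁ (fun x hx hx' _ => f₁ x hx hx') g₁ h0,
      by rw [f₁ r hr hrN], by simp⟩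
    (by
      intro i hi s hF hsc ⟨h1, h2, h3, h4⟩
      have hF' : Frame (enumerate a len base N c body) s₀ s := by
        refine ⟨fun x hx => ?_, fun x hx => ?_⟩
        · have := enumerate_wr' hx
          rw [hF.reg x, f₁ x this.1 this.2.1]
          simp [forLoop, Program.wr, this, this.1.ne, incr_wr]
        · have := enumerate_wa' hx
          rw [hF.arr x, g₁ x this.1]
          simp [forLoop, Program.wa, this, incr_wa]
      obtain ⟨s', hr', hI', hle, hvis⟩ := hstep i hi s hF' h1 h2
      have e1 : s'.reg len = ℓ := by
        rw [hr'.frame.reg len wlen, hF'.reg len (enumerate_wr hlen hlN hlc wlen), hℓ]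
      have e2 : s'.reg base = b := by
        rw [hr'.frame.reg base wbase, hF'.reg base (enumerate_wr hbase hbN hbc wbase), hb]
      obtain ⟨s'', hr'', h1''⟩ := runs_incr (a := a) (c := i) (s := s') hlen hbase e1 e2 hb0
        (fun j hj => by rw [hr'.frame.arr a wa]; exact h1 j hj)
      have e3 : s''.reg r = s'.reg r := hr''.frame.reg r (incr_wr hr)
      refine ⟨s'', hr'.seq hr'', h1'', ?_, by omega, fun i' hi' => ?_⟩
      · exact hInv s' s'' (fun x hx _ _ => hr''.frame.reg x (incr_wr hx))
          (fun x hx => hr''.frame.arr x (incr_wa hx)) hI'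
      · rw [e3]
        rcases Nat.lt_succ_iff_lt_or_eq.1 hi' with hi' | rfl
        · exact hVis _ _ _ hle (h4 i' hi')
        · exact hvis)
  refine ⟨s₂, ((runs_const _ N 1).seq (hr₁.seq hr₂)).mono ?_, hI₂, hrr, hV⟩
  unfold enumerateTime
  rw [show T + (12 * ℓ + 4) + 4 = T + 12 * ℓ + 8 by ring, show 5 * b + 8 + 4 = 5 * b + 12 by ring]
  omega

/-- Write `f 0, …, f (N - 1)` to the first `N` cells of array `a`. -/
def loadTable (a : ℕ) (f : ℕ → ℕ) : ℕ → Program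
  | 0 => .skip
  | N + 1 => .seq (loadTable a f N)
      (.seq (.const 15 N) (.seq (.const 16 (f N)) (.store a 15 16)))

theorem loadTable_wr (a : ℕ) (f : ℕ → ℕ) (N : ℕ) {x : ℕ} (hx : Keep x) :
    (loadTable a f N).wr x = false := by
  induction N with
  | zero => rfl
  | succ N ih => simp [loadTable, Program.wr, ih, hx.ne]

theorem loadTable_wa (a : ℕ) (f : ℕ → ℕ) (N : ℕ) {x : ℕ} (hx : x ≠ a) :
    (loadTable a f N).wa x = false := by
  induction N with
  | zero => rfl
  | succ N ih => simp [loadTable, Program.wa, ih, hx]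

theorem runs_loadTable (a : ℕ) (f : ℕ → ℕ) (N : ℕ) (s : State) :
    ∃ s', Runs (loadTable a f N) s (3 * N + 1) s' ∧ ∀ i < N, s'.arr a i = f i := by
  induction N with
  | zero => exact ⟨s, runs_skip s, by simp⟩
  | succ N ih =>
    obtain ⟨s', hr, h⟩ := ih
    refine ⟨_, (hr.seq ((runs_const _ 15 N).seq ((runs_const _ 16 (f N)).seq
      (runs_store _ a 15 16)))).mono (by omega), fun i hi => ?_⟩
    rcases Nat.lt_succ_iff_lt_or_eq.1 hi with hi | rfl
    · simp [hi.ne, h i hi]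
    · simp

end RAM

namespace LowRank

open RAM Finset

/-! ### Field elements as numbers -/

section Encoding

variable {F : Type*} {q : ℕ} (e : F ≃ Fin q)

/-- The number of a field element. -/
def enc (x : F) : ℕ := e x

/-- The field element with a given number. -/
def dec [Zero F] (x : ℕ) : F := if h : x < q then e.symm ⟨x, h⟩ else 0

theorem enc_lt (x : F) : enc e x < q := (e x).2

@[simp] theorem dec_enc [Zero F] (x : F) : dec e (enc e x) = x := by
  simp [dec, enc]

theorem enc_dec [Zero F] {x : ℕ} (h : x < q) : enc e (dec e x) = x := by
  simp [dec, enc, h]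

theorem enc_inj {x y : F} : enc e x = enc e y ↔ x = y :=
  ⟨fun h => e.injective (Fin.ext h), fun h => by rw [h]⟩

/-- The data of a weighted system of equations: the coefficients are in array `w`, the right hand
sides in array `9`, the weights in array `m`, and their number in register `len`. -/
structure System (k w m len : ℕ) (W : ℕ → ℕ → F) (b : ℕ → F) (wt : ℕ → ℕ) (ℓ : ℕ)
    (s : State) : Prop where
  len : s.reg len = ℓ
  coeff : ∀ i < ℓ, ∀ l < k, s.arr w (i * k + l) = enc e (W i l)
  rhs : ∀ i < ℓ, s.arr 9 i = enc e (b i)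
  weight : ∀ i < ℓ, s.arr m i = wt i

variable {e} in
theorem System.frame {k w m len : ℕ} {W : ℕ → ℕ → F} {b : ℕ → F} {wt : ℕ → ℕ} {ℓ : ℕ}
    {s s' : State} (h : System e k w m len W b wt ℓ s) {p : Program} (hF : Frame p s s')
    (hlen : p.wr len = false) (hw : p.wa w = false) (h9 : p.wa 9 = false) (hm : p.wa m = false) :
    System e k w m len W b wt ℓ s' :=
  ⟨(hF.reg _ hlen).trans h.len, by rw [hF.arr w hw]; exact h.coeff,
    by rw [hF.arr 9 h9]; exact h.rhs, by rw [hF.arr m hm]; exact h.weight⟩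

theorem fma_index_lt (x y z : F) : (enc e x * q + enc e y) * q + enc e z < q * q * q := by
  have h1 := enc_lt e x
  have h2 := enc_lt e y
  have h3 := enc_lt e z
  have : enc e x * q + enc e y + 1 ≤ q * q := by nlinarith
  nlinarith

end Encoding

/-! ### Table-driven field arithmetic and brute-force regression -/

section Algorithm

variable {F : Type*} [Field F] {q : ℕ} (e : F ≃ Fin q)

/-- The table of the operation `(x, y, z) ↦ x + y * z` on the numbers of field elements. -/
def fmaTable (m : ℕ) : ℕ := enc e (dec e (m / q / q) + dec e (m / q % q) * dec e (m % q))

theorem fmaTable_enc (x y z : F) :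
    fmaTable e ((enc e x * q + enc e y) * q + enc e z) = enc e (x + y * z) := by
  have hq : 0 < q := (Nat.zero_le _).trans_lt (enc_lt e x)
  have h1 : ((enc e x * q + enc e y) * q + enc e z) / q = enc e x * q + enc e y := by
    rw [mul_comm, Nat.mul_add_div hq, Nat.div_eq_of_lt (enc_lt e z), add_zero]
  have h2 : (enc e x * q + enc e y) / q = enc e x := by
    rw [mul_comm, Nat.mul_add_div hq, Nat.div_eq_of_lt (enc_lt e y), add_zero]
  rw [fmaTable, h1, h2, Nat.mul_add_mod', Nat.mul_add_mod', Nat.mod_eq_of_lt (enc_lt e z),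
    Nat.mod_eq_of_lt (enc_lt e y)]
  simp

/-- Register `29` receives the inner product of the vector in array `7` with row `reg 27` of the
matrix in array `w`. -/
def dotProg (w : ℕ) : Program :=
  .seq (.const 29 (enc e 0)) (.seq (mul 30 27 2) (forLoop 28 2
    (.seq (.add 31 30 28) (.seq (.load 31 w 31) (.seq (mul 32 29 3) (.seq (.load 36 7 28)
      (.seq (.add 32 32 36) (.seq (mul 36 32 3) (.seq (.add 36 36 31) (.load 29 3 36))))))))))

/-- The contents of registers and arrays that stay fixed: the format of the input and the table of
the field operations. -/
structure Fixed (n d k : ℕ) (s : State) : Prop where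
  reg0 : s.reg 0 = n
  reg1 : s.reg 1 = d
  reg2 : s.reg 2 = k
  reg3 : s.reg 3 = q
  table : ∀ m < q * q * q, s.arr 3 m = fmaTable e m

variable {e}

theorem Fixed.frame {n d k : ℕ} {s s' : State} {p : Program} (h : Fixed e n d k s)
    (hF : Frame p s s') (h0 : p.wr 0 = false) (h1 : p.wr 1 = false) (h2 : p.wr 2 = false)
    (h3 : p.wr 3 = false) (ha : p.wa 3 = false) : Fixed e n d k s' :=
  ⟨(hF.reg 0 h0).trans h.reg0, (hF.reg 1 h1).trans h.reg1, (hF.reg 2 h2).trans h.reg2,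
    (hF.reg 3 h3).trans h.reg3, by rw [hF.arr 3 ha]; exact h.table⟩

/-- A bound on the running time of `dotProg`. -/
def dotTime (k q : ℕ) : ℕ := k * (10 * q + 18) + (5 * k + 8)

theorem runs_dotProg {n d k : ℕ} {s : State} (hs : Fixed e n d k s) {w i : ℕ} (hi : s.reg 27 = i)
    {x y : ℕ → F} (hx : ∀ l < k, s.arr 7 l = enc e (x l))
    (hy : ∀ l < k, s.arr w (i * k + l) = enc e (y l)) :
    ∃ s', Runs (dotProg e w) s (dotTime k q) s' ∧
      s'.reg 29 = enc e (∑ l ∈ range k, x l * y l) := by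
  obtain ⟨s₁, hr₁, h₁⟩ := runs_mul (s.setReg 29 (enc e 0)) (z := 30) (x := 27) (y := 2)
    (by decide) (by decide) (by decide) (by decide) (by decide) (by decide) (by decide) (by decide)
  have hF₁ := ((runs_const s 29 (enc e 0)).seq hr₁).frame
  have hs₁ : Fixed e n d k s₁ := hs.frame hF₁ rfl rfl rfl rfl rfl
  obtain ⟨s₂, hr₂, h₂⟩ := runs_forLoop (i := 28) (N := 2) (n := k) (T := 10 * q + 14) (s₀ := s₁)
    (body := .seq (.add 31 30 28) (.seq (.load 31 w 31) (.seq (mul 32 29 3) (.seq (.load 36 7 28)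
      (.seq (.add 32 32 36) (.seq (mul 36 32 3) (.seq (.add 36 36 31) (.load 29 3 36))))))))
    (fun i s => s.reg 29 = enc e (∑ l ∈ range i, x l * y l))
    hs₁.reg2 (by decide) (by decide) (by decide) rfl rfl
    (fun i s s' hreg harr hI => by rw [hreg 29 (by decide) (by decide)]; exact hI)
    (by rw [hr₁.frame.reg 29 rfl]; simp)
    (by
      intro l hl s' hF hsl hI
      have hs' : Fixed e n d k s' := hs₁.frame hF rfl rfl rfl rfl rfl
      have h30 : s'.reg 30 = i * k := by
        rw [hF.reg 30 rfl, h₁]; simp [hi, hs.reg2]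
      have h7 : s'.arr 7 l = enc e (x l) := by rw [hF.arr 7 rfl, hF₁.arr 7 rfl, hx l hl]
      have hw : s'.arr w (i * k + l) = enc e (y l) := by rw [hF.arr w rfl, hF₁.arr w rfl, hy l hl]
      set s₃ := (s'.setReg 31 (s'.reg 30 + s'.reg 28)).setReg 31
        ((s'.setReg 31 (s'.reg 30 + s'.reg 28)).arr w
          ((s'.setReg 31 (s'.reg 30 + s'.reg 28)).reg 31)) with hs₃
      have hr₃ := (runs_add s' 31 30 28).seq (runs_load _ 31 w 31)
      rw [← hs₃] at hr₃
      have e31 : s₃.reg 31 = enc e (y l) := by simp [hs₃, h30, hsl, hw]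
      obtain ⟨s₄, hr₄, h₄⟩ := runs_mul s₃ (z := 32) (x := 29) (y := 3)
        (by decide) (by decide) (by decide) (by decide) (by decide) (by decide) (by decide)
        (by decide)
      have e29 : s₃.reg 29 = enc e (∑ l ∈ range l, x l * y l) := by rw [hr₃.frame.reg 29 rfl, hI]
      have e3 : s₃.reg 3 = q := by rw [hr₃.frame.reg 3 rfl, hs'.reg3]
      set s₅ := (s₄.setReg 36 (s₄.arr 7 (s₄.reg 28))).setReg 32
        ((s₄.setReg 36 (s₄.arr 7 (s₄.reg 28))).reg 32 +
          (s₄.setReg 36 (s₄.arr 7 (s₄.reg 28))).reg 36) with hs₅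
      have hr₅ := (runs_load s₄ 36 7 28).seq (runs_add _ 32 32 36)
      rw [← hs₅] at hr₅
      obtain ⟨s₆, hr₆, h₆⟩ := runs_mul s₅ (z := 36) (x := 32) (y := 3)
        (by decide) (by decide) (by decide) (by decide) (by decide) (by decide) (by decide)
        (by decide)
      have f28 : s₄.reg 28 = l := by rw [hr₄.frame.reg 28 rfl, hr₃.frame.reg 28 rfl, hsl]
      have f7 : s₄.arr 7 l = enc e (x l) := by
        rw [hr₄.frame.arr 7 rfl, hr₃.frame.arr 7 rfl, h7]
      have f32 : s₅.reg 32 = enc e (∑ l ∈ range l, x l * y l) * q + enc e (x l) := by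
        simp [hs₅, h₄, f28, f7, e29, e3]
      have f3 : s₅.reg 3 = q := by rw [hr₅.frame.reg 3 rfl, hr₄.frame.reg 3 rfl, e3]
      have f31 : s₆.reg 31 = enc e (y l) := by
        rw [hr₆.frame.reg 31 rfl, hr₅.frame.reg 31 rfl, hr₄.frame.reg 31 rfl, e31]
      have f3a : s₆.arr 3 = s'.arr 3 := by
        rw [hr₆.frame.arr 3 rfl, hr₅.frame.arr 3 rfl, hr₄.frame.arr 3 rfl, hr₃.frame.arr 3 rfl]
      refine ⟨_, ((runs_add s' 31 30 28).seq ((runs_load _ 31 w 31).seq (hr₄.seq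
        ((runs_load _ 36 7 28).seq ((runs_add _ 32 32 36).seq (hr₆.seq ((runs_add _ 36 36 31).seq
          (runs_load _ 29 3 36)))))))).mono (by rw [e3, f3]; omega), ?_⟩
      simp only [State.setReg_reg, State.setReg_arr, if_true, h₆, f32, f3, f31, f3a]
      -- The computed address has the running sum, `x l` and `y l` as its three base-`q` digits, so
      -- a single table lookup performs one multiply-and-add.
      rw [hs'.table _ (fma_index_lt e _ _ _), fmaTable_enc, sum_range_succ])
  refine ⟨s₂, ((runs_const s 29 (enc e 0)).seq (hr₁.seq hr₂)).mono ?_, h₂⟩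
  have : (s.setReg 29 (enc e 0)).reg 2 = k := by simp [hs.reg2]
  rw [this, show 10 * q + 14 + 4 = 10 * q + 18 by ring]
  unfold dotTime
  omega

open Classical in
/-- The total weight, with weights `m`, of the equations `⟨x, W s⟩ = b s`, `s < ℓ`, that `x`
satisfies. -/
noncomputable def score (W : ℕ → ℕ → F) (b : ℕ → F) (m : ℕ → ℕ) (ℓ k : ℕ) (x : ℕ → F) : ℕ :=
  ∑ s ∈ range ℓ, if ∑ l ∈ range k, x l * W s l = b s then m s else 0

theorem score_congr {W W' : ℕ → ℕ → F} {b b' : ℕ → F} {m m' : ℕ → ℕ} {ℓ k : ℕ} {x x' : ℕ → F}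
    (hW : ∀ s < ℓ, ∀ l < k, W s l = W' s l) (hb : ∀ s < ℓ, b s = b' s) (hm : ∀ s < ℓ, m s = m' s)
    (hx : ∀ l < k, x l = x' l) : score W b m ℓ k x = score W' b' m' ℓ k x' := by
  refine sum_congr rfl fun s hs => ?_
  have hs := mem_range.1 hs
  rw [hb s hs, hm s hs, sum_congr rfl fun l hl => by
    rw [hx l (mem_range.1 hl), hW s hs l (mem_range.1 hl)]]

variable (e) in
/-- Register `26` receives one plus the score of the vector in array `7`. -/
def scoreProg (w m len : ℕ) : Program :=
  .seq (.const 26 1) (forLoop 27 len (.seq (dotProg e w) (.seq (.load 30 9 27)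
    (.seq (.sub 31 29 30) (.seq (.sub 32 30 29) (.seq (.add 31 31 32)
      (.ite 31 .skip (.seq (.load 30 m 27) (.add 26 26 30)))))))))

/-- A bound on the running time of `scoreProg` with `ℓ` equations. -/
def scoreTime (ℓ k q : ℕ) : ℕ := ℓ * (dotTime k q + 11) + 4

theorem runs_scoreProg {n d k : ℕ} {s : State} (hs : Fixed e n d k s) {w m len : ℕ}
    {W : ℕ → ℕ → F} {b : ℕ → F} {wt : ℕ → ℕ} {ℓ : ℕ} (hS : System e k w m len W b wt ℓ s)
    (hlen : len < 11) {x : ℕ → F} (hx : ∀ l < k, s.arr 7 l = enc e (x l)) :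
    ∃ s', Runs (scoreProg e w m len) s (scoreTime ℓ k q) s' ∧
      s'.reg 26 = score W b wt ℓ k x + 1 := by
  have wlen : ∀ y, 11 ≤ y → len ≠ y := fun y hy h => by omega
  have wlen' : (scoreProg e w m len).wr len = false := by
    simp [scoreProg, dotProg, mul, forLoop, Program.wr, wlen]
  obtain ⟨s₂, hr₂, h₂⟩ := runs_forLoop (i := 27) (N := len) (n := ℓ) (T := dotTime k q + 7)
    (s₀ := s.setReg 26 1)
    (body := .seq (dotProg e w) (.seq (.load 30 9 27)
    (.seq (.sub 31 29 30) (.seq (.sub 32 30 29) (.seq (.add 31 31 32)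
      (.ite 31 .skip (.seq (.load 30 m 27) (.add 26 26 30))))))))
    (fun i s => s.reg 26 = score W b wt i k x + 1)
    (by simp [wlen, hS.len]) (by decide) (wlen 27 (by decide)) (wlen 11 (by decide)) rfl
    (by simp [dotProg, mul, forLoop, Program.wr, wlen])
    (fun i s s' hreg harr hI => by rw [hreg 26 (by decide) (by decide)]; exact hI)
    (by simp [score])
    (by
      intro i hi s' hF hsi hI
      have hF' : Frame (scoreProg e w m len) s s' :=
        ((runs_const s 26 1).frame.mono (r := scoreProg e w m len)
          (by simp +contextual [scoreProg, Program.wr])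
          (by simp [Program.wa])).trans
        (hF.mono (by simp +contextual [scoreProg, Program.wr])
          (by simp +contextual [scoreProg, Program.wa]))
      have hs' : Fixed e n d k s' := hs.frame hF' rfl rfl rfl rfl rfl
      have hS' := hS.frame hF' wlen' rfl rfl rfl
      obtain ⟨s₁, hr₁, h₁⟩ := runs_dotProg hs' hsi (x := x) (y := W i)
        (by rw [hF'.arr 7 rfl]; exact hx) (hS'.coeff i hi)
      have hS₁ := hS'.frame hr₁.frame (by simp [dotProg, mul, forLoop, Program.wr, wlen])
        rfl rfl rfl
      have h27 : s₁.reg 27 = i := by rw [hr₁.frame.reg 27 rfl, hsi]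
      have h26 : s₁.reg 26 = score W b wt i k x + 1 := by rw [hr₁.frame.reg 26 rfl, hI]
      have h9 := hS₁.rhs i hi
      -- Register `31` is the sum of the two truncated differences, which vanishes exactly when the
      -- two codes agree.
      by_cases heq : ∑ l ∈ range k, x l * W i l = b i
      · refine ⟨_, (hr₁.seq ((runs_load _ 30 9 27).seq ((runs_sub _ 31 29 30).seq
          ((runs_sub _ 32 30 29).seq ((runs_add _ 31 31 32).seq (Runs.ite_false ?_
            ((runs_load _ 30 m 27).seq (runs_add _ 26 26 30)))))))).mono (by omega), ?_⟩
        · simp [h27, h₁, h9, heq]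
        · simp [h27, h26, hS₁.weight i hi, score, sum_range_succ, heq]; omega
      · refine ⟨_, (hr₁.seq ((runs_load _ 30 9 27).seq ((runs_sub _ 31 29 30).seq
          ((runs_sub _ 32 30 29).seq ((runs_add _ 31 31 32).seq (Runs.ite_true ?_
            (runs_skip _))))))).mono (by omega), ?_⟩
        · have : enc e (∑ l ∈ range k, x l * W i l) ≠ enc e (b i) := fun h =>
            heq ((enc_inj e).1 h)
          simp [h27, h₁, h9]; omega
        · simp [h26, score, sum_range_succ, heq])
  refine ⟨s₂, ((runs_const s 26 1).seq hr₂).mono ?_, h₂⟩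
  unfold scoreTime
  rw [show dotTime k q + 7 + 4 = dotTime k q + 11 by ring]
  omega

variable (e) in
/-- Array `8` receives a vector of maximum score, and register `25` one plus its score. -/
def regress (w m len : ℕ) : Program :=
  .seq (.const 25 0) (enumerate 7 2 3 17 18 (.seq (scoreProg e w m len) (.seq (.sub 30 26 25)
    (.ite 30 (.seq (mov 25 26) (forLoop 27 2 (.seq (.load 30 7 27) (.store 8 27 30)))) .skip))))

/-- A bound on the running time of `regress` with `ℓ` equations. -/
def regressTime (ℓ k q : ℕ) : ℕ := enumerateTime k q (scoreTime ℓ k q + 6 * k + 7) + 1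

theorem regress_wr {w m len x : ℕ} (hx : x < 11 ∨ 32 < x) (h36 : x ≠ 36) :
    (regress e w m len).wr x = false := by
  simp [regress, enumerate, incr, scoreProg, dotProg, mul, mov, forLoop, Program.wr]
  omega

/-- Enumerating the numbers below `b ^ ℓ` therefore meets every candidate sequence. -/
theorem exists_digits {b ℓ : ℕ} {f : ℕ → ℕ} (hf : ∀ i < ℓ, f i < b) :
    ∃ c < b ^ ℓ, ∀ i < ℓ, c / b ^ i % b = f i := by
  refine ⟨finFunctionFinEquiv fun i : Fin ℓ => ⟨f i, hf i i.2⟩, Fin.is_lt _, fun i hi => ?_⟩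
  have := congrFun (finFunctionFinEquiv.symm_apply_apply
    fun i : Fin ℓ => (⟨f i, hf i i.2⟩ : Fin b)) ⟨i, hi⟩
  exact congrArg Fin.val this

/-- Exhaustive search through all `q ^ k` vectors. Recorded scores are shifted by one, so the
initial `0` in register `25` means that nothing is recorded and even a vector of score zero beats
it. -/
theorem runs_regress {n d k : ℕ} {s : State} (hs : Fixed e n d k s) {w m len : ℕ}
    {W : ℕ → ℕ → F} {b : ℕ → F} {wt : ℕ → ℕ} {ℓ : ℕ} (hS : System e k w m len W b wt ℓ s)
    (hlen : len < 11) (hw7 : w ≠ 7) (hw8 : w ≠ 8) (hm7 : m ≠ 7) (hm8 : m ≠ 8) :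
    ∃ s' x, Runs (regress e w m len) s (regressTime ℓ k q) s' ∧
      (∀ l < k, s'.arr 8 l = enc e (x l)) ∧ s'.reg 25 = score W b wt ℓ k x + 1 ∧
      ∀ y, score W b wt ℓ k y ≤ score W b wt ℓ k x := by
  have hq : 0 < q := (Nat.zero_le _).trans_lt (enc_lt e 0)
  have hdig : ∀ i j, i / q ^ j % q = enc e (dec e (i / q ^ j % q)) := fun i j =>
    (enc_dec e (Nat.mod_lt _ hq)).symm
  have wlen : ∀ y, 11 ≤ y → len ≠ y := fun y hy h => by omega
  have wreg : (regress e w m len).wr len = false := regress_wr (.inl hlen) (by omega)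
  obtain ⟨s', hr, hI, -, hV⟩ := runs_enumerate (a := 7) (len := 2) (base := 3) (N := 17) (c := 18)
    (ℓ := k) (b := q) (T := scoreTime ℓ k q + 6 * k + 7) (s₀ := s.setReg 25 0)
    (body := .seq (scoreProg e w m len) (.seq (.sub 30 26 25)
    (.ite 30 (.seq (mov 25 26) (forLoop 27 2 (.seq (.load 30 7 27) (.store 8 27 30)))) .skip)))
    25
    (fun s => s.reg 25 = 0 ∨ ∃ x, (∀ l < k, s.arr 8 l = enc e (x l)) ∧
      s.reg 25 = score W b wt ℓ k x + 1)
    (fun i v => score W b wt ℓ k (fun l => dec e (i / q ^ l % q)) + 1 ≤ v)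
    (by simp [hs.reg2]) (by simp [hs.reg3]) hq (by decide) (by decide) (by decide) (by decide)
    (by decide) (by decide) (by decide) (by decide) (by decide) (by decide) (by decide)
    (by decide) rfl rfl rfl rfl rfl
    (fun s s' hreg harr hI => by
      rwa [hreg 25 (by decide) (by decide) (by decide), harr 8 (by decide)])
    (fun i v w h h' => h'.trans h)
    (by simp)
    (by
      intro i hi s₁ hF hdi hInv
      have hF' : Frame (regress e w m len) s s₁ :=
        ((runs_const s 25 0).frame.mono (r := regress e w m len)
          (by simp +contextual [regress, Program.wr])
          (by simp [Program.wa])).trans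
        (hF.mono (by simp +contextual [regress, Program.wr])
          (by simp +contextual [regress, Program.wa]))
      have hs₁ : Fixed e n d k s₁ := hs.frame hF' rfl rfl rfl rfl rfl
      have wreg' : ∀ a, a ≠ 7 → a ≠ 8 → (regress e w m len).wa a = false := fun a h h' => by
        simp [regress, enumerate, incr, scoreProg, dotProg, mul, mov, forLoop, Program.wa, h, h']
      have hS₁ := hS.frame hF' wreg (wreg' w hw7 hw8) rfl (wreg' m hm7 hm8)
      obtain ⟨s₂, hr₂, h₂⟩ := runs_scoreProg hs₁ hS₁ hlen
        (x := fun l => dec e (i / q ^ l % q)) (fun l hl => by rw [hdi l hl]; exact hdig i l)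
      have h25 : s₂.reg 25 = s₁.reg 25 := hr₂.frame.reg 25 rfl
      by_cases hlt : s₂.reg 25 < s₂.reg 26
      · set s₃ := (s₂.setReg 30 (s₂.reg 26 - s₂.reg 25)).setReg 25
          ((s₂.setReg 30 (s₂.reg 26 - s₂.reg 25)).reg 26) with hs₃
        have h3 : s₃.reg 25 = s₂.reg 26 := by simp [hs₃]
        obtain ⟨s₄, hr₄, h₄⟩ := runs_forLoop (i := 27) (N := 2) (n := k) (T := 2) (s₀ := s₃)
          (body := .seq (.load 30 7 27) (.store 8 27 30))
          (fun j s => ∀ l < j, s.arr 8 l = i / q ^ l % q)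
          (by simp [hs₃, hr₂.frame.reg 2 rfl, hs₁.reg2]) (by decide) (by decide) (by decide) rfl rfl
          (fun i s s' hreg harr hI => by rw [harr]; exact hI)
          (by simp)
          (by
            intro j hj s₅ hF₅ h27 hI
            have h7 : s₅.arr 7 j = i / q ^ j % q := by
              rw [hF₅.arr 7 rfl, ← hdi j hj, ← hr₂.frame.arr 7 rfl]; simp [hs₃]
            refine ⟨_, (runs_load _ 30 7 27).seq (runs_store _ 8 27 30), fun l hl => ?_⟩
            rcases Nat.lt_succ_iff_lt_or_eq.1 hl with hl | rfl
            · simp [h27, hl.ne, hI l hl]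
            · simp [h27, h7])
        have h4 : s₄.reg 25 = s₂.reg 26 := by rw [hr₄.frame.reg 25 rfl, h3]
        refine ⟨s₄, (hr₂.seq ((runs_sub _ 30 26 25).seq (Runs.ite_true ?_
          ((runs_mov _ (by decide)).seq hr₄)))).mono (by omega),
          .inr ⟨fun l => dec e (i / q ^ l % q), ?_, ?_⟩, ?_, ?_⟩
        · simp; omega
        · exact fun l hl => (h₄ l hl).trans (hdig i l)
        · rw [h4, h₂]
        · omega
        · rw [h4, h₂]
      · refine ⟨_, (hr₂.seq ((runs_sub _ 30 26 25).seq (Runs.ite_false ?_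
          (runs_skip _)))).mono (by omega), ?_, ?_, ?_⟩
        · simp; omega
        · simpa [h25, hr₂.frame.arr 8 rfl] using hInv
        · simp [h25]
        · simp; omega)
  have hV' : ∀ y, score W b wt ℓ k y + 1 ≤ s'.reg 25 := fun y => by
    obtain ⟨c, hc, hcy⟩ := exists_digits (b := q) (ℓ := k) (f := fun l => enc e (y l))
      fun i _ => enc_lt e _
    refine le_trans (le_of_eq ?_) (hV c hc)
    congr 1
    exact score_congr (fun _ _ _ _ => rfl) (fun _ _ => rfl) (fun _ _ => rfl)
      fun l hl => by rw [hcy l hl, dec_enc]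
  -- An empty record is impossible: the zero vector alone forces register `25` to be positive.
  rcases hI with hI | ⟨x, hx, hx'⟩
  · have := hV' 0
    omega
  · refine ⟨s', x, ((runs_const s 25 0).seq hr).mono (by unfold regressTime; omega), hx, hx',
      fun y => ?_⟩
    have := hV' y
    omega

/-! ### Evaluating one guess: rows, columns, record -/

variable (e)

/-- Row by row, find the best answer to the guess in arrays `4`, `5`, `6`, and store the resulting
matrix in array `10`. -/
def rowsProg : Program :=
  forLoop 33 0 (.seq (mul 36 33 1)
    (.seq (forLoop 34 4 (.seq (.load 37 4 34) (.seq (.add 37 36 37) (.seq (.load 37 0 37)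
      (.store 9 34 37)))))
    (.seq (regress e 6 5 4) (.seq (mul 36 33 2)
      (forLoop 34 2 (.seq (.load 37 8 34) (.seq (.add 38 36 34) (.store 10 38 37))))))))

/-- Column by column, find the best answer to the matrix in array `10`, and store the resulting
matrix in array `11`; register `10` receives one plus the number of correct entries. -/
def colsProg : Program :=
  .seq (.const 10 1) (forLoop 33 1
    (.seq (forLoop 34 0 (.seq (mul 36 34 1) (.seq (.add 36 36 33) (.seq (.load 36 0 36)
      (.store 9 34 36)))))
    (.seq (regress e 10 12 0) (.seq (.add 10 10 25) (.seq (.const 36 1) (.seq (.sub 10 10 36)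
      (forLoop 34 2 (.seq (mul 36 34 1) (.seq (.add 36 36 33) (.seq (.load 37 8 34)
        (.store 11 36 37)))))))))))

/-- Copy the matrices in arrays `10` and `11` to arrays `1` and `2` if they beat the record in
register `9`. -/
def recordProg : Program :=
  .seq (.sub 36 10 9) (.ite 36
    (.seq (mov 9 10) (.seq (forLoop 34 7 (.seq (.load 36 10 34) (.store 1 34 36)))
      (forLoop 34 8 (.seq (.load 36 11 34) (.store 2 34 36))))) .skip)

/-- Array `a` holds the matrix `M`, row by row, in its first `r * c` cells. -/
def Holds {F : Type*} {q : ℕ} (e : F ≃ Fin q) (a r c : ℕ) (M : ℕ → ℕ → F) (s : State) : Prop :=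
  ∀ i < r, ∀ j < c, s.arr a (i * c + j) = enc e (M i j)

variable {e}

/-- `x` has maximum score. -/
def IsBest (W : ℕ → ℕ → F) (b : ℕ → F) (m : ℕ → ℕ) (ℓ k : ℕ) (x : ℕ → F) : Prop :=
  ∀ y, score W b m ℓ k y ≤ score W b m ℓ k x

theorem IsBest.congr {W W' : ℕ → ℕ → F} {b b' : ℕ → F} {m m' : ℕ → ℕ} {ℓ k : ℕ} {x x' : ℕ → F}
    (h : IsBest W b m ℓ k x)
    (hW : ∀ s < ℓ, ∀ l < k, W s l = W' s l) (hb : ∀ s < ℓ, b s = b' s) (hm : ∀ s < ℓ, m s = m' s)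
    (hx : ∀ l < k, x l = x' l) : IsBest W' b' m' ℓ k x' := fun y => by
  rw [← score_congr hW hb hm hx, ← score_congr hW hb hm fun _ _ => rfl]
  exact h y

theorem index_inj {c i i' j j' : ℕ} (hj : j < c) (hj' : j' < c) :
    i * c + j = i' * c + j' ↔ i = i' ∧ j = j' := by
  refine ⟨fun h => ?_, fun h => by rw [h.1, h.2]⟩
  have hc : 0 < c := by omega
  have h1 : (i * c + j) / c = i := by rw [mul_comm, Nat.mul_add_div hc, Nat.div_eq_of_lt hj]; simp
  have h2 : (i' * c + j') / c = i' := by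
    rw [mul_comm, Nat.mul_add_div hc, Nat.div_eq_of_lt hj']; simp
  have : i = i' := by rw [← h1, h, h2]
  subst this
  omega

/-- A bound on the running time of `rowsProg`. -/
def rowsTime (n d k t q : ℕ) : ℕ :=
  n * (5 * d + 4 + (t * 8 + 3) + regressTime t k q + (5 * k + 4 + (k * 7 + 3)) + 4) + 3

/-- Each row is an independent regression on the `t` guessed coordinates only, so the time is `n`
times a quantity free of `n`. -/
theorem runs_rowsProg {n d k t : ℕ} {s : State} (hs : Fixed e n d k s) {A : ℕ → ℕ → F}
    (hA : Holds e 0 n d A s) {J M : ℕ → ℕ} {W : ℕ → ℕ → F} (ht : s.reg 4 = t)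
    (hJ : ∀ i < t, s.arr 4 i = J i) (hJd : ∀ i < t, J i < d) (hM : ∀ i < t, s.arr 5 i = M i)
    (hW : Holds e 6 t k W s) :
    ∃ s' U, Runs (rowsProg e) s (rowsTime n d k t q) s' ∧ Holds e 10 n k U s' ∧
      ∀ i < n, IsBest W (fun s => A i (J s)) M t k (U i) := by
  obtain ⟨s', hr, U, hU⟩ := runs_forLoop (i := 33) (N := 0) (n := n)
    (T := 5 * d + 4 + (t * 8 + 3) + regressTime t k q + (5 * k + 4 + (k * 7 + 3))) (s₀ := s)
    (body := .seq (mul 36 33 1)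
    (.seq (forLoop 34 4 (.seq (.load 37 4 34) (.seq (.add 37 36 37) (.seq (.load 37 0 37)
      (.store 9 34 37)))))
    (.seq (regress e 6 5 4) (.seq (mul 36 33 2)
      (forLoop 34 2 (.seq (.load 37 8 34) (.seq (.add 38 36 34) (.store 10 38 37))))))))
    (fun i s => ∃ U : ℕ → ℕ → F, Holds e 10 i k U s ∧
      ∀ i' < i, IsBest W (fun s => A i' (J s)) M t k (U i'))
    hs.reg0 (by decide) (by decide) (by decide) rfl rfl
    (fun i s s' hreg harr hI => by unfold Holds; rw [harr]; exact hI)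
    ⟨0, by simp [Holds], by simp⟩
    (by
      intro i hi s₁ hF h33 ⟨U, hU1, hU2⟩
      have hs₁ : Fixed e n d k s₁ := hs.frame hF rfl rfl rfl rfl rfl
      obtain ⟨s₂, hr₂, h₂⟩ := runs_mul s₁ (z := 36) (x := 33) (y := 1)
        (by decide) (by decide) (by decide) (by decide) (by decide) (by decide) (by decide)
        (by decide)
      rw [h33, hs₁.reg1] at h₂
      rw [hs₁.reg1] at hr₂
      have e4 : s₂.reg 4 = t := by rw [hr₂.frame.reg 4 rfl, hF.reg 4 rfl, ht]
      have hF₂ : Frame (rowsProg e) s s₂ := hF.trans (hr₂.frame.mono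
        (by simp +contextual [forLoop, Program.wr])
        (by simp +contextual [forLoop, Program.wa]))
      obtain ⟨s₃, hr₃, h₃⟩ := runs_forLoop (i := 34) (N := 4) (n := t) (T := 4) (s₀ := s₂)
        (body := .seq (.load 37 4 34) (.seq (.add 37 36 37) (.seq (.load 37 0 37)
          (.store 9 34 37))))
        (fun j s => ∀ j' < j, s.arr 9 j' = enc e (A i (J j')))
        e4 (by decide) (by decide) (by decide) rfl rfl
        (fun i s s' hreg harr hI => by rw [harr]; exact hI)
        (by simp)
        (by
          intro j hj s₄ hF₄ h34 hI
          have e0 : s₄.arr 0 = s.arr 0 := by rw [hF₄.arr 0 rfl, hF₂.arr 0 rfl]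
          have e1 : s₄.arr 4 j = J j := by rw [hF₄.arr 4 rfl, hF₂.arr 4 rfl, hJ j hj]
          have e2 : s₄.reg 36 = i * d := by rw [hF₄.reg 36 rfl, h₂]
          refine ⟨_, (runs_load _ 37 4 34).seq ((runs_add _ 37 36 37).seq
            ((runs_load _ 37 0 37).seq (runs_store _ 9 34 37))), fun j' hj' => ?_⟩
          rcases Nat.lt_succ_iff_lt_or_eq.1 hj' with hj' | rfl
          · simp [h34, hj'.ne, hI j' hj']
          · simp [h34, e1, e2, e0, hA i hi _ (hJd _ hj)])
      have hF₃ : Frame (rowsProg e) s s₃ := hF₂.trans (hr₃.frame.mono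
        (by simp +contextual [rowsProg, forLoop, Program.wr])
        (by simp +contextual [rowsProg, forLoop, Program.wa]))
      have hs₃ : Fixed e n d k s₃ := hs.frame hF₃ rfl rfl rfl rfl rfl
      obtain ⟨s₅, x, hr₅, hx, -, hbest⟩ := runs_regress hs₃ (w := 6) (m := 5) (len := 4) (ℓ := t)
        (W := W) (b := fun s => A i (J s)) (wt := M)
        ⟨by rw [hF₃.reg 4 rfl, ht], by rw [hF₃.arr 6 rfl]; exact hW, h₃,
          by rw [hF₃.arr 5 rfl]; exact hM⟩
        (by decide) (by decide) (by decide) (by decide) (by decide)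
      obtain ⟨s₆, hr₆, h₆⟩ := runs_mul s₅ (z := 36) (x := 33) (y := 2)
        (by decide) (by decide) (by decide) (by decide) (by decide) (by decide) (by decide)
        (by decide)
      have hs₅ : Fixed e n d k s₅ := hs₃.frame hr₅.frame rfl rfl rfl rfl rfl
      have h33' : s₅.reg 33 = i := by
        rw [hr₅.frame.reg 33 rfl, hr₃.frame.reg 33 rfl, hr₂.frame.reg 33 rfl, h33]
      rw [h33', hs₅.reg2] at h₆
      rw [hs₅.reg2] at hr₆
      have e10 : s₆.arr 10 = s₁.arr 10 := by
        rw [hr₆.frame.arr 10 rfl, hr₅.frame.arr 10 rfl, hr₃.frame.arr 10 rfl,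
          hr₂.frame.arr 10 rfl]
      obtain ⟨s₇, hr₇, h₇, h₇'⟩ := runs_forLoop (i := 34) (N := 2) (n := k) (T := 3) (s₀ := s₆)
        (body := .seq (.load 37 8 34) (.seq (.add 38 36 34) (.store 10 38 37)))
        (fun j s => (∀ j' < j, s.arr 10 (i * k + j') = enc e (x j')) ∧ Holds e 10 i k U s)
        (by rw [hr₆.frame.reg 2 rfl, hs₅.reg2]) (by decide) (by decide) (by decide) rfl rfl
        (fun i s s' hreg harr hI => by unfold Holds; rw [harr]; exact hI)
        ⟨by simp, by unfold Holds; rw [e10]; exact hU1⟩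
        (by
          intro j hj s₈ hF₈ h34 ⟨hI1, hI2⟩
          have e1 : s₈.arr 8 j = enc e (x j) := by
            rw [hF₈.arr 8 rfl, hr₆.frame.arr 8 rfl, hx j hj]
          have e2 : s₈.reg 36 = i * k := by rw [hF₈.reg 36 rfl, h₆]
          refine ⟨_, (runs_load _ 37 8 34).seq ((runs_add _ 38 36 34).seq
            (runs_store _ 10 38 37)), fun j' hj' => ?_, fun i' hi' j' hj' => ?_⟩
          · rcases Nat.lt_succ_iff_lt_or_eq.1 hj' with hj' | rfl
            · simp [h34, hj'.ne, e2, hI1 j' hj']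
            · simp [h34, e1, e2]
          · have := hI2 i' hi' j' hj'
            simp [h34, e2, index_inj hj' hj, hi'.ne, this])
      refine ⟨s₇, (hr₂.seq (hr₃.seq (hr₅.seq (hr₆.seq hr₇)))).mono (by omega),
        Function.update U i x, fun i' hi' l hl => ?_, fun i' hi' => ?_⟩
      · rcases Nat.lt_succ_iff_lt_or_eq.1 hi' with hi' | rfl
        · rw [Function.update_of_ne hi'.ne]; exact h₇' i' hi' l hl
        · rw [Function.update_self]; exact h₇ l hl
      · rcases Nat.lt_succ_iff_lt_or_eq.1 hi' with hi' | rfl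
        · rw [Function.update_of_ne hi'.ne]; exact hU2 i' hi'
        · rw [Function.update_self]; exact hbest)
  exact ⟨s', U, hr, hU.1, hU.2⟩

/-- The number of entries of `A` that the product of `U` and the transpose of `V` gets right. -/
noncomputable def agreement (n d k : ℕ) (A U V : ℕ → ℕ → F) : ℕ :=
  ∑ j ∈ range d, score U (fun i => A i j) (fun _ => 1) n k (V j)

/-- A bound on the running time of `colsProg`. -/
def colsTime (n d k q : ℕ) : ℕ :=
  d * (n * (5 * d + 4 + 3 + 4) + 3 + regressTime n k q + 3 + (k * (5 * d + 4 + 3 + 4) + 3) + 4) + 4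

/-- For fixed `U` the columns of the second factor are independent, so maximising the number of
correct entries in each column, with unit weights over all rows, maximises the total agreement. -/
theorem runs_colsProg {n d k : ℕ} {s : State} (hs : Fixed e n d k s) {A U : ℕ → ℕ → F}
    (hA : Holds e 0 n d A s) (hU : Holds e 10 n k U s) (h1 : ∀ i < n, s.arr 12 i = 1) :
    ∃ s' V, Runs (colsProg e) s (colsTime n d k q) s' ∧ Holds e 11 k d (fun l j => V j l) s' ∧
      s'.reg 10 = agreement n d k A U V + 1 ∧
      ∀ V', agreement n d k A U V' ≤ agreement n d k A U V := by
  obtain ⟨s', hr, V, hV, hV', hb⟩ := runs_forLoop (i := 33) (N := 1) (n := d)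
    (T := n * (5 * d + 4 + 3 + 4) + 3 + regressTime n k q + 3 + (k * (5 * d + 4 + 3 + 4) + 3))
    (s₀ := s.setReg 10 1)
    (body := .seq (forLoop 34 0 (.seq (mul 36 34 1) (.seq (.add 36 36 33) (.seq (.load 36 0 36)
      (.store 9 34 36)))))
    (.seq (regress e 10 12 0) (.seq (.add 10 10 25) (.seq (.const 36 1) (.seq (.sub 10 10 36)
      (forLoop 34 2 (.seq (mul 36 34 1) (.seq (.add 36 36 33) (.seq (.load 37 8 34)
        (.store 11 36 37))))))))))
    (fun j s => ∃ V : ℕ → ℕ → F, (∀ l < k, ∀ j' < j, s.arr 11 (l * d + j') = enc e (V j' l)) ∧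
      s.reg 10 = agreement n j k A U V + 1 ∧
      ∀ j' < j, IsBest U (fun i => A i j') (fun _ => 1) n k (V j'))
    (by simp [hs.reg1]) (by decide) (by decide) (by decide) rfl rfl
    (fun i s s' hreg harr hI => by rw [harr, hreg 10 (by decide) (by decide)]; exact hI)
    ⟨0, by simp, by simp [agreement], by simp⟩
    (by
      intro j hj s₁ hF h33 ⟨V, hV1, hV2, hV3⟩
      have hF₁ : Frame (colsProg e) s s₁ :=
        ((runs_const s 10 1).frame.mono (r := colsProg e)
          (by simp +contextual [colsProg, Program.wr])
          (by simp [Program.wa])).trans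
        (hF.mono (by simp +contextual [colsProg, Program.wr])
          (by simp +contextual [colsProg, Program.wa]))
      have hs₁ : Fixed e n d k s₁ := hs.frame hF₁ rfl rfl rfl rfl rfl
      obtain ⟨s₃, hr₃, h₃⟩ := runs_forLoop (i := 34) (N := 0) (n := n) (T := 5 * d + 4 + 3)
        (s₀ := s₁)
        (body := .seq (mul 36 34 1) (.seq (.add 36 36 33) (.seq (.load 36 0 36)
          (.store 9 34 36))))
        (fun i s => ∀ i' < i, s.arr 9 i' = enc e (A i' j))
        hs₁.reg0 (by decide) (by decide) (by decide) rfl rfl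
        (fun i s s' hreg harr hI => by rw [harr]; exact hI)
        (by simp)
        (by
          intro i hi s₄ hF₄ h34 hI
          obtain ⟨s₅, hr₅, h₅⟩ := runs_mul s₄ (z := 36) (x := 34) (y := 1)
            (by decide) (by decide) (by decide) (by decide) (by decide) (by decide) (by decide)
            (by decide)
          rw [h34, hF₄.reg 1 rfl, hs₁.reg1] at h₅
          rw [hF₄.reg 1 rfl, hs₁.reg1] at hr₅
          have e0 : s₅.arr 0 = s.arr 0 := by
            rw [hr₅.frame.arr 0 rfl, hF₄.arr 0 rfl, hF₁.arr 0 rfl]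
          have e9 : s₅.arr 9 = s₄.arr 9 := hr₅.frame.arr 9 rfl
          have e1 : s₅.reg 33 = j := by rw [hr₅.frame.reg 33 rfl, hF₄.reg 33 rfl, h33]
          have e2 : s₅.reg 34 = i := by rw [hr₅.frame.reg 34 rfl, h34]
          refine ⟨_, hr₅.seq ((runs_add _ 36 36 33).seq
            ((runs_load _ 36 0 36).seq (runs_store _ 9 34 36))), fun j' hj' => ?_⟩
          rcases Nat.lt_succ_iff_lt_or_eq.1 hj' with hj' | rfl
          · simp [e2, e9, hj'.ne, hI j' hj']
          · simp [e2, e1, h₅, e0, hA _ hi _ hj])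
      have hs₃ : Fixed e n d k s₃ := hs₁.frame hr₃.frame rfl rfl rfl rfl rfl
      obtain ⟨s₅, x, hr₅, hx, hx', hbest⟩ := runs_regress hs₃ (w := 10) (m := 12) (len := 0)
        (ℓ := n) (W := U) (b := fun i => A i j) (wt := fun _ => 1)
        ⟨hs₃.reg0, by rw [hr₃.frame.arr 10 rfl, hF₁.arr 10 rfl]; exact hU, h₃,
          by rw [hr₃.frame.arr 12 rfl, hF₁.arr 12 rfl]; exact h1⟩
        (by decide) (by decide) (by decide) (by decide) (by decide)
      have hs₅ : Fixed e n d k s₅ := hs₃.frame hr₅.frame rfl rfl rfl rfl rfl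
      have e10 : s₅.reg 10 = agreement n j k A U V + 1 := by
        rw [hr₅.frame.reg 10 rfl, hr₃.frame.reg 10 rfl, hV2]
      have e11 : s₅.arr 11 = s₁.arr 11 := by rw [hr₅.frame.arr 11 rfl, hr₃.frame.arr 11 rfl]
      have e33 : s₅.reg 33 = j := by rw [hr₅.frame.reg 33 rfl, hr₃.frame.reg 33 rfl, h33]
      have hr₆ := (runs_add s₅ 10 10 25).seq ((runs_const _ 36 1).seq (runs_sub _ 10 10 36))
      obtain ⟨s₆, hs₆⟩ : ∃ s₆, s₆ = (((s₅.setReg 10 (s₅.reg 10 + s₅.reg 25)).setReg 36 1).setReg 10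
        (((s₅.setReg 10 (s₅.reg 10 + s₅.reg 25)).setReg 36 1).reg 10 -
          ((s₅.setReg 10 (s₅.reg 10 + s₅.reg 25)).setReg 36 1).reg 36)) := ⟨_, rfl⟩
      rw [← hs₆] at hr₆
      -- Both summands carry the shift by one, so one unit is subtracted after adding.
      have f10 : s₆.reg 10 = agreement n j k A U V +
          score U (fun i => A i j) (fun _ => 1) n k x + 1 := by
        simp [hs₆, e10, hx']; omega
      obtain ⟨s₇, hr₇, h₇, h₇'⟩ := runs_forLoop (i := 34) (N := 2) (n := k) (T := 5 * d + 4 + 3)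
        (s₀ := s₆)
        (body := .seq (mul 36 34 1) (.seq (.add 36 36 33) (.seq (.load 37 8 34)
          (.store 11 36 37))))
        (fun i s => (∀ l < i, s.arr 11 (l * d + j) = enc e (x l)) ∧
          ∀ l < k, ∀ j' < j, s.arr 11 (l * d + j') = enc e (V j' l))
        (by rw [hr₆.frame.reg 2 rfl, hs₅.reg2]) (by decide) (by decide) (by decide) rfl rfl
        (fun i s s' hreg harr hI => by rw [harr]; exact hI)
        ⟨by simp, by rw [hr₆.frame.arr 11 rfl, e11]; exact hV1⟩
        (by
          intro l hl s₈ hF₈ h34 ⟨hI1, hI2⟩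
          obtain ⟨s₉, hr₉, h₉⟩ := runs_mul s₈ (z := 36) (x := 34) (y := 1)
            (by decide) (by decide) (by decide) (by decide) (by decide) (by decide) (by decide)
            (by decide)
          rw [h34, hF₈.reg 1 rfl, hr₆.frame.reg 1 rfl, hs₅.reg1] at h₉
          rw [hF₈.reg 1 rfl, hr₆.frame.reg 1 rfl, hs₅.reg1] at hr₉
          have e8 : s₉.arr 8 l = enc e (x l) := by
            rw [hr₉.frame.arr 8 rfl, hF₈.arr 8 rfl, hr₆.frame.arr 8 rfl, hx l hl]
          have e11 : s₉.arr 11 = s₈.arr 11 := hr₉.frame.arr 11 rfl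
          have e1 : s₉.reg 33 = j := by
            rw [hr₉.frame.reg 33 rfl, hF₈.reg 33 rfl, hr₆.frame.reg 33 rfl, e33]
          have e2 : s₉.reg 34 = l := by rw [hr₉.frame.reg 34 rfl, h34]
          refine ⟨_, hr₉.seq ((runs_add _ 36 36 33).seq
            ((runs_load _ 37 8 34).seq (runs_store _ 11 36 37))), fun l' hl' => ?_,
            fun l' hl' j' hj' => ?_⟩
          · rcases Nat.lt_succ_iff_lt_or_eq.1 hl' with hl' | rfl
            · have := hI1 l' hl'
              simp [e1, e2, h₉, e11, hl'.ne, this, (Nat.zero_le j).trans_lt hj |>.ne']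
            · simp [e1, e2, h₉, e8]
          · have := hI2 l' hl' j' hj'
            simp [e1, e2, h₉, e11, index_inj (hj'.trans hj) hj, hj'.ne, this])
      refine ⟨s₇, ((hr₃.seq (hr₅.seq ((runs_add s₅ 10 10 25).seq ((runs_const _ 36 1).seq
        ((runs_sub _ 10 10 36).seq (hs₆ ▸ hr₇))))))).mono (by omega),
        Function.update V j x, fun l hl j' hj' => ?_, ?_, fun j' hj' => ?_⟩
      · rcases Nat.lt_succ_iff_lt_or_eq.1 hj' with hj' | rfl
        · rw [Function.update_of_ne hj'.ne]; exact h₇' l hl j' hj'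
        · rw [Function.update_self]; exact h₇ l hl
      · rw [hr₇.frame.reg 10 rfl, f10, agreement, agreement, sum_range_succ, Function.update_self]
        congr 2
        exact sum_congr rfl fun j' hj' => by
          rw [Function.update_of_ne (mem_range.1 hj').ne]
      · rcases Nat.lt_succ_iff_lt_or_eq.1 hj' with hj' | rfl
        · rw [Function.update_of_ne hj'.ne]; exact hV3 j' hj'
        · rw [Function.update_self]; exact hbest)
  exact ⟨s', V, ((runs_const s 10 1).seq hr).mono (by unfold colsTime; omega), hV, hV',
    fun V' => sum_le_sum fun j hj => hb j (mem_range.1 hj) _⟩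

/-- The record: register `9` is zero, or arrays `1` and `2` hold matrices whose agreement with `A`
is one less than register `9`. -/
def Record (e : F ≃ Fin q) (n d k : ℕ) (A : ℕ → ℕ → F) (s : State) : Prop :=
  s.reg 9 = 0 ∨ ∃ U V, Holds e 1 n k U s ∧ Holds e 2 k d (fun l j => V j l) s ∧
    s.reg 9 = agreement n d k A U V + 1

theorem index_lt {r c i j : ℕ} (hi : i < r) (hj : j < c) : i * c + j < r * c := by
  nlinarith

theorem runs_copy (s : State) {a b N m : ℕ} (hab : a ≠ b) (hN : N < 11) (hm : s.reg N = m) :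
    ∃ s', Runs (forLoop 34 N (.seq (.load 36 a 34) (.store b 34 36))) s (m * 6 + 3) s' ∧
      ∀ i < m, s'.arr b i = s.arr a i := by
  refine runs_forLoop (T := 2) (fun i s' => ∀ j < i, s'.arr b j = s.arr a j) hm (by decide)
    (by omega) (by omega) rfl (by simp [Program.wr]; omega)
    (fun i s s' hreg harr hI => by rw [harr]; exact hI) (by simp) ?_
  intro i hi s₁ hF h34 hI
  have ha : s₁.arr a = s.arr a := hF.arr a (by simp [forLoop, Program.wa, hab])
  refine ⟨_, (runs_load _ 36 a 34).seq (runs_store _ b 34 36), fun j hj => ?_⟩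
  rcases Nat.lt_succ_iff_lt_or_eq.1 hj with hj | rfl
  · simp [h34, hj.ne, hI j hj]
  · simp [h34, ha]

/-- A bound on the running time of `recordProg`. -/
def recordTime (n d k : ℕ) : ℕ := n * k * 6 + k * d * 6 + 10

theorem runs_recordProg {n d k : ℕ} {s : State} {A U V : ℕ → ℕ → F} (h7 : s.reg 7 = n * k)
    (h8 : s.reg 8 = k * d) (hU : Holds e 10 n k U s) (hV : Holds e 11 k d (fun l j => V j l) s)
    (h10 : s.reg 10 = agreement n d k A U V + 1) (hR : Record e n d k A s) :
    ∃ s', Runs recordProg s (recordTime n d k) s' ∧ Record e n d k A s' ∧ s.reg 9 ≤ s'.reg 9 ∧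
      agreement n d k A U V + 1 ≤ s'.reg 9 := by
  by_cases hlt : s.reg 9 < s.reg 10
  · set s₁ := (s.setReg 36 (s.reg 10 - s.reg 9)).setReg 9
      ((s.setReg 36 (s.reg 10 - s.reg 9)).reg 10) with hs₁
    have e9 : s₁.reg 9 = s.reg 10 := by simp [hs₁]
    obtain ⟨s₂, hr₂, h₂⟩ := runs_copy s₁ (a := 10) (b := 1) (N := 7) (m := n * k) (by decide)
      (by decide) (by simp [hs₁, h7])
    obtain ⟨s₃, hr₃, h₃⟩ := runs_copy s₂ (a := 11) (b := 2) (N := 8) (m := k * d) (by decide)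
      (by decide) (by rw [hr₂.frame.reg 8 rfl]; simp [hs₁, h8])
    have f9 : s₃.reg 9 = s.reg 10 := by rw [hr₃.frame.reg 9 rfl, hr₂.frame.reg 9 rfl, e9]
    refine ⟨s₃, ((runs_sub s 36 10 9).seq (Runs.ite_true (by simp; omega)
      ((runs_mov _ (by decide)).seq (hr₂.seq hr₃)))).mono (by unfold recordTime; omega),
      .inr ⟨U, V, fun i hi l hl => ?_, fun l hl j hj => ?_, by rw [f9, h10]⟩, by omega, by omega⟩
    · rw [hr₃.frame.arr 1 rfl, h₂ _ (index_lt hi hl)]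
      exact hU i hi l hl
    · rw [h₃ _ (index_lt hl hj), hr₂.frame.arr 11 rfl]
      exact hV l hl j hj
  · refine ⟨_, ((runs_sub s 36 10 9).seq (Runs.ite_false (by simp; omega)
      (runs_skip _))).mono (by unfold recordTime; omega), ?_, by simp, by simp; omega⟩
    simpa [Record, Holds] using hR

variable (e) in
/-- Find the best answers to a guess and update the record. -/
def guessBody : Program := .seq (rowsProg e) (.seq (colsProg e) recordProg)

/-- The matrix factor `U` found for the guess `(J, M, W)`, together with any second factor, has an
agreement of less than `v`. -/
def Visited (n d k t : ℕ) (A : ℕ → ℕ → F) (J M : ℕ → ℕ) (W : ℕ → ℕ → F) (v : ℕ) : Prop :=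
  ∃ U : ℕ → ℕ → F, (∀ i < n, IsBest W (fun s => A i (J s)) M t k (U i)) ∧
    ∀ V, agreement n d k A U V + 1 ≤ v

theorem Visited.mono {n d k t : ℕ} {A : ℕ → ℕ → F} {J M : ℕ → ℕ} {W : ℕ → ℕ → F} {v w : ℕ}
    (hvw : v ≤ w) (h : Visited n d k t A J M W v) : Visited n d k t A J M W w := by
  obtain ⟨U, h1, h2⟩ := h
  exact ⟨U, h1, fun V => (h2 V).trans hvw⟩

/-- The contents of registers and arrays that stay fixed during the search over all guesses. -/
structure SearchFixed (e : F ≃ Fin q) (n d k t : ℕ) (A : ℕ → ℕ → F) (s : State) : Prop where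
  fixed : Fixed e n d k s
  reg4 : s.reg 4 = t
  reg5 : s.reg 5 = t * k
  reg6 : s.reg 6 = d + 1
  reg7 : s.reg 7 = n * k
  reg8 : s.reg 8 = k * d
  input : Holds e 0 n d A s
  ones : ∀ i < n, s.arr 12 i = 1

theorem SearchFixed.frame {n d k t : ℕ} {A : ℕ → ℕ → F} {s s' : State}
    (h : SearchFixed e n d k t A s) {p : Program} (hF : Frame p s s')
    (hp : ∀ x < 9, p.wr x = false) (hp0 : p.wa 0 = false) (hp3 : p.wa 3 = false)
    (hp12 : p.wa 12 = false) : SearchFixed e n d k t A s' where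
  fixed := h.fixed.frame hF (hp 0 (by decide)) (hp 1 (by decide)) (hp 2 (by decide))
    (hp 3 (by decide)) hp3
  reg4 := by rw [hF.reg 4 (hp 4 (by decide)), h.reg4]
  reg5 := by rw [hF.reg 5 (hp 5 (by decide)), h.reg5]
  reg6 := by rw [hF.reg 6 (hp 6 (by decide)), h.reg6]
  reg7 := by rw [hF.reg 7 (hp 7 (by decide)), h.reg7]
  reg8 := by rw [hF.reg 8 (hp 8 (by decide)), h.reg8]
  input := by unfold Holds; rw [hF.arr 0 hp0]; exact h.input
  ones := by rw [hF.arr 12 hp12]; exact h.ones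

/-- A bound on the running time of `guessBody`. -/
def guessTime (n d k t q : ℕ) : ℕ := rowsTime n d k t q + colsTime n d k q + recordTime n d k

theorem runs_guessBody {n d k t : ℕ} {s : State} {A : ℕ → ℕ → F}
    (hs : SearchFixed e n d k t A s) {J M : ℕ → ℕ} {W : ℕ → ℕ → F}
    (hJ : ∀ i < t, s.arr 4 i = J i) (hJd : ∀ i < t, J i < d) (hM : ∀ i < t, s.arr 5 i = M i)
    (hW : Holds e 6 t k W s) (hR : Record e n d k A s) :
    ∃ s', Runs (guessBody e) s (guessTime n d k t q) s' ∧ Record e n d k A s' ∧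
      s.reg 9 ≤ s'.reg 9 ∧ Visited n d k t A J M W (s'.reg 9) := by
  obtain ⟨s₁, U, hr₁, hU₁, hU⟩ := runs_rowsProg hs.fixed hs.input hs.reg4 hJ hJd hM hW
  have hs₁ : SearchFixed e n d k t A s₁ := hs.frame hr₁.frame
    (fun x hx => by interval_cases x <;> rfl) rfl rfl rfl
  obtain ⟨s₂, V, hr₂, hV₂, h10, hmax⟩ := runs_colsProg hs₁.fixed hs₁.input hU₁ hs₁.ones
  have hs₂ : SearchFixed e n d k t A s₂ := hs₁.frame hr₂.frame
    (fun x hx => by interval_cases x <;> rfl) rfl rfl rfl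
  have e9 : s₂.reg 9 = s.reg 9 := by rw [hr₂.frame.reg 9 rfl, hr₁.frame.reg 9 rfl]
  obtain ⟨s₃, hr₃, hR₃, hle, hge⟩ := runs_recordProg hs₂.reg7 hs₂.reg8
    (by unfold Holds; rw [hr₂.frame.arr 10 rfl]; exact hU₁) hV₂ h10
    (by
      unfold Record Holds
      rw [e9, hr₂.frame.arr 1 rfl, hr₁.frame.arr 1 rfl, hr₂.frame.arr 2 rfl, hr₁.frame.arr 2 rfl]
      exact hR)
  exact ⟨s₃, (hr₁.seq (hr₂.seq hr₃)).mono (by unfold guessTime; omega), hR₃, by omega, U, hU,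
    fun V' => (Nat.succ_le_succ (hmax V')).trans hge⟩

/-! ### Exhaustive search over all guesses -/

variable (e) in
/-- Try all guesses. -/
def search : Program :=
  enumerate 4 4 1 19 20 (enumerate 5 4 6 21 22 (enumerate 6 5 3 23 24 (guessBody e)))

/-- A bound on the running time of `search`. -/
def searchTime (n d k t q : ℕ) : ℕ :=
  enumerateTime t d (enumerateTime t (d + 1) (enumerateTime (t * k) q (guessTime n d k t q)))

theorem Record.of_eq {n d k : ℕ} {A : ℕ → ℕ → F} {s s' : State} (h : Record e n d k A s)
    (h9 : s'.reg 9 = s.reg 9) (h1 : s'.arr 1 = s.arr 1) (h2 : s'.arr 2 = s.arr 2) :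
    Record e n d k A s' := by
  unfold Record Holds
  rw [h9, h1, h2]
  exact h

/-- Three nested enumerations, over indices, weights and columns; the visit predicate of an outer
loop quantifies over all candidates of the inner ones. Positivity of `d` makes the base-`d` digits
valid indices, and positivity of `k` lets a matrix be decoded from its flattened form. -/
theorem runs_search {n d k t : ℕ} {s : State} {A : ℕ → ℕ → F} (hd : 0 < d) (hk : 0 < k)
    (hs : SearchFixed e n d k t A s) (hR : Record e n d k A s) :
    ∃ s', Runs (search e) s (searchTime n d k t q) s' ∧ Record e n d k A s' ∧
      ∀ (J M : ℕ → ℕ) (W : ℕ → ℕ → F), (∀ i < t, J i < d) → (∀ i < t, M i ≤ d) →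
        Visited n d k t A J M W (s'.reg 9) := by
  have hq : 0 < q := (Nat.zero_le _).trans_lt (enc_lt e 0)
  obtain ⟨s', hr, hR', -, hV⟩ := runs_enumerate (a := 4) (len := 4) (base := 1) (N := 19) (c := 20)
    (ℓ := t) (b := d)
    (T := enumerateTime t (d + 1) (enumerateTime (t * k) q (guessTime n d k t q)))
    (s₀ := s) (body := enumerate 5 4 6 21 22 (enumerate 6 5 3 23 24 (guessBody e)))
    9 (Record e n d k A)
    (fun a v => ∀ b < (d + 1) ^ t, ∀ c < q ^ (t * k), Visited n d k t A
      (fun i => a / d ^ i % d) (fun i => b / (d + 1) ^ i % (d + 1))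
      (fun i l => dec e (c / q ^ (i * k + l) % q)) v)
    hs.reg4 hs.fixed.reg1 hd (by decide) (by decide) (by decide) (by decide)
    (by decide) (by decide) (by decide) (by decide) (by decide) (by decide) (by decide)
    (by decide) rfl rfl rfl rfl rfl
    (fun s s' hreg harr hI => hI.of_eq (hreg 9 (by decide) (by decide) (by decide))
      (harr 1 (by decide)) (harr 2 (by decide)))
    (fun i v w hvw h b hb c hc => (h b hb c hc).mono hvw)
    hR
    (by
      intro a ha s₁ hF₁ hJ hR₁
      have hs₁ : SearchFixed e n d k t A s₁ := hs.frame hF₁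
        (fun x hx => by interval_cases x <;> rfl) rfl rfl rfl
      refine runs_enumerate (s₀ := s₁) 9 (Record e n d k A)
        (fun b v => ∀ c < q ^ (t * k), Visited n d k t A
          (fun i => a / d ^ i % d) (fun i => b / (d + 1) ^ i % (d + 1))
          (fun i l => dec e (c / q ^ (i * k + l) % q)) v)
        hs₁.reg4 hs₁.reg6 (Nat.succ_pos d) (by decide) (by decide) (by decide) (by decide)
        (by decide) (by decide) (by decide) (by decide) (by decide) (by decide) (by decide)
        (by decide) rfl rfl rfl rfl rfl
        (fun s s' hreg harr hI => hI.of_eq (hreg 9 (by decide) (by decide) (by decide))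
          (harr 1 (by decide)) (harr 2 (by decide)))
        (fun i v w hvw h c hc => (h c hc).mono hvw)
        hR₁ ?_
      intro b hb s₂ hF₂ hM hR₂
      have hs₂ : SearchFixed e n d k t A s₂ := hs₁.frame hF₂
        (fun x hx => by interval_cases x <;> rfl) rfl rfl rfl
      refine runs_enumerate (s₀ := s₂) 9 (Record e n d k A)
        (fun c v => Visited n d k t A
          (fun i => a / d ^ i % d) (fun i => b / (d + 1) ^ i % (d + 1))
          (fun i l => dec e (c / q ^ (i * k + l) % q)) v)
        hs₂.reg5 hs₂.fixed.reg3 hq (by decide) (by decide) (by decide) (by decide)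
        (by decide) (by decide) (by decide) (by decide) (by decide) (by decide) (by decide)
        (by decide) rfl rfl rfl rfl rfl
        (fun s s' hreg harr hI => hI.of_eq (hreg 9 (by decide) (by decide) (by decide))
          (harr 1 (by decide)) (harr 2 (by decide)))
        (fun i v w hvw h => h.mono hvw)
        hR₂ ?_
      intro c hc s₃ hF₃ hW hR₃
      have hs₃ : SearchFixed e n d k t A s₃ := hs₂.frame hF₃
        (fun x hx => by interval_cases x <;> rfl) rfl rfl rfl
      refine runs_guessBody hs₃ ?_ (fun i hi => Nat.mod_lt _ hd) ?_ ?_ hR₃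
      · rw [hF₃.arr 4 rfl, hF₂.arr 4 rfl]; exact hJ
      · rw [hF₃.arr 5 rfl]; exact hM
      · intro i hi l hl
        rw [hW _ (index_lt hi hl), enc_dec e (Nat.mod_lt _ hq)])
  refine ⟨s', hr, hR', fun J M W hJ hM => ?_⟩
  obtain ⟨a, ha, haJ⟩ := exists_digits hJ
  obtain ⟨b, hb, hbM⟩ := exists_digits (b := d + 1) (f := M) fun i hi => Nat.lt_succ_of_le (hM i hi)
  obtain ⟨c, hc, hcW⟩ := exists_digits (b := q) (ℓ := t * k)
    (f := fun m => enc e (W (m / k) (m % k))) fun i hi => enc_lt e _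
  obtain ⟨U, hU, hU'⟩ := hV a ha b hb c hc
  -- The enumerated guess equals the given one only on the first `t` positions, which is all that
  -- the scores see.
  refine ⟨U, fun i hi => (hU i hi).congr (fun s hs l hl => ?_) (fun s hs => congrArg (A i) (haJ s hs)) hbM
    fun _ _ => rfl, hU'⟩
  rw [hcW _ (index_lt hs hl), dec_enc, Nat.mul_add_mod', Nat.mod_eq_of_lt hl, mul_comm s k,
    Nat.mul_add_div hk, Nat.div_eq_of_lt hl, add_zero]

variable (e) in
/-- The whole algorithm, which takes `C * k ^ 3` samples. -/
def lowRankProg (C : ℕ) : Program :=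
  .seq (.const 3 q) (.seq (loadTable 3 (fmaTable e) (q * q * q)) (.seq (.const 36 C)
    (.seq (mul 37 36 2) (.seq (mul 36 37 2) (.seq (mul 4 36 2) (.seq (mul 5 4 2)
    (.seq (.const 36 1) (.seq (.add 6 1 36) (.seq (mul 7 0 2) (.seq (mul 8 2 1)
    (.seq (forLoop 34 0 (.store 12 34 36)) (search e))))))))))))

/-- A bound on the running time of `lowRankProg`. -/
def lowRankTime (n d k C q : ℕ) : ℕ :=
  3 * (q * q * q) + 32 + 25 * k + 5 * d + n * 5 + searchTime n d k (C * k * k * k) q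

/-- Only `C` is part of the program text; the number `C * k ^ 3` of samples is computed at run time,
so one program serves all formats and ranks. -/
theorem runs_lowRankProg {n d k : ℕ} (C : ℕ) {s : State} {A : ℕ → ℕ → F} (hd : 0 < d) (hk : 0 < k)
    (h0 : s.reg 0 = n) (h1 : s.reg 1 = d) (h2 : s.reg 2 = k) (h9 : s.reg 9 = 0)
    (hA : Holds e 0 n d A s) :
    ∃ s', Runs (lowRankProg e C) s (lowRankTime n d k C q) s' ∧ Record e n d k A s' ∧
      ∀ (J M : ℕ → ℕ) (W : ℕ → ℕ → F), (∀ i < C * k * k * k, J i < d) →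
        (∀ i < C * k * k * k, M i ≤ d) → Visited n d k (C * k * k * k) A J M W (s'.reg 9) := by
  obtain ⟨s₁, hr₁, h₁⟩ := runs_loadTable 3 (fmaTable e) (q * q * q) (s.setReg 3 q)
  have k₁ : ∀ x, Keep x → s₁.reg x = (s.setReg 3 q).reg x := fun x hx =>
    hr₁.frame.reg x (loadTable_wr _ _ _ hx)
  have a₁ : s₁.arr 0 = s.arr 0 := hr₁.frame.arr 0 (loadTable_wa _ _ _ (by decide))
  obtain ⟨s₂, hs₂⟩ : ∃ s₂, s₂ = s₁.setReg 36 C := ⟨_, rfl⟩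
  have hr₂ := runs_const s₁ 36 C
  rw [← hs₂] at hr₂
  have hr₁₂ := ((runs_const s 3 q).seq (hr₁.seq hr₂))
  have k₂ : ∀ x < 11, s₂.reg x = (s.setReg 3 q).reg x := fun x hx => by
    rw [hr₂.frame.reg x (by simp [Program.wr]; omega), k₁ x (.inl hx)]
  have mulspec := fun (s : State) (z x y : ℕ) (hzx : x ≠ z) (hzy : y ≠ z) (hz : z ≠ 11)
    (hz' : z ≠ 12) (hx : x ≠ 11) (hx' : x ≠ 12) (hy : y ≠ 11) (hy' : y ≠ 12) =>
    runs_mul s hzx hzy hz hz' hx hx' hy hy'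
  obtain ⟨s₃, hr₃, h₃⟩ := mulspec s₂ 37 36 2 (by decide) (by decide) (by decide) (by decide)
    (by decide) (by decide) (by decide) (by decide)
  obtain ⟨s₄, hr₄, h₄⟩ := mulspec s₃ 36 37 2 (by decide) (by decide) (by decide) (by decide)
    (by decide) (by decide) (by decide) (by decide)
  obtain ⟨s₅, hr₅, h₅⟩ := mulspec s₄ 4 36 2 (by decide) (by decide) (by decide) (by decide)
    (by decide) (by decide) (by decide) (by decide)
  obtain ⟨s₆, hr₆, h₆⟩ := mulspec s₅ 5 4 2 (by decide) (by decide) (by decide) (by decide)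
    (by decide) (by decide) (by decide) (by decide)
  have e2 : s₂.reg 2 = k := by rw [k₂ 2 (by decide)]; simp [h2]
  have e3 : s₃.reg 2 = k := by rw [hr₃.frame.reg 2 rfl, e2]
  have e4 : s₄.reg 2 = k := by rw [hr₄.frame.reg 2 rfl, e3]
  have e5 : s₅.reg 2 = k := by rw [hr₅.frame.reg 2 rfl, e4]
  have e6 : s₆.reg 2 = k := by rw [hr₆.frame.reg 2 rfl, e5]
  have f2 : s₂.reg 36 = C := by simp [hs₂]
  rw [e2] at hr₃ h₃
  rw [e3] at hr₄ h₄
  rw [e4] at hr₅ h₅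
  rw [e5] at hr₆ h₆
  rw [f2] at h₃
  rw [h₃] at h₄
  rw [h₄] at h₅
  rw [h₅] at h₆
  have hr₃₆ := hr₃.seq (hr₄.seq (hr₅.seq hr₆))
  obtain ⟨s₇, hs₇⟩ : ∃ s₇, s₇ = (s₆.setReg 36 1).setReg 6
    ((s₆.setReg 36 1).reg 1 + (s₆.setReg 36 1).reg 36) := ⟨_, rfl⟩
  have hr₇ := (runs_const s₆ 36 1).seq (runs_add _ 6 1 36)
  rw [← hs₇] at hr₇
  have g0 : s₆.reg 0 = n := by rw [hr₃₆.frame.reg 0 rfl, k₂ 0 (by decide)]; simp [h0]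
  have g1 : s₆.reg 1 = d := by rw [hr₃₆.frame.reg 1 rfl, k₂ 1 (by decide)]; simp [h1]
  have g3 : s₆.reg 3 = q := by rw [hr₃₆.frame.reg 3 rfl, k₂ 3 (by decide)]; simp
  have g9 : s₆.reg 9 = 0 := by rw [hr₃₆.frame.reg 9 rfl, k₂ 9 (by decide)]; simp [h9]
  obtain ⟨s₈, hr₈, h₈⟩ := mulspec s₇ 7 0 2 (by decide) (by decide) (by decide) (by decide)
    (by decide) (by decide) (by decide) (by decide)
  have e7 : s₇.reg 2 = k := by rw [hr₇.frame.reg 2 rfl, e6]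
  rw [e7, hr₇.frame.reg 0 rfl, g0] at h₈
  rw [e7] at hr₈
  obtain ⟨s₉, hr₉, h₉⟩ := mulspec s₈ 8 2 1 (by decide) (by decide) (by decide) (by decide)
    (by decide) (by decide) (by decide) (by decide)
  have e8 : s₈.reg 2 = k := by rw [hr₈.frame.reg 2 rfl, e7]
  have e8' : s₈.reg 1 = d := by rw [hr₈.frame.reg 1 rfl, hr₇.frame.reg 1 rfl, g1]
  rw [e8, e8'] at h₉
  rw [e8'] at hr₉
  have hr₇₉ := hr₇.seq (hr₈.seq hr₉)
  have u36 : s₉.reg 36 = 1 := by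
    rw [hr₉.frame.reg 36 rfl, hr₈.frame.reg 36 rfl]; simp [hs₇]
  obtain ⟨s', hr', hones⟩ := runs_forLoop (i := 34) (N := 0) (n := n) (T := 1) (s₀ := s₉)
    (body := .store 12 34 36) (fun i s => ∀ j < i, s.arr 12 j = 1)
    (by rw [hr₇₉.frame.reg 0 rfl, g0]) (by decide) (by decide) (by decide) rfl rfl
    (fun i s s' hreg harr hI => by rw [harr]; exact hI) (by simp)
    (by
      intro i hi s₁ hF h34 hI
      have : s₁.reg 36 = 1 := by rw [hF.reg 36 rfl, u36]
      refine ⟨_, runs_store _ 12 34 36, fun j hj => ?_⟩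
      rcases Nat.lt_succ_iff_lt_or_eq.1 hj with hj | rfl
      · simp [h34, hj.ne, hI j hj]
      · simp [h34, this])
  have hr₈₉ := hr₈.seq hr₉
  have hfix : SearchFixed e n d k (C * k * k * k) A s' := by
    refine ⟨⟨?_, ?_, ?_, ?_, ?_⟩, ?_, ?_, ?_, ?_, ?_, ?_, hones⟩
    · rw [hr'.frame.reg 0 rfl, hr₇₉.frame.reg 0 rfl, g0]
    · rw [hr'.frame.reg 1 rfl, hr₇₉.frame.reg 1 rfl, g1]
    · rw [hr'.frame.reg 2 rfl, hr₇₉.frame.reg 2 rfl, e6]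
    · rw [hr'.frame.reg 3 rfl, hr₇₉.frame.reg 3 rfl, g3]
    · rw [hr'.frame.arr 3 rfl, hr₇₉.frame.arr 3 rfl, hr₃₆.frame.arr 3 rfl, hr₂.frame.arr 3 rfl]
      exact h₁
    · rw [hr'.frame.reg 4 rfl, hr₇₉.frame.reg 4 rfl, hr₆.frame.reg 4 rfl, h₅]
    · rw [hr'.frame.reg 5 rfl, hr₇₉.frame.reg 5 rfl, h₆]
    · rw [hr'.frame.reg 6 rfl, hr₈₉.frame.reg 6 rfl]; simp [hs₇, g1]
    · rw [hr'.frame.reg 7 rfl, hr₉.frame.reg 7 rfl, h₈]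
    · rw [hr'.frame.reg 8 rfl, h₉]
    · unfold Holds
      rw [hr'.frame.arr 0 rfl, hr₇₉.frame.arr 0 rfl, hr₃₆.frame.arr 0 rfl, hr₂.frame.arr 0 rfl, a₁]
      exact hA
  obtain ⟨s'', hr'', hR, hV⟩ := runs_search hd hk hfix
    (.inl (by rw [hr'.frame.reg 9 rfl, hr₇₉.frame.reg 9 rfl, g9]))
  refine ⟨s'', ((runs_const s 3 q).seq (hr₁.seq (hr₂.seq (hr₃.seq (hr₄.seq (hr₅.seq (hr₆.seq
    ((runs_const s₆ 36 1).seq ((runs_add _ 6 1 36).seq (hs₇ ▸ hr₈.seq (hr₉.seq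
      (hr'.seq hr'')))))))))))).mono ?_, hR, hV⟩
  unfold lowRankTime
  omega

end Algorithm

/-! ### Sensitivities of a linear code -/

section Sensitivity

variable {F ι : Type*} [Field F] [Fintype ι]

-- Greedy peeling. A codeword `c₁` of minimum positive weight `w` on `J` gives every coordinate of
-- its support the value `w`, and these `w` reciprocals add up to one. Off the support, each
-- codeword can be corrected by a multiple of `c₁` so as to vanish at a fixed support point, which
-- lowers the dimension. At most `r` rounds occur; coordinates left over get the length of the code,
-- whence the last summand.
open Classical in
theorem exists_sensitivities_on (r : ℕ) (C : Submodule F (ι → F)) (hC : Module.finrank F C ≤ r)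
    (J : Finset ι) :
    ∃ m : ι → ℕ, (∀ j ∈ J, 1 ≤ m j ∧ m j ≤ Fintype.card ι) ∧
      (∀ c ∈ C, ∀ j ∈ J, c j ≠ 0 → m j ≤ #{i ∈ J | c i ≠ 0}) ∧
      ∑ j ∈ J, (1 / m j : ℝ) ≤ r + #J / Fintype.card ι := by
  induction r generalizing C J with
  | zero =>
    have hbot : C = ⊥ := Submodule.finrank_eq_zero.1 (Nat.le_zero.1 hC)
    refine ⟨fun _ => Fintype.card ι, fun j _ => ⟨Fintype.card_pos_iff.2 ⟨j⟩, le_rfl⟩, ?_, ?_⟩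
    · rintro c hc j _ hcj
      rw [hbot, Submodule.mem_bot] at hc
      exact absurd (congrFun hc j) hcj
    · simp [div_eq_mul_inv]
  | succ r ih =>
    by_cases h0 : ∀ c ∈ C, ∀ j ∈ J, c j = 0
    · refine ⟨fun _ => Fintype.card ι, fun j _ => ⟨Fintype.card_pos_iff.2 ⟨j⟩, le_rfl⟩,
        fun c hc j hj hcj => absurd (h0 c hc j hj) hcj, ?_⟩
      simp only [sum_const, nsmul_eq_mul, Nat.cast_succ]
      rw [mul_one_div]
      have : (0 : ℝ) ≤ r := Nat.cast_nonneg r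
      linarith
    push Not at h0
    have hex : ∃ w, ∃ c ∈ C, #{i ∈ J | c i ≠ 0} = w ∧ 0 < w := by
      obtain ⟨c, hc, j, hj, hcj⟩ := h0
      exact ⟨_, c, hc, rfl, card_pos.2 ⟨j, by simp [hj, hcj]⟩⟩
    -- Minimality of `w` is what makes it a valid lower bound at every coordinate of the support of
    -- `c₁`.
    obtain ⟨c₁, hc₁, hw, hw0⟩ := Nat.find_spec hex
    set w := Nat.find hex with hwdef
    have hmin : ∀ c ∈ C, ∀ j ∈ J, c j ≠ 0 → w ≤ #{i ∈ J | c i ≠ 0} := fun c hc j hj hcj =>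
      Nat.find_min' hex ⟨c, hc, rfl, card_pos.2 ⟨j, by simp [hj, hcj]⟩⟩
    obtain ⟨j₀, hj₀⟩ := card_pos.1 (hw ▸ hw0)
    rw [mem_filter] at hj₀
    set C' := C ⊓ LinearMap.ker (LinearMap.proj j₀ : (ι → F) →ₗ[F] F) with hC'
    have hlt : C' < C := lt_of_le_of_ne inf_le_left fun h => hj₀.2 (by
      have : c₁ ∈ C' := h ▸ hc₁
      simpa [hC'] using this.2)
    have hfin := Submodule.finrank_lt_finrank_of_lt hlt
    obtain ⟨m, hm1, hm2, hm3⟩ := ih C' (by omega) {j ∈ J | c₁ j = 0}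
    refine ⟨fun j => if c₁ j = 0 then m j else w, fun j hj => ?_, fun c hc j hj hcj => ?_, ?_⟩
    · by_cases h : c₁ j = 0
      · simpa [h] using hm1 j (by simp [hj, h])
      · simp only [h, if_false]
        exact ⟨hw0, hw ▸ card_le_univ _⟩
    · by_cases h : c₁ j = 0
      · simp only [h, if_true]
        -- The correction cancels the entry at `j₀` and leaves all coordinates where `c₁` vanishes
        -- unchanged, so the weight of `c` there is preserved.
        have hmem : c - (c j₀ / c₁ j₀) • c₁ ∈ C' := by
          refine ⟨C.sub_mem hc (C.smul_mem _ hc₁), ?_⟩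
          simp [div_mul_cancel₀ _ hj₀.2]
        refine (hm2 _ hmem j (by simp [hj, h]) (by simpa [h] using hcj)).trans
          (card_le_card fun i hi => ?_)
        simp only [mem_filter, Pi.sub_apply, Pi.smul_apply, smul_eq_mul] at hi ⊢
        refine ⟨hi.1.1, ?_⟩
        have := hi.2
        rwa [hi.1.2, mul_zero, sub_zero] at this
      · simpa only [h, if_false] using hmin c hc j hj hcj
    · rw [← sum_filter_add_sum_filter_not J (fun j => c₁ j = 0)]
      have h1 : ∑ j ∈ J with c₁ j = 0, (1 / ((if c₁ j = 0 then m j else w : ℕ) : ℝ)) =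
          ∑ j ∈ J with c₁ j = 0, (1 / m j : ℝ) :=
        sum_congr rfl fun j hj => by rw [if_pos (mem_filter.1 hj).2]
      have h2 : ∑ j ∈ J with ¬ c₁ j = 0, (1 / ((if c₁ j = 0 then m j else w : ℕ) : ℝ)) = 1 := by
        rw [sum_congr rfl fun j hj => by rw [if_neg (mem_filter.1 hj).2], sum_const, hw,
          nsmul_eq_mul, mul_one_div, div_self (by exact_mod_cast hw0.ne')]
      have h3 : (#{j ∈ J | c₁ j = 0} : ℝ) / Fintype.card ι ≤ #J / Fintype.card ι := by
        gcongr
        exact filter_subset _ _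
      rw [h1, h2]
      push_cast
      linarith

open Classical in
/-- The sensitivities of a linear code: reciprocals of weights `m j` such that every code word
that does not vanish at `j` has Hamming weight at least `m j`. Their sum is at most one plus the
dimension of the code. -/
theorem exists_sensitivities (C : Submodule F (ι → F)) :
    ∃ m : ι → ℕ, (∀ j, 1 ≤ m j ∧ m j ≤ Fintype.card ι) ∧
      (∀ c ∈ C, ∀ j, c j ≠ 0 → m j ≤ #{i | c i ≠ 0}) ∧
      ∑ j, (1 / m j : ℝ) ≤ Module.finrank F C + 1 := by
  obtain ⟨m, h1, h2, h3⟩ := exists_sensitivities_on _ C le_rfl univ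
  refine ⟨m, fun j => h1 j (mem_univ j), fun c hc j => h2 c hc j (mem_univ j), h3.trans ?_⟩
  gcongr
  rw [card_univ]
  exact div_self_le_one _

end Sensitivity

/-! ### Expectations over independent samples and a weighted deviation bound -/

section Sampling

variable {ι : Type*} [Fintype ι]

/-- The expectation of `f` over `t` independent samples from the distribution `p`. -/
def expect (p : ι → ℝ) {t : ℕ} (f : (Fin t → ι) → ℝ) : ℝ := ∑ S, (∏ s, p (S s)) * f S

theorem expect_prod (p : ι → ℝ) {t : ℕ} (g : Fin t → ι → ℝ) :
    expect p (fun S => ∏ s, g s (S s)) = ∏ s, ∑ j, p j * g s j := by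
  classical
  rw [Finset.prod_univ_sum]
  simp only [expect, ← prod_mul_distrib, Fintype.piFinset_univ]

theorem expect_mono {p : ι → ℝ} (hp : ∀ j, 0 ≤ p j) {t : ℕ} {f g : (Fin t → ι) → ℝ}
    (h : ∀ S, f S ≤ g S) : expect p f ≤ expect p g :=
  sum_le_sum fun S _ => mul_le_mul_of_nonneg_left (h S) (prod_nonneg fun _ _ => hp _)

theorem expect_sum {κ : Type*} (p : ι → ℝ) {t : ℕ} (A : Finset κ) (f : κ → (Fin t → ι) → ℝ) :
    expect p (fun S => ∑ a ∈ A, f a S) = ∑ a ∈ A, expect p (f a) := by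
  simp only [expect, mul_sum]
  exact sum_comm

theorem expect_add (p : ι → ℝ) {t : ℕ} (f g : (Fin t → ι) → ℝ) :
    expect p (fun S => f S + g S) = expect p f + expect p g := by
  simp only [expect, mul_add, sum_add_distrib]

theorem expect_const_mul (p : ι → ℝ) {t : ℕ} (c : ℝ) (f : (Fin t → ι) → ℝ) :
    expect p (fun S => c * f S) = c * expect p f := by
  simp only [expect, mul_sum]
  exact sum_congr rfl fun _ _ => by ring

theorem expect_one {p : ι → ℝ} (hp : ∑ j, p j = 1) {t : ℕ} :
    expect p (fun _ : Fin t → ι => 1) = 1 := by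
  have := expect_prod p (t := t) (fun _ _ => 1)
  simpa [hp] using this

open Classical in
/-- A deviation inequality for sums of independent samples, weighted by a further sum. -/
theorem expect_deviation {p : ι → ℝ} (hp : ∀ j, 0 ≤ p j) (hp1 : ∑ j, p j = 1) {y : ι → ℝ}
    (hy0 : ∑ j, p j * y j ≤ 0) {R η : ℝ} (hR : 1 ≤ R) (hyR : ∀ j, |y j| ≤ R) (hη : 0 < η)
    (hη1 : η ≤ 1) {f : ι → ℝ} (hf : ∀ j, 0 ≤ f j) (t : ℕ) :
    expect p (fun S : Fin t → ι => (∑ s, f (S s)) * if t * η < ∑ s, y (S s) then 1 else 0) ≤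
      t * (∑ j, p j * f j) * (3 * Real.exp (-(t * (η ^ 2 / (4 * R ^ 2))))) := by
  -- This `θ` minimises `θ ^ 2 * R ^ 2 - θ * η`, with minimum `-α`.
  set θ := η / (2 * R ^ 2) with hθ
  set α := η ^ 2 / (4 * R ^ 2) with hα
  have hθ0 : 0 < θ := by positivity
  have hα1 : α ≤ 1 / 4 := by
    rw [hα, div_le_div_iff₀ (by positivity) (by norm_num)]
    nlinarith
  have hθR : θ * R ≤ 1 / 2 := by
    rw [hθ, div_mul_eq_mul_div, div_le_div_iff₀ (by positivity) (by norm_num)]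
    nlinarith
  set g : ι → ℝ := fun j => Real.exp (θ * (y j - η)) with hg
  have hgpos : ∀ j, 0 < g j := fun j => Real.exp_pos _
  have hgle : ∀ j, g j ≤ Real.exp (1 / 2) := fun j => Real.exp_le_exp.2 (by
    have := (abs_le.1 (hyR j)).2
    nlinarith)
  have hEg : ∑ j, p j * g j ≤ Real.exp (-α) := by
    -- Since `|θ * y j| ≤ 1 / 2`, the second-order estimate of `exp` applies; its linear term has
    -- nonpositive mean.
    have h1 : ∀ j, Real.exp (θ * y j) ≤ 1 + θ * y j + θ ^ 2 * R ^ 2 := fun j => by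
      have hb : |θ * y j| ≤ θ * R := by
        rw [abs_mul, abs_of_pos hθ0]
        exact mul_le_mul_of_nonneg_left (hyR j) hθ0.le
      have h := (abs_le.1 (Real.abs_exp_sub_one_sub_id_le (x := θ * y j) (by linarith))).2
      have hsq : (θ * y j) ^ 2 ≤ (θ * R) ^ 2 := sq_le_sq' (by linarith [(abs_le.1 hb).1])
        (abs_le.1 hb).2
      nlinarith
    have h2 : ∑ j, p j * Real.exp (θ * y j) ≤ Real.exp (θ ^ 2 * R ^ 2) := by
      calc ∑ j, p j * Real.exp (θ * y j)
          ≤ ∑ j, (p j * (1 + θ ^ 2 * R ^ 2) + θ * (p j * y j)) := sum_le_sum fun j _ => by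
            have := mul_le_mul_of_nonneg_left (h1 j) (hp j)
            linarith
        _ = 1 + θ ^ 2 * R ^ 2 + θ * ∑ j, p j * y j := by
            rw [sum_add_distrib, ← sum_mul, hp1, ← mul_sum, one_mul]
        _ ≤ θ ^ 2 * R ^ 2 + 1 := by nlinarith
        _ ≤ _ := Real.add_one_le_exp _
    have h3 : ∑ j, p j * g j = Real.exp (-(θ * η)) * ∑ j, p j * Real.exp (θ * y j) := by
      rw [mul_sum]
      refine sum_congr rfl fun j _ => ?_
      rw [hg]
      simp only
      rw [show θ * (y j - η) = θ * y j + -(θ * η) by ring, Real.exp_add]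
      ring
    rw [h3]
    refine (mul_le_mul_of_nonneg_left h2 (Real.exp_pos _).le).trans ?_
    rw [← Real.exp_add]
    refine Real.exp_le_exp.2 (le_of_eq ?_)
    rw [hθ, hα]
    field_simp
    ring
  have hfg : ∑ j, p j * (f j * g j) ≤ (∑ j, p j * f j) * Real.exp (1 / 2) := by
    rw [sum_mul]
    refine sum_le_sum fun j _ => ?_
    have := mul_le_mul_of_nonneg_left (hgle j) (mul_nonneg (hp j) (hf j))
    linarith
  have hpf : 0 ≤ ∑ j, p j * f j := sum_nonneg fun j _ => mul_nonneg (hp j) (hf j)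
  -- Independence factorises the expectation. The weight spoils only the factor at `s₀`, where `g`
  -- is bounded by `exp (1 / 2)`; the other `t - 1` factors each contribute `exp (-α)`.
  have hone : ∀ s₀ : Fin t, expect p (fun S : Fin t → ι => f (S s₀) * ∏ s, g (S s)) ≤
      (∑ j, p j * f j) * (3 * Real.exp (-(t * α))) := fun s₀ => by
    have h1 : (fun S : Fin t → ι => f (S s₀) * ∏ s, g (S s)) =
        fun S => ∏ s, (fun s j => if s = s₀ then f j * g j else g j) s (S s) := by
      funext S
      rw [← mul_prod_erase univ _ (mem_univ s₀), ← mul_prod_erase univ _ (mem_univ s₀), ← mul_assoc]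
      simp only [if_true]
      congr 1
      exact prod_congr rfl fun s hs => by rw [if_neg (ne_of_mem_erase hs)]
    rw [h1]
    refine (expect_prod p fun (s : Fin t) j => if s = s₀ then f j * g j else g j).le.trans ?_
    rw [← mul_prod_erase univ _ (mem_univ s₀)]
    simp only [if_true]
    rw [prod_congr rfl fun s hs => by
      rw [sum_congr rfl fun j _ => by rw [if_neg (ne_of_mem_erase hs)]], prod_const,
      card_erase_of_mem (mem_univ _), card_univ, Fintype.card_fin]
    -- The missing `t`-th factor costs `exp α ≤ exp (1 / 4)`. Altogether the loss is `exp (3 / 4) ≤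
    -- 3`.
    have hpow : (∑ j, p j * g j) ^ (t - 1) ≤ Real.exp (-(t * α)) * Real.exp (1 / 4) := by
      refine (pow_le_pow_left₀ (sum_nonneg fun j _ => mul_nonneg (hp j) (hgpos j).le) hEg _).trans ?_
      rw [← Real.exp_nat_mul, ← Real.exp_add]
      have ht : 1 ≤ t := by have := s₀.2; omega
      refine Real.exp_le_exp.2 ?_
      push_cast [Nat.cast_sub ht]
      linarith
    have h3 : Real.exp (1 / 2) * Real.exp (1 / 4) ≤ 3 := by
      rw [← Real.exp_add]
      have h4 : Real.exp (1 / 2 + 1 / 4) ≤ Real.exp 1 := Real.exp_le_exp.2 (by norm_num)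
      linarith [Real.exp_one_lt_d9]
    calc (∑ j, p j * (f j * g j)) * (∑ j, p j * g j) ^ (t - 1)
        ≤ ((∑ j, p j * f j) * Real.exp (1 / 2)) * (Real.exp (-(t * α)) * Real.exp (1 / 4)) :=
          mul_le_mul hfg hpow (pow_nonneg (sum_nonneg fun j _ => mul_nonneg (hp j) (hgpos j).le) _)
            (by positivity)
      _ = (∑ j, p j * f j) * Real.exp (-(t * α)) * (Real.exp (1 / 2) * Real.exp (1 / 4)) := by ring
      _ ≤ (∑ j, p j * f j) * Real.exp (-(t * α)) * 3 :=
          mul_le_mul_of_nonneg_left h3 (by positivity)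
      _ = _ := by ring
  calc expect p (fun S : Fin t → ι => (∑ s, f (S s)) * if t * η < ∑ s, y (S s) then 1 else 0)
      ≤ expect p (fun S : Fin t → ι => ∑ s₀, f (S s₀) * ∏ s, g (S s)) := by
        -- Markov's device: the product of the `g (S s)` is `exp (θ * (∑ y - t * η))`, which
        -- dominates the indicator.
        refine expect_mono hp fun S => ?_
        rw [← sum_mul]
        refine mul_le_mul_of_nonneg_left ?_ (sum_nonneg fun _ _ => hf _)
        split_ifs with h
        · rw [hg, ← Real.exp_sum, ← mul_sum, sum_sub_distrib]
          refine Real.one_le_exp (mul_nonneg hθ0.le ?_)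
          simp only [sum_const, card_univ, Fintype.card_fin, nsmul_eq_mul]
          linarith
        · exact prod_nonneg fun _ _ => (hgpos _).le
    _ = ∑ s₀, expect p (fun S : Fin t → ι => f (S s₀) * ∏ s, g (S s)) := expect_sum p _ _
    _ ≤ ∑ s₀ : Fin t, (∑ j, p j * f j) * (3 * Real.exp (-(t * α))) :=
        sum_le_sum fun s₀ _ => hone s₀
    _ = _ := by simp; ring

end Sampling

/-! ### Hamming distance -/

section Hamming

variable {F ι : Type*} [Fintype ι]

open Classical in
/-- The indicator of `x ≠ y`. -/
noncomputable def err (x y : F) : ℝ := if x = y then 0 else 1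

theorem err_nonneg (x y : F) : 0 ≤ err x y := by unfold err; split_ifs <;> simp

@[simp] theorem err_self (x : F) : err x x = 0 := by simp [err]

theorem err_of_ne {x y : F} (h : x ≠ y) : err x y = 1 := by simp [err, h]

theorem err_le_one (x y : F) : err x y ≤ 1 := by unfold err; split_ifs <;> simp

theorem err_triangle (x y z : F) : err y z ≤ err x y + err x z := by
  by_cases h : x = y
  · rw [h, err_self, zero_add]
  · rw [err_of_ne h]
    linarith [err_le_one y z, err_nonneg x z]

theorem abs_err_sub_err (x y z : F) : |err x y - err x z| ≤ err y z := by
  by_cases h : y = z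
  · simp [h]
  · rw [err_of_ne h, abs_le]
    constructor <;> linarith [err_nonneg x y, err_nonneg x z, err_le_one x y, err_le_one x z]

/-- The Hamming distance as a real number. -/
noncomputable def dist (x y : ι → F) : ℝ := ∑ j, err (x j) (y j)

theorem dist_nonneg (x y : ι → F) : 0 ≤ dist x y := sum_nonneg fun _ _ => err_nonneg _ _

theorem dist_triangle (x y z : ι → F) : dist y z ≤ dist x y + dist x z := by
  unfold dist
  rw [← sum_add_distrib]
  exact sum_le_sum fun j _ => err_triangle _ _ _

theorem err_comm (x y : F) : err x y = err y x := by
  by_cases h : x = y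
  · rw [h]
  · rw [err_of_ne h, err_of_ne (Ne.symm h)]

theorem dist_comm (x y : ι → F) : dist x y = dist y x :=
  sum_congr rfl fun _ _ => err_comm _ _

theorem dist_pos {x y : ι → F} (h : x ≠ y) : 0 < dist x y := by
  obtain ⟨j, hj⟩ := Function.ne_iff.1 h
  exact sum_pos' (fun _ _ => err_nonneg _ _) ⟨j, mem_univ j, by rw [err_of_ne hj]; norm_num⟩

theorem abs_dist_sub_dist (x y z : ι → F) : |dist x y - dist x z| ≤ dist y z := by
  unfold dist
  rw [← sum_sub_distrib]
  exact (abs_sum_le_sum_abs _ _).trans (sum_le_sum fun j _ => abs_err_sub_err _ _ _)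

end Hamming

/-- Strictness is needed in the averaging argument: when the optimum is zero, non-strict
inequalities would give no contradiction. -/
theorem expect_lt {ι : Type*} [Fintype ι] {p : ι → ℝ} (hp : ∀ j, 0 < p j) {t : ℕ}
    {f g : (Fin t → ι) → ℝ} (h : ∀ S, f S ≤ g S) {S₀ : Fin t → ι} (h0 : f S₀ < g S₀) :
    expect p f < expect p g :=
  sum_lt_sum (fun S _ => mul_le_mul_of_nonneg_left (h S) (prod_nonneg fun _ _ => (hp _).le))
    ⟨S₀, mem_univ _, mul_lt_mul_of_pos_left h0 (prod_pos fun _ _ => hp _)⟩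

/-! ### Importance sampling for a linear code -/

section Code

variable {F ι X : Type*} [Field F] [Fintype ι] [AddCommGroup X]

/-- The total sensitivity of the coordinates. -/
noncomputable def totalSens (m : ι → ℕ) : ℝ := ∑ j, (1 / m j : ℝ)

/-- The normalized deviation of the sampled difference of the errors of `u` and `u₀` from its
expectation. -/
noncomputable def dev (c : X →+ (ι → F)) (m : ι → ℕ) (a : ι → F) (u₀ u : X) (j : ι) : ℝ :=
  (dist a (c u) - dist a (c u₀) - totalSens m * m j * (err (a j) (c u j) - err (a j) (c u₀ j))) /
    dist (c u) (c u₀)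

/-- The samples `S` misjudge the difference of the errors of `u₀` and of some other vector. -/
def Misjudges (c : X →+ (ι → F)) (m : ι → ℕ) (η : ℝ) (a : ι → F) (u₀ : X) {t : ℕ}
    (S : Fin t → ι) : Prop :=
  ∃ u, c u ≠ c u₀ ∧ t * η < ∑ s, dev c m a u₀ u (S s)

/-- The distribution of a sample: proportional to the sensitivities. -/
noncomputable def sampleProb (m : ι → ℕ) (j : ι) : ℝ := 1 / (totalSens m * m j)

theorem totalSens_pos [Nonempty ι] {m : ι → ℕ} (hm : ∀ j, 1 ≤ m j) : 0 < totalSens m :=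
  sum_pos (fun j _ => by have := hm j; positivity) univ_nonempty

theorem sampleProb_pos [Nonempty ι] {m : ι → ℕ} (hm : ∀ j, 1 ≤ m j) (j : ι) :
    0 < sampleProb m j := by
  have := totalSens_pos hm
  have := hm j
  unfold sampleProb
  positivity

theorem sum_sampleProb [Nonempty ι] {m : ι → ℕ} (hm : ∀ j, 1 ≤ m j) :
    ∑ j, sampleProb m j = 1 := by
  have h := totalSens_pos hm
  have : ∀ j, sampleProb m j = 1 / totalSens m * (1 / m j) := fun j => by
    rw [sampleProb, one_div_mul_one_div]
  simp only [this]
  rw [← mul_sum, ← totalSens, one_div_mul_cancel h.ne']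

/-- The importance weight cancels the sampling probability, which makes the estimator unbiased. -/
theorem sampleProb_mul [Nonempty ι] {m : ι → ℕ} (hm : ∀ j, 1 ≤ m j) (j : ι) (x : ℝ) :
    sampleProb m j * (totalSens m * m j * x) = x := by
  have h := totalSens_pos hm
  have h' : (m j : ℝ) ≠ 0 := by have := hm j; positivity
  unfold sampleProb
  field_simp

variable {c : X →+ (ι → F)} {m : ι → ℕ}

/-- A sampled term is nonzero only where the two codewords differ, and there `m j` is at most their
distance. Dividing by that distance bounds the term by the total sensitivity, and the exact
difference by one. -/
theorem abs_dev_le [Nonempty ι] (hm : ∀ j, 1 ≤ m j)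
    (hc : ∀ u u' j, c u j ≠ c u' j → (m j : ℝ) ≤ dist (c u) (c u')) (a : ι → F) {u₀ u : X}
    (hu : c u ≠ c u₀) (j : ι) : |dev c m a u₀ u j| ≤ totalSens m + 1 := by
  have hK := totalSens_pos hm
  have hM := dist_pos hu
  unfold dev
  rw [abs_div, abs_of_pos hM, div_le_iff₀ hM]
  have h1 := abs_dist_sub_dist a (c u) (c u₀)
  have h2 : |totalSens m * m j * (err (a j) (c u j) - err (a j) (c u₀ j))| ≤
      totalSens m * dist (c u) (c u₀) := by
    rw [abs_mul, abs_of_nonneg (by positivity), mul_assoc]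
    refine mul_le_mul_of_nonneg_left ?_ hK.le
    have h3 := abs_err_sub_err (a j) (c u j) (c u₀ j)
    by_cases h : c u j = c u₀ j
    · simp [h, hM.le]
    · rw [err_of_ne h] at h3
      calc (m j : ℝ) * |err (a j) (c u j) - err (a j) (c u₀ j)| ≤ m j * 1 := by gcongr
        _ ≤ _ := by rw [mul_one]; exact hc _ _ _ h
  calc _ ≤ _ := abs_sub _ _
    _ ≤ _ := add_le_add h1 h2
    _ = _ := by ring

theorem sum_sampleProb_mul_dev [Nonempty ι] (hm : ∀ j, 1 ≤ m j) (a : ι → F) (u₀ u : X) :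
    ∑ j, sampleProb m j * dev c m a u₀ u j = 0 := by
  have h : ∀ j, sampleProb m j * dev c m a u₀ u j =
      (sampleProb m j * (dist a (c u) - dist a (c u₀)) -
        (err (a j) (c u j) - err (a j) (c u₀ j))) / dist (c u) (c u₀) := fun j => by
    rw [dev, mul_div_assoc', mul_sub, sampleProb_mul hm]
  simp only [h]
  rw [← sum_div, sum_sub_distrib, ← sum_mul, sum_sampleProb hm, sum_sub_distrib]
  simp [dist]

-- Union bound over `X` on top of `expect_deviation`, keeping the weight `f` inside the expectation.
open Classical in
theorem expect_misjudges [Fintype X] [Nonempty ι] (hm : ∀ j, 1 ≤ m j)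
    (hc : ∀ u u' j, c u j ≠ c u' j → (m j : ℝ) ≤ dist (c u) (c u')) {η : ℝ} (hη : 0 < η)
    (hη1 : η ≤ 1) {R : ℝ} (hR : totalSens m + 1 ≤ R) (a : ι → F) (u₀ : X) {f : ι → ℝ}
    (hf : ∀ j, 0 ≤ f j) (t : ℕ) :
    expect (sampleProb m) (fun S : Fin t → ι =>
      (∑ s, f (S s)) * if Misjudges c m η a u₀ S then 1 else 0) ≤
    t * (∑ j, sampleProb m j * f j) *
      (Fintype.card X * (3 * Real.exp (-(t * (η ^ 2 / (4 * R ^ 2)))))) := by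
  have hp := fun j => (sampleProb_pos hm j).le
  have hK := totalSens_pos hm
  have hpf : 0 ≤ ∑ j, sampleProb m j * f j := sum_nonneg fun j _ => mul_nonneg (hp j) (hf j)
  calc _ ≤ expect (sampleProb m) (fun S : Fin t → ι => ∑ u with c u ≠ c u₀,
        (∑ s, f (S s)) * if t * η < ∑ s, dev c m a u₀ u (S s) then 1 else 0) := by
        refine expect_mono hp fun S => ?_
        rw [← mul_sum]
        refine mul_le_mul_of_nonneg_left ?_ (sum_nonneg fun _ _ => hf _)
        split_ifs with h
        · obtain ⟨u, hu, h⟩ := h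
          refine le_trans ?_ (single_le_sum (fun _ _ => by positivity)
            (mem_filter.2 ⟨mem_univ u, hu⟩))
          rw [if_pos h]
        · positivity
    _ = _ := expect_sum _ _ _
    _ ≤ ∑ u : X with c u ≠ c u₀, t * (∑ j, sampleProb m j * f j) *
          (3 * Real.exp (-(t * (η ^ 2 / (4 * R ^ 2))))) := by
        refine sum_le_sum fun u hu => ?_
        exact expect_deviation hp (sum_sampleProb hm) (sum_sampleProb_mul_dev hm a u₀ u).le
          (by linarith) (fun j => (abs_dev_le hm hc a (mem_filter.1 hu).2 j).trans hR) hη hη1 hf t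
    _ ≤ Fintype.card X * (t * (∑ j, sampleProb m j * f j) *
          (3 * Real.exp (-(t * (η ^ 2 / (4 * R ^ 2)))))) := by
        rw [sum_const, nsmul_eq_mul]
        have : #{u : X | c u ≠ c u₀} ≤ Fintype.card X := card_le_univ _
        gcongr
    _ = _ := by ring

theorem sum_dev_le {η : ℝ} {a : ι → F} {u₀ u : X} {t : ℕ} {S : Fin t → ι} (hu : c u ≠ c u₀)
    (h : ¬ Misjudges c m η a u₀ S) :
    t * (dist a (c u) - dist a (c u₀)) ≤ t * η * dist (c u) (c u₀) +
      totalSens m * ∑ s, m (S s) * (err (a (S s)) (c u (S s)) - err (a (S s)) (c u₀ (S s))) := by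
  have hM := dist_pos hu
  have h1 : ∑ s, dev c m a u₀ u (S s) ≤ t * η := by
    by_contra h2
    exact h ⟨u, hu, not_le.1 h2⟩
  simp only [dev] at h1
  rw [← sum_div, div_le_iff₀ hM, sum_sub_distrib] at h1
  simp only [sum_const, card_univ, Fintype.card_fin, nsmul_eq_mul] at h1
  rw [mul_sum]
  simp only [mul_assoc] at h1 ⊢
  linarith

open Classical in
/-- If the samples judge the code itself correctly, then a vector `v` that fits `a` on the samples
at least as well as `u₀` is not much worse than `u₀` everywhere. -/
theorem dist_le_of_samples [Nonempty ι] (hm : ∀ j, 1 ≤ m j) {η : ℝ} (hη : 0 < η)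
    (hη1 : η ≤ 1 / 2) {a : ι → F} {u₀ v : X} {t : ℕ} (ht : 0 < t) {S : Fin t → ι}
    (hS : ¬ Misjudges c m η 0 0 S)
    (hv : ∑ s, m (S s) * err (a (S s)) (c v (S s)) ≤
      ∑ s, m (S s) * err (a (S s)) (c u₀ (S s))) :
    dist a (c v) ≤ (1 + 4 * η) * dist a (c u₀) + 1 / t * ((∑ s, (dist a (c u₀) +
      4 * (totalSens m * m (S s) * err (a (S s)) (c u₀ (S s))))) *
        if Misjudges c m η a u₀ S then 1 else 0) := by
  have hK := totalSens_pos hm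
  have ht' : (0 : ℝ) < t := by exact_mod_cast ht
  have hd0 := dist_nonneg a (c u₀)
  have he0 : 0 ≤ ∑ s, m (S s) * err (a (S s)) (c u₀ (S s)) :=
    sum_nonneg fun s _ => mul_nonneg (Nat.cast_nonneg _) (err_nonneg _ _)
  have hsum : ∑ s, (dist a (c u₀) + 4 * (totalSens m * m (S s) * err (a (S s)) (c u₀ (S s)))) =
      t * dist a (c u₀) + 4 * (totalSens m * ∑ s, m (S s) * err (a (S s)) (c u₀ (S s))) := by
    rw [sum_add_distrib, mul_sum, mul_sum]
    simp [mul_assoc]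
  rw [hsum]
  have hpos : 0 ≤ t * dist a (c u₀) +
      4 * (totalSens m * ∑ s, m (S s) * err (a (S s)) (c u₀ (S s))) := by positivity
  by_cases hvu : c v = c u₀
  · rw [hvu]
    have : 0 ≤ 1 / (t : ℝ) * ((t * dist a (c u₀) +
      4 * (totalSens m * ∑ s, m (S s) * err (a (S s)) (c u₀ (S s)))) *
        if Misjudges c m η a u₀ S then 1 else 0) := by
      split_ifs
      · positivity
      · simp
    nlinarith
  have hM := dist_pos hvu
  have htri := dist_triangle a (c v) (c u₀)
  split_ifs with hbad
  -- Misjudged row: linearity turns the correct judgement at `0` into an estimate of the distance of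
  -- `c v` and `c u₀` from the samples.
  · have h1 : c (v - u₀) ≠ c 0 := by
      rw [map_sub, map_zero, sub_ne_zero]; exact hvu
    have h2 := sum_dev_le h1 hS
    have h3 : ∀ j, err ((0 : ι → F) j) (c (v - u₀) j) - err ((0 : ι → F) j) (c 0 j) =
        err (c v j) (c u₀ j) := fun j => by
      simp only [map_sub, map_zero, Pi.sub_apply, Pi.zero_apply, err_self, sub_zero]
      unfold err
      simp only [eq_comm (a := (0 : F)), sub_eq_zero]
    have h4 : dist 0 (c (v - u₀)) - dist 0 (c 0) = dist (c v) (c u₀) := by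
      unfold dist
      rw [← sum_sub_distrib]
      exact sum_congr rfl fun j _ => h3 j
    have h5 : dist (c (v - u₀)) (c 0) = dist (c v) (c u₀) := by
      rw [← h4, map_zero, dist_comm]
      simp [dist]
    rw [h4, h5] at h2
    simp only [h3] at h2
    -- Triangle inequality through `a` at each sample; since `v` fits the samples no worse than
    -- `u₀`, the bound is twice the sampled error of `u₀`.
    have h6 : ∑ s, (m (S s) : ℝ) * err (c v (S s)) (c u₀ (S s)) ≤
        2 * ∑ s, m (S s) * err (a (S s)) (c u₀ (S s)) := by
      calc _ ≤ ∑ s, (m (S s) * err (a (S s)) (c v (S s)) +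
            m (S s) * err (a (S s)) (c u₀ (S s))) := sum_le_sum fun s _ => by
              rw [← mul_add]
              exact mul_le_mul_of_nonneg_left (err_triangle _ _ _) (Nat.cast_nonneg _)
        _ ≤ _ := by rw [sum_add_distrib]; linarith
    have h7 := mul_le_mul_of_nonneg_left h6 hK.le
    have h8 : t * dist (c v) (c u₀) ≤
        4 * (totalSens m * ∑ s, m (S s) * err (a (S s)) (c u₀ (S s))) := by
      have : t * η * dist (c v) (c u₀) ≤ t * (1 / 2) * dist (c v) (c u₀) := by gcongr
      linarith
    have h9 : dist (c v) (c u₀) ≤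
        1 / t * (4 * (totalSens m * ∑ s, m (S s) * err (a (S s)) (c u₀ (S s)))) := by
      rw [one_div, ← div_eq_inv_mul, le_div_iff₀ ht']
      linarith
    have h10 : dist a (c v) ≤ dist a (c u₀) + dist (c v) (c u₀) := by
      have := (abs_le.1 (abs_dist_sub_dist a (c v) (c u₀))).2
      linarith
    have h11 : 1 / (t : ℝ) * (t * dist a (c u₀)) = dist a (c u₀) := by field_simp
    rw [mul_one, mul_add, h11]
    nlinarith
  -- Correctly judged row: the sampled difference is nonpositive, so the true one is at most `η`
  -- times the distance of the codewords, itself at most the sum of both errors.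
  · have h1 := sum_dev_le hvu hbad
    have h2 : ∑ s, (m (S s) : ℝ) * (err (a (S s)) (c v (S s)) - err (a (S s)) (c u₀ (S s))) ≤ 0 := by
      simp only [mul_sub, sum_sub_distrib]
      linarith
    have h3 : t * (dist a (c v) - dist a (c u₀)) ≤ t * (η * dist (c v) (c u₀)) := by
      have := mul_nonpos_of_nonneg_of_nonpos hK.le h2
      linarith
    have h4 := le_of_mul_le_mul_left h3 ht'
    have h5 : (1 - η) * dist a (c v) ≤ (1 + η) * dist a (c u₀) := by nlinarith
    -- This is where `η ≤ 1 / 2` is exactly what is needed: `(1 - η) * (1 + 4 * η) ≥ 1 + η`.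
    have h6 : (1 + η) * dist a (c u₀) ≤ (1 - η) * ((1 + 4 * η) * dist a (c u₀)) := by
      rw [← mul_assoc]
      exact mul_le_mul_of_nonneg_right (by nlinarith) hd0
    have h7 := le_of_mul_le_mul_left (h5.trans h6) (by linarith)
    simpa using h7

open Classical in
/-- Some choice of samples is good for all rows together. -/
theorem exists_samples [Fintype X] [Nonempty ι] (hm : ∀ j, 1 ≤ m j)
    (hc : ∀ u u' j, c u j ≠ c u' j → (m j : ℝ) ≤ dist (c u) (c u')) {η : ℝ} (hη : 0 < η)
    (hη1 : η ≤ 1 / 2) {R : ℝ} (hR : totalSens m + 1 ≤ R) {t : ℕ} (ht : 0 < t)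
    (hexp : Fintype.card X * (3 * Real.exp (-(t * (η ^ 2 / (4 * R ^ 2))))) ≤ η)
    {κ : Type*} [Fintype κ] (a : κ → ι → F) (u₀ : κ → X) :
    ∃ S : Fin t → ι, ∀ v : κ → X,
      (∀ i, ∑ s, m (S s) * err (a i (S s)) (c (v i) (S s)) ≤
        ∑ s, m (S s) * err (a i (S s)) (c (u₀ i) (S s))) →
      ∑ i, dist (a i) (c (v i)) ≤ (1 + 20 * η) * ∑ i, dist (a i) (c (u₀ i)) := by
  by_contra! hcon
  -- If no `S` works, every `S` has its own bad answer `v S`; averaging over those `S` that judge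
  -- the code correctly will refute this.
  choose v hv hlt using hcon
  have hp := fun j => (sampleProb_pos hm j)
  have ht' : (0 : ℝ) < t := by exact_mod_cast ht
  set opt := ∑ i, dist (a i) (c (u₀ i)) with hopt
  have hopt0 : 0 ≤ opt := sum_nonneg fun _ _ => dist_nonneg _ _
  set G : (Fin t → ι) → ℝ := fun S => if Misjudges c m η 0 0 S then 0 else 1 with hG
  have hGbad : expect (sampleProb m) (fun S : Fin t → ι =>
      if Misjudges c m η 0 0 S then 1 else 0) ≤ η := by
    have h := expect_misjudges hm hc hη (by linarith) hR 0 0 (f := fun _ => 1) (fun _ => zero_le_one) t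
    simp only [sum_const, card_univ, Fintype.card_fin, nsmul_eq_mul, mul_one,
      sum_sampleProb hm] at h
    rw [expect_const_mul] at h
    exact (le_of_mul_le_mul_left h ht').trans hexp
  have hGE : 1 - η ≤ expect (sampleProb m) G := by
    have h : expect (sampleProb m) (fun S : Fin t → ι =>
        G S + if Misjudges c m η 0 0 S then 1 else 0) = 1 := by
      refine Eq.trans ?_ (expect_one (sum_sampleProb hm) (t := t))
      congr 1
      funext S
      simp only [hG]
      split_ifs <;> simp
    rw [expect_add] at h
    linarith
  -- The weight has mean `5` times the optimal row error, by unbiasedness, and misjudgement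
  -- contributes the factor `η`; hence `4 + 5 = 9`.
  have hrow : ∀ i, expect (sampleProb m) (fun S : Fin t → ι => (1 + 4 * η) * dist (a i) (c (u₀ i)) +
      1 / t * ((∑ s, (dist (a i) (c (u₀ i)) +
        4 * (totalSens m * m (S s) * err (a i (S s)) (c (u₀ i) (S s))))) *
        if Misjudges c m η (a i) (u₀ i) S then 1 else 0)) ≤
      (1 + 9 * η) * dist (a i) (c (u₀ i)) := fun i => by
    have hd := dist_nonneg (a i) (c (u₀ i))
    have h := expect_misjudges hm hc hη (by linarith) hR (a i) (u₀ i)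
      (f := fun j => dist (a i) (c (u₀ i)) + 4 * (totalSens m * m j * err (a i j) (c (u₀ i) j)))
      (fun j => by
        have := err_nonneg (a i j) (c (u₀ i) j)
        have := totalSens_pos hm
        positivity) t
    have h1 : ∑ j, sampleProb m j *
        (dist (a i) (c (u₀ i)) + 4 * (totalSens m * m j * err (a i j) (c (u₀ i) j))) =
        5 * dist (a i) (c (u₀ i)) := by
      have : ∀ j, sampleProb m j *
          (dist (a i) (c (u₀ i)) + 4 * (totalSens m * m j * err (a i j) (c (u₀ i) j))) =
          sampleProb m j * dist (a i) (c (u₀ i)) + 4 * err (a i j) (c (u₀ i) j) := fun j => by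
        rw [mul_add, mul_left_comm, sampleProb_mul hm]
      simp only [this]
      rw [sum_add_distrib, ← sum_mul, sum_sampleProb hm, ← mul_sum, ← dist]
      ring
    rw [h1] at h
    have hone : expect (sampleProb m) (fun _ : Fin t → ι => (1 + 4 * η) * dist (a i) (c (u₀ i))) =
        (1 + 4 * η) * dist (a i) (c (u₀ i)) := by
      have := expect_const_mul (sampleProb m) (t := t) ((1 + 4 * η) * dist (a i) (c (u₀ i)))
        (fun _ => 1)
      rw [expect_one (sum_sampleProb hm), mul_one] at this
      simpa using this
    rw [expect_add, expect_const_mul _ (1 / (t : ℝ)), hone]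
    have h2 := mul_le_mul_of_nonneg_left (h.trans (mul_le_mul_of_nonneg_left hexp (by positivity)))
      (one_div_nonneg.2 ht'.le)
    have h3 : 1 / (t : ℝ) * (t * (5 * dist (a i) (c (u₀ i))) * η) =
        5 * η * dist (a i) (c (u₀ i)) := by field_simp
    rw [h3] at h2
    linarith
  have hupper : expect (sampleProb m) (fun S => G S * ∑ i, dist (a i) (c (v S i))) ≤
      (1 + 9 * η) * opt := by
    rw [hopt, mul_sum]
    refine le_trans ?_ (sum_le_sum fun i _ => hrow i)
    rw [← expect_sum]
    refine expect_mono (fun j => (hp j).le) fun S => ?_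
    rw [mul_sum]
    refine sum_le_sum fun i _ => ?_
    simp only [hG]
    split_ifs with h hb hb
    · have := totalSens_pos hm
      have := dist_nonneg (a i) (c (u₀ i))
      have := sum_nonneg fun s (_ : s ∈ univ) => add_nonneg this (mul_nonneg zero_le_four
        (mul_nonneg (by positivity : 0 ≤ totalSens m * m (S s))
          (err_nonneg (a i (S s)) (c (u₀ i) (S s)))))
      rw [zero_mul]
      positivity
    · have := dist_nonneg (a i) (c (u₀ i))
      rw [zero_mul, mul_zero, mul_zero, add_zero]
      positivity
    · have := dist_le_of_samples hm hη hη1 ht h (hv S i)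
      rw [if_pos hb] at this
      rwa [one_mul]
    · have := dist_le_of_samples hm hη hη1 ht h (hv S i)
      rw [if_neg hb] at this
      rwa [one_mul]
  -- A sample with `G S₀ = 1` supplies the point of strict inequality.
  have hgood : ∃ S₀ : Fin t → ι, ¬ Misjudges c m η 0 0 S₀ := by
    by_contra! h
    have h0 : G = fun _ => (0 : ℝ) * 1 := by
      funext S
      simp [hG, h S]
    rw [h0, expect_const_mul] at hGE
    linarith
  obtain ⟨S₀, hS₀⟩ := hgood
  have hlower : expect (sampleProb m) (fun S => (1 + 20 * η) * opt * G S) <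
      expect (sampleProb m) (fun S => G S * ∑ i, dist (a i) (c (v S i))) := by
    refine expect_lt hp (fun S => ?_) (S₀ := S₀) ?_
    · rw [mul_comm]
      refine mul_le_mul_of_nonneg_left (hlt S).le ?_
      simp only [hG]
      split_ifs <;> simp
    · simpa [hG, hS₀] using hlt S₀
  rw [expect_const_mul] at hlower
  have h1 : (1 + 20 * η) * opt * (1 - η) ≤ (1 + 20 * η) * opt * expect (sampleProb m) G :=
    mul_le_mul_of_nonneg_left hGE (by positivity)
  -- The constant `20` leaves room for the factor `1 - η` lost by discarding samples that misjudge
  -- the code.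
  have h2 : (1 + 9 * η) * opt ≤ (1 + 20 * η) * (1 - η) * opt :=
    mul_le_mul_of_nonneg_right (by nlinarith) hopt0
  linarith

end Code

/-! ### From scores and samples to approximate factorisations -/

section Bridge

variable {F : Type*} [Field F]

/-- A matrix as a function on all pairs of natural numbers. -/
def extend {n d : ℕ} (A : Matrix (Fin n) (Fin d) F) (i j : ℕ) : F :=
  if h : i < n ∧ j < d then A ⟨i, h.1⟩ ⟨j, h.2⟩ else 0

@[simp] theorem extend_val {n d : ℕ} (A : Matrix (Fin n) (Fin d) F) (i : Fin n) (j : Fin d) :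
    extend A i j = A i j := by simp [extend]

theorem l0Norm_sub_eq_sum {n d : ℕ} (A B : Matrix (Fin n) (Fin d) F) :
    (l0Norm (A - B) : ℝ) = ∑ i, dist (A i) (B i) := by
  classical
  have h1 : l0Norm (A - B) = #{p : Fin n × Fin d | A p.1 p.2 ≠ B p.1 p.2} := by
    rw [l0Norm, ← Set.ncard_coe_finset]
    congr 1
    ext p
    simp [sub_eq_zero]
  rw [h1, card_filter]
  push_cast
  rw [Fintype.sum_prod_type]
  refine sum_congr rfl fun i _ => sum_congr rfl fun j _ => ?_
  unfold err
  split_ifs <;> simp_all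

theorem agreement_add_l0Norm {n d k : ℕ} (A : Matrix (Fin n) (Fin d) F) (U V : ℕ → ℕ → F)
    {U' : Matrix (Fin n) (Fin k) F} {V' : Matrix (Fin k) (Fin d) F}
    (hU : ∀ i l, U' i l = U i l) (hV : ∀ l j, V' l j = V j l) :
    (agreement n d k (extend A) U V : ℝ) + l0Norm (A - U' * V') = n * d := by
  classical
  have h : ∀ (i : Fin n) (j : Fin d), ∑ l ∈ range k, V j l * U i l = (U' * V') i j := fun i j => by
    rw [Matrix.mul_apply, ← Fin.sum_univ_eq_sum_range (fun l => V j l * U i l)]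
    exact sum_congr rfl fun l _ => by rw [hU, hV, mul_comm]
  rw [l0Norm_sub_eq_sum, agreement, ← Fin.sum_univ_eq_sum_range
    (fun j => score U (fun i => extend A i j) (fun _ => 1) n k (V j))]
  simp only [score]
  simp only [← Fin.sum_univ_eq_sum_range (fun s => if _ = _ then 1 else 0), h, extend_val, dist]
  push_cast
  rw [sum_comm, ← sum_add_distrib]
  simp only [← sum_add_distrib]
  rw [sum_congr rfl fun i _ => sum_congr rfl fun j _ => show
    ((if (U' * V') i j = A i j then (1 : ℝ) else 0) + err (A i j) ((U' * V') i j)) = 1 by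
      unfold err; split_ifs <;> simp_all]
  simp

/-- Maximising the score is therefore the same as minimising the weighted error on the samples. -/
theorem score_add_sum_err {t k : ℕ} (W : ℕ → ℕ → F) (b : ℕ → F) (m : ℕ → ℕ) (x : ℕ → F) :
    (score W b m t k x : ℝ) +
      ∑ s : Fin t, m s * err (b s) (∑ l : Fin k, x l * W s l) = ∑ s : Fin t, (m s : ℝ) := by
  classical
  have h : ∀ s, ∑ l ∈ range k, x l * W s l = ∑ l : Fin k, x l * W s l := fun s =>
    (Fin.sum_univ_eq_sum_range (fun l => x l * W s l) k).symm
  unfold score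
  simp only [h]
  rw [← Fin.sum_univ_eq_sum_range
    (fun s => if ∑ l : Fin k, x l * W s l = b s then m s else 0)]
  push_cast
  rw [← sum_add_distrib]
  refine sum_congr rfl fun s _ => ?_
  unfold err
  split_ifs <;> simp_all

/-- Every matrix factor `V'` has a guess from which a good partner of `V'` is recovered. -/
theorem exists_guess [Fintype F] {n d k t N : ℕ} (hd : 0 < d) (hk : 0 < k) (hN : 0 < N)
    (ht : t = 160 * Fintype.card F * (20 * N) ^ 3 * k * k * k)
    (A : Matrix (Fin n) (Fin d) F) (U' : Matrix (Fin n) (Fin k) F)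
    (V' : Matrix (Fin k) (Fin d) F) :
    ∃ (J M : ℕ → ℕ) (W : ℕ → ℕ → F), (∀ i < t, J i < d) ∧ (∀ i < t, M i ≤ d) ∧
      ∀ U : ℕ → ℕ → F, (∀ i < n, IsBest W (fun s => extend A i (J s)) M t k (U i)) →
        (l0Norm (A - Matrix.of (fun (i : Fin n) (l : Fin k) => U i l) * V') : ℝ) ≤
          (1 + 1 / N) * l0Norm (A - U' * V') := by
  classical
  have : Nonempty (Fin d) := ⟨⟨0, hd⟩⟩
  set c : (Fin k → F) →+ (Fin d → F) := V'.vecMulLinear.toAddMonoidHom with hcdef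
  have hcapp : ∀ u, c u = Matrix.vecMul u V' := fun u => rfl
  obtain ⟨m, hm1, hm2, hm3⟩ := exists_sensitivities (LinearMap.range V'.vecMulLinear)
  have hfr : Module.finrank F (LinearMap.range V'.vecMulLinear) ≤ k := by
    simpa using LinearMap.finrank_range_le V'.vecMulLinear
  have hm : ∀ j, 1 ≤ m j := fun j => (hm1 j).1
  have hc : ∀ u u' j, c u j ≠ c u' j → (m j : ℝ) ≤ dist (c u) (c u') := fun u u' j h => by
    have h1 := hm2 (c (u - u')) ⟨u - u', rfl⟩ j (by
      rw [map_sub, Pi.sub_apply, sub_ne_zero]; exact h)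
    have h2 : (#{i | c (u - u') i ≠ 0} : ℝ) = dist (c u) (c u') := by
      rw [card_filter]
      push_cast
      refine sum_congr rfl fun i _ => ?_
      rw [map_sub, Pi.sub_apply]
      unfold err
      split_ifs with h3 h4 h4 <;> simp_all [sub_eq_zero]
    rw [← h2]
    exact_mod_cast h1
  set q := Fintype.card F with hq
  have hq1 : 1 ≤ q := Fintype.card_pos
  set η : ℝ := 1 / (20 * N : ℕ) with hη
  have hN' : (1 : ℝ) ≤ N := by exact_mod_cast hN
  have hη0 : 0 < η := by positivity
  have hη1 : η ≤ 1 / 2 := by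
    rw [hη]
    push_cast
    exact one_div_le_one_div_of_le (by norm_num) (by linarith)
  -- The total sensitivity is at most `k + 1`, one more than a bound on the dimension of the code.
  have hR : totalSens m + 1 ≤ (k + 2 : ℝ) := by
    have : (Module.finrank F (LinearMap.range V'.vecMulLinear) : ℝ) ≤ k := by exact_mod_cast hfr
    unfold totalSens
    linarith
  have ht0 : 0 < t := by rw [ht]; positivity
  have hexp : Fintype.card (Fin k → F) *
      (3 * Real.exp (-(t * (η ^ 2 / (4 * (k + 2 : ℝ) ^ 2))))) ≤ η := by
    have hq1' : (1 : ℝ) ≤ q := by exact_mod_cast hq1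
    have hk1' : (1 : ℝ) ≤ k := by exact_mod_cast hk
    have hNk : (1 : ℝ) ≤ (20 * N : ℕ) := by push_cast; linarith
    set L : ℝ := ((20 * N : ℕ) : ℝ) with hL
    -- The number of samples is fixed here: the exponent must beat `q * k`, for the union bound over
    -- `q ^ k ≤ exp (q * k)` vectors, plus `3 * L`, to get below `η = 1 / L`. The estimate needs
    -- `144` and the constant is `160`.
    have h1 : q * k + 3 * L ≤ t * (η ^ 2 / (4 * (k + 2 : ℝ) ^ 2)) := by
      have h2 : (k + 2 : ℝ) ^ 2 ≤ 9 * k ^ 2 := by nlinarith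
      have h3 : (t : ℝ) = 160 * q * L ^ 3 * k * k * k := by rw [ht, hL]; push_cast; ring
      have h4 : q * k + 3 * L ≤ 4 * (q * k * L) := by
        have : (1 : ℝ) ≤ q * k := by nlinarith
        nlinarith
      rw [div_eq_mul_inv, ← mul_assoc, ← div_eq_mul_inv, le_div_iff₀ (by positivity), h3, hη]
      have h5 : 160 * q * L ^ 3 * k * k * k * (1 / L) ^ 2 = 160 * q * L * k * k * k := by
        field_simp
      rw [h5]
      calc (q * k + 3 * L) * (4 * (k + 2 : ℝ) ^ 2) ≤ 4 * (q * k * L) * (4 * (9 * k ^ 2)) := by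
            gcongr
        _ ≤ 160 * q * L * k * k * k := by
            have : 0 ≤ q * L * (k : ℝ) ^ 3 := by positivity
            nlinarith
    have h6 : (Fintype.card (Fin k → F) : ℝ) ≤ Real.exp (q * k) := by
      rw [Fintype.card_fun, Fintype.card_fin, mul_comm, Real.exp_nat_mul]
      push_cast
      gcongr
      linarith [Real.add_one_le_exp (q : ℝ)]
    have h7 : 3 * L ≤ Real.exp (3 * L) := by linarith [Real.add_one_le_exp (3 * L)]
    calc _ ≤ Real.exp (q * k) * (3 * Real.exp (-(q * k + 3 * L))) := by gcongr
      _ = 3 * Real.exp (-(3 * L)) := by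
          rw [mul_left_comm, ← Real.exp_add]; ring_nf
      _ ≤ η := by
          rw [Real.exp_neg, hη, ← div_eq_mul_inv, div_le_div_iff₀ (Real.exp_pos _) (by linarith)]
          linarith
  obtain ⟨S, hS⟩ := exists_samples hm hc hη0 hη1 hR ht0 hexp (fun i j => A i j) (fun i l => U' i l)
  -- The guess consists of the sampled indices, their weights and the sampled columns of `V'`;
  -- values beyond `t` are never read.
  refine ⟨fun i => if h : i < t then S ⟨i, h⟩ else 0, fun i => if h : i < t then m (S ⟨i, h⟩) else 0,
    fun i l => if h : i < t then extend V' l (S ⟨i, h⟩) else 0, fun i hi => ?_, fun i hi => ?_,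
    fun U hU => ?_⟩
  · simp [hi]
  · simpa [hi] using (hm1 (S ⟨i, hi⟩)).2
  -- Any maximiser of the score, whatever the tie-breaking, fits the samples at least as well as the
  -- row of `U'`.
  have h1 := hS (fun i l => U i l) fun i => by
    set W : ℕ → ℕ → F := fun i l => if h : i < t then extend V' l (S ⟨i, h⟩) else 0 with hW
    have hb := hU i i.2 (extend U' i)
    have e1 := score_add_sum_err (t := t) (k := k) W
      (fun s => extend A i (if h : s < t then S ⟨s, h⟩ else 0 : ℕ))
      (fun i => if h : i < t then m (S ⟨i, h⟩) else 0) (U i)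
    have e2 := score_add_sum_err (t := t) (k := k) W
      (fun s => extend A i (if h : s < t then S ⟨s, h⟩ else 0 : ℕ))
      (fun i => if h : i < t then m (S ⟨i, h⟩) else 0) (extend U' i)
    have hb' := (Nat.cast_le (α := ℝ)).2 hb
    simp only [hW, Fin.is_lt, dif_pos, Fin.eta, extend_val] at e1 e2 hb'
    simp only [hcapp, Matrix.vecMul, dotProduct]
    linarith
  rw [l0Norm_sub_eq_sum, l0Norm_sub_eq_sum]
  have h20 : 20 * η = 1 / N := by rw [hη]; push_cast; field_simp
  rw [h20] at h1
  exact h1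

end Bridge

/-! ### Estimating the running time -/

theorem enumerateTime_le {Y ℓ b T T' : ℕ} (hY : 4 ≤ Y) (hℓ : ℓ ≤ Y) (hb : b ≤ Y) (hb1 : 1 ≤ b)
    (hT : T ≤ T') (hT1 : 1 ≤ T') : RAM.enumerateTime ℓ b T ≤ b ^ ℓ * T' * Y ^ 5 := by
  have hp : 1 ≤ b ^ ℓ := Nat.one_le_pow _ _ hb1
  have h1 : ℓ * (5 * b) ≤ 5 * Y ^ 2 := by
    calc ℓ * (5 * b) ≤ Y * (5 * Y) := by gcongr
      _ = _ := by ring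
  have h3 : 16 + 24 * Y + 5 * Y ^ 2 ≤ Y ^ 5 := by
    have : 4 ^ 3 * Y ^ 2 ≤ Y ^ 3 * Y ^ 2 := by gcongr
    nlinarith
  have h4 : 1 ≤ b ^ ℓ * T' := Nat.mul_pos hp hT1
  calc RAM.enumerateTime ℓ b T = b ^ ℓ * (T + 12 * ℓ + 8) + ℓ * (5 * b) + 12 * ℓ + 7 := by
        unfold RAM.enumerateTime; ring
    _ ≤ b ^ ℓ * (T' * (1 + 12 * Y + 8)) + 5 * Y ^ 2 + 12 * Y + 7 := by
        gcongr
        nlinarith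
    _ ≤ b ^ ℓ * T' * (16 + 24 * Y + 5 * Y ^ 2) := by nlinarith
    _ ≤ _ := by gcongr

/-- The number `ℓ` of equations stays explicit, because it is `n` in the column step and must enter
linearly. -/
theorem regressTime_le {Y ℓ k q : ℕ} (hY : 4 ≤ Y) (hk : k ≤ Y) (hq : q ≤ Y) (hq1 : 1 ≤ q)
    (hℓ : 1 ≤ ℓ) : regressTime ℓ k q ≤ q ^ k * ℓ * Y ^ 13 := by
  have hp : 1 ≤ q ^ k := Nat.one_le_pow _ _ hq1
  have h4 : 4 ^ 3 ≤ Y ^ 3 := by gcongr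
  have h1 : dotTime k q ≤ Y ^ 5 := by
    have : k * (10 * q + 18) ≤ Y * (10 * Y + 18) := by gcongr
    have : 4 ^ 3 * Y ^ 2 ≤ Y ^ 3 * Y ^ 2 := by gcongr
    unfold dotTime
    nlinarith
  have h5 : 4 ^ 3 * Y ^ 2 ≤ Y ^ 5 := by
    calc 4 ^ 3 * Y ^ 2 ≤ Y ^ 3 * Y ^ 2 := by gcongr
      _ = _ := by ring
  have h2 : scoreTime ℓ k q + 6 * k + 7 ≤ ℓ * Y ^ 7 := by
    have : 4 ^ 2 * Y ^ 5 ≤ Y ^ 2 * Y ^ 5 := by gcongr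
    have h6 : Y ^ 5 + 6 * Y + 22 ≤ Y ^ 7 := by nlinarith
    calc scoreTime ℓ k q + 6 * k + 7 ≤ ℓ * (Y ^ 5 + 11) + 4 + 6 * Y + 7 := by
          unfold scoreTime; gcongr
      _ ≤ ℓ * (Y ^ 5 + 6 * Y + 22) := by nlinarith
      _ ≤ _ := by gcongr
  have h3 := enumerateTime_le hY hk hq hq1 h2 (Nat.mul_pos hℓ (by positivity))
  have h6 : 1 ≤ q ^ k * ℓ * Y ^ 12 := Nat.mul_pos (Nat.mul_pos hp hℓ) (by positivity)
  calc regressTime ℓ k q ≤ q ^ k * (ℓ * Y ^ 7) * Y ^ 5 + 1 := by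
        unfold regressTime; gcongr
    _ = q ^ k * ℓ * Y ^ 12 + 1 := by ring
    _ ≤ q ^ k * ℓ * Y ^ 12 * 4 := by omega
    _ ≤ q ^ k * ℓ * Y ^ 12 * Y := by gcongr
    _ = _ := by ring

theorem guessTime_le {Y n d k t q : ℕ} (hY : 4 ≤ Y) (hk : k ≤ Y) (hq : q ≤ Y) (hd : d ≤ Y)
    (ht : t ≤ Y) (hq1 : 1 ≤ q) (ht1 : 1 ≤ t) (hn : 1 ≤ n) :
    guessTime n d k t q ≤ n * q ^ k * Y ^ 16 := by
  have hp : 1 ≤ q ^ k := Nat.one_le_pow _ _ hq1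
  have h2 : 4 ^ 12 * Y ^ 2 ≤ Y ^ 14 := by
    calc 4 ^ 12 * Y ^ 2 ≤ Y ^ 12 * Y ^ 2 := by gcongr
      _ = _ := by ring
  have hnp : 1 ≤ n * q ^ k := Nat.mul_pos hn hp
  have h14 : q ^ k * Y ^ 14 ≤ n * q ^ k * Y ^ 14 := by
    rw [mul_assoc]; exact Nat.le_mul_of_pos_left _ hn
  have a1 : Y ^ 2 ≤ n * Y ^ 2 := Nat.le_mul_of_pos_left _ hn
  have a2 : n * Y * 4 ≤ n * Y ^ 2 := by rw [pow_two, ← mul_assoc]; gcongr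
  have a3 : n * 4 ≤ n * Y := by gcongr
  have a4 : 4 * Y ≤ Y ^ 2 := by rw [pow_two]; gcongr
  have hrows : rowsTime n d k t q ≤ 2 * (n * q ^ k * Y ^ 14) := by
    have h1 := regressTime_le hY hk hq hq1 ht1
    calc rowsTime n d k t q
        ≤ n * (5 * Y + 4 + (Y * 8 + 3) + q ^ k * Y * Y ^ 13 + (5 * Y + 4 + (Y * 7 + 3)) + 4) + 3 := by
          unfold rowsTime
          gcongr
          exact h1.trans (by gcongr)
      _ ≤ n * (q ^ k * Y ^ 14 + q ^ k * (4 ^ 12 * Y ^ 2)) := by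
          have : 25 * Y + 21 ≤ q ^ k * (4 ^ 12 * Y ^ 2) := by nlinarith
          nlinarith
      _ ≤ n * (q ^ k * Y ^ 14 + q ^ k * Y ^ 14) := by gcongr
      _ = _ := by ring
  have hcols : colsTime n d k q ≤ 2 * (n * q ^ k * Y ^ 14) := by
    have h1 := regressTime_le hY hk hq hq1 hn
    calc colsTime n d k q
        ≤ Y * (n * (5 * Y + 11) + q ^ k * n * Y ^ 13 + Y * (5 * Y + 11) + 13) + 4 := by
          unfold colsTime
          calc _ = d * (n * (5 * d + 11) + regressTime n k q + k * (5 * d + 11) + 13) + 4 := by ring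
            _ ≤ _ := by gcongr
      _ ≤ n * q ^ k * Y ^ 14 + n * q ^ k * (Y * (4 ^ 4 * Y ^ 2)) := by
          have h3 : n * (5 * Y + 11) + Y * (5 * Y + 11) + 14 ≤ n * (4 ^ 4 * Y ^ 2) := by
            nlinarith
          have h4 : n * (4 ^ 4 * Y ^ 2) ≤ n * q ^ k * (4 ^ 4 * Y ^ 2) := by
            gcongr; exact Nat.le_mul_of_pos_right _ hp
          have h5 := Nat.mul_le_mul_left Y (h3.trans h4)
          nlinarith
      _ ≤ n * q ^ k * Y ^ 14 + n * q ^ k * Y ^ 14 := by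
          gcongr
          calc Y * (4 ^ 4 * Y ^ 2) = 4 ^ 4 * Y ^ 3 := by ring
            _ ≤ Y ^ 11 * Y ^ 3 := by
                refine Nat.mul_le_mul_right _ ?_
                exact (Nat.pow_le_pow_left hY 4).trans
                  (Nat.pow_le_pow_right (by omega) (by norm_num))
            _ = _ := by ring
      _ = _ := by ring
  have hrec : recordTime n d k ≤ n * q ^ k * Y ^ 14 := by
    calc recordTime n d k ≤ n * Y * 6 + Y * Y * 6 + 10 := by unfold recordTime; gcongr
      _ ≤ n * (4 ^ 12 * Y ^ 2) := by nlinarith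
      _ ≤ n * q ^ k * Y ^ 14 := by
          gcongr
          exact Nat.le_mul_of_pos_right _ hp
  have h16 : 4 ^ 2 * (n * q ^ k * Y ^ 14) ≤ n * q ^ k * Y ^ 16 := by
    calc 4 ^ 2 * (n * q ^ k * Y ^ 14) ≤ Y ^ 2 * (n * q ^ k * Y ^ 14) := by gcongr
      _ = _ := by ring
  unfold guessTime
  omega

/-- One guess costs `Y ^ 16`, each of the three enumerations a further `Y ^ 5`, and the
preprocessing one more factor `Y`; `n` is never absorbed into `Y`. -/
theorem lowRankTime_le {Y n d k C q : ℕ} (hY : 4 ≤ Y) (hk : k ≤ Y) (hq : q ≤ Y) (hd : d + 1 ≤ Y)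
    (ht : C * k * k * k ≤ Y) (htk : C * k * k * k * k ≤ Y) (hq1 : 1 ≤ q) (hd1 : 1 ≤ d)
    (ht1 : 1 ≤ C * k * k * k) (hn : 1 ≤ n) :
    lowRankTime n d k C q ≤ n * (d ^ (C * k * k * k) * (d + 1) ^ (C * k * k * k) *
      q ^ (C * k * k * k * k) * q ^ k) * Y ^ 32 := by
  unfold lowRankTime
  generalize C * k * k * k = t at *
  set Z := d ^ t * (d + 1) ^ t * q ^ (t * k) * q ^ k with hZ
  have hZ1 : 1 ≤ Z := by rw [hZ]; exact Nat.succ_le_of_lt (by positivity)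
  have h1 := guessTime_le hY hk hq (by omega : d ≤ Y) ht hq1 ht1 hn
  have p1 : 1 ≤ n * q ^ k * Y ^ 16 := Nat.succ_le_of_lt (by positivity)
  have h2 := enumerateTime_le hY htk hq hq1 h1 p1
  have h3 := enumerateTime_le hY ht hd (by omega) h2 (Nat.succ_le_of_lt (by positivity))
  have h4 := enumerateTime_le hY ht (by omega : d ≤ Y) hd1 h3 (Nat.succ_le_of_lt (by positivity))
  have h5 : searchTime n d k t q ≤ n * Z * Y ^ 31 := by
    refine h4.trans (le_of_eq ?_)
    rw [hZ]
    ring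
  have h6 : 3 * (q * q * q) + 32 + 25 * k + 5 * d + n * 5 ≤ n * Z * Y ^ 31 := by
    have h7 : 3 * (q * q * q) ≤ 3 * (Y * Y * Y) := by gcongr
    have h8 : 4 ^ 28 * Y ^ 3 ≤ Y ^ 31 := by
      calc 4 ^ 28 * Y ^ 3 ≤ Y ^ 28 * Y ^ 3 := by gcongr
        _ = _ := by ring
    have h9 : 3 * (Y * Y * Y) + 32 + 30 * Y + n * 5 ≤ n * (4 ^ 28 * Y ^ 3) := by
      have a1 : 1 ≤ Y * Y * Y := Nat.succ_le_of_lt (by positivity)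
      have a2 : Y ≤ Y * Y * Y := by nlinarith
      have a3 : Y * Y * Y ≤ n * (Y * Y * Y) := Nat.le_mul_of_pos_left _ hn
      have a4 : n ≤ n * (Y * Y * Y) := Nat.le_mul_of_pos_right _ a1
      have a5 : n * (4 ^ 28 * Y ^ 3) = 4 ^ 28 * (n * (Y * Y * Y)) := by ring
      rw [a5]
      omega
    have h10 : n * (4 ^ 28 * Y ^ 3) ≤ n * Z * Y ^ 31 := by
      gcongr
      exact Nat.le_mul_of_pos_right _ hZ1
    omega
  calc _ ≤ n * Z * Y ^ 31 * 4 := by omega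
    _ ≤ n * Z * Y ^ 31 * Y := by gcongr
    _ = _ := by ring

/-- The exponent of `max d 2` in the running time, for `t` samples. -/
def timeExponent (k t q : ℕ) : ℕ := 3 * t + q * (t * k) + q * k + 32 * (3 + q + t + k)

theorem lowRankTime_le_pow {n d k C q : ℕ} (hn : 0 < n) (hd : 0 < d) (hk : 0 < k) (hq : 0 < q)
    (hC : 0 < C) :
    lowRankTime n d k C q ≤ n * (max d 2) ^ timeExponent k (C * k * k * k) q := by
  have ht1 : 1 ≤ C * k * k * k := Nat.succ_le_of_lt (by positivity)
  have key := fun Y hY hk' hq' hd' ht htk =>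
    lowRankTime_le (Y := Y) (n := n) (C := C) hY hk' hq' hd' ht htk hq hd ht1 hn
  generalize C * k * k * k = t at *
  set D := max d 2 with hD
  have hD2 : 2 ≤ D := le_max_right _ _
  have hdD : d ≤ D := le_max_left _ _
  have hpow : ∀ x, x ≤ D ^ x := fun x =>
    x.lt_two_pow_self.le.trans (Nat.pow_le_pow_left hD2 x)
  have htk : 1 ≤ t * k := Nat.mul_pos ht1 hk
  set Y := 4 * (d * (q * (t * k))) with hY
  have hqtk : 1 ≤ q * (t * k) := Nat.mul_pos hq htk
  have hdqtk : 1 ≤ d * (q * (t * k)) := Nat.mul_pos hd hqtk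
  have b1 : q * (t * k) ≤ d * (q * (t * k)) := Nat.le_mul_of_pos_left _ hd
  have b2 : t * k ≤ q * (t * k) := Nat.le_mul_of_pos_left _ hq
  have b3 : k ≤ t * k := Nat.le_mul_of_pos_left _ ht1
  have b4 : t ≤ t * k := Nat.le_mul_of_pos_right _ hk
  have b5 : q ≤ q * (t * k) := Nat.le_mul_of_pos_right _ htk
  have b6 : d ≤ d * (q * (t * k)) := Nat.le_mul_of_pos_right _ hqtk
  have h := key Y (by omega) (by omega) (by omega) (by omega) (by omega) (by omega)
  -- Everything becomes a power of `D` through `x ≤ 2 ^ x ≤ D ^ x`; the `3` comes from `4 ≤ D ^ 2`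
  -- and `d ≤ D`.
  have hYD : Y ≤ D ^ (3 + q + t + k) := by
    calc Y ≤ D ^ 2 * (D * (D ^ q * (D ^ t * D ^ k))) := by
          rw [hY]
          gcongr
          · exact (by norm_num : (4 : ℕ) = 2 ^ 2) ▸ Nat.pow_le_pow_left hD2 2
          · exact hpow q
          · exact hpow t
          · exact hpow k
      _ = _ := by ring
  have hd1 : d + 1 ≤ D ^ 2 := by nlinarith
  refine h.trans ?_
  calc _ ≤ n * (D ^ t * (D ^ 2) ^ t * (D ^ q) ^ (t * k) * (D ^ q) ^ k) *
        (D ^ (3 + q + t + k)) ^ 32 := by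
        gcongr
        · exact hpow q
        · exact hpow q
    _ = n * D ^ (3 * t + q * (t * k) + q * k + 32 * (3 + q + t + k)) := by
        simp only [← pow_mul, ← pow_add, mul_assoc]
        congr 2
        ring
    _ ≤ _ := le_of_eq (by unfold timeExponent; rfl)

/-! ### Correctness of the algorithm and the polynomial exponent -/

theorem solvesWithin_lowRankProg {F : Type*} [Field F] {q : ℕ} (e : F ≃ Fin q) {N : ℕ}
    (hN : 0 < N) {n d k : ℕ} (hn : 0 < n) (hd : 0 < d) (hk : 0 < k)
    (A : Matrix (Fin n) (Fin d) F) :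
    SolvesWithin e (lowRankProg e (160 * q * (20 * N) ^ 3)) (1 + 1 / N) A k
      (n * (max d 2 : ℕ) ^ timeExponent k (160 * q * (20 * N) ^ 3 * k * k * k) q : ℕ) := by
  have hq : 0 < q := (Nat.zero_le _).trans_lt (enc_lt e 0)
  have : Fintype F := Fintype.ofEquiv _ e.symm
  have hcard : Fintype.card F = q := by rw [Fintype.card_congr e, Fintype.card_fin]
  set C := 160 * q * (20 * N) ^ 3 with hC
  have hA : Holds e 0 n d (extend A) (inputState e A k) := fun i hi j hj => by
    have h1 : (i * d + j) / d = i := by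
      rw [mul_comm, Nat.mul_add_div hd, Nat.div_eq_of_lt hj, add_zero]
    have h2 : (i * d + j) % d = j := by rw [Nat.mul_add_mod', Nat.mod_eq_of_lt hj]
    simp [inputState, extend, enc, h1, h2, hi, hj, hd]
  obtain ⟨s, ⟨t, ht, hr⟩, hR, hV⟩ := runs_lowRankProg (e := e) (n := n) (d := d) (k := k) C
    (s := inputState e A k) hd hk rfl rfl rfl rfl hA
  have htime := ht.trans (lowRankTime_le_pow hn hd hk hq (C := C) (by positivity))
  rcases hR with hR | ⟨U, V, hU, hV', h9⟩
  -- The zero guess is among those tried, so some pair has been recorded.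
  · obtain ⟨_, _, h⟩ := hV 0 0 0 (fun _ _ => hd) (fun _ _ => Nat.zero_le _)
    have := h 0
    omega
  refine ⟨t, s, Matrix.of fun i l => U i l, Matrix.of fun l j => V j l, hr,
    by exact_mod_cast htime, fun i l => hU i i.2 l l.2, fun l j => hV' l l.2 j j.2,
    fun U' V'' => ?_⟩
  obtain ⟨J, M, W, hJ, hM, hbest⟩ := exists_guess (N := N) hd hk hN
    (t := C * k * k * k) (by rw [hcard]) A U' V''
  obtain ⟨U₁, hU₁, hagr⟩ := hV J M W hJ hM
  -- The recorded pair agrees with `A` at least as often as `U₁` with any second factor, in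
  -- particular with `V''`, for which `U₁` is a good partner.
  refine le_trans ?_ (hbest U₁ hU₁)
  have h1 := agreement_add_l0Norm (k := k) A U V (U' := Matrix.of fun i l => U i l)
    (V' := Matrix.of fun l j => V j l) (fun _ _ => rfl) (fun _ _ => rfl)
  have h2 := agreement_add_l0Norm (k := k) A U₁ (fun j l => extend V'' l j)
    (U' := Matrix.of fun i l => U₁ i l) (V' := V'') (fun _ _ => rfl) (fun _ _ => by simp)
  have h3 : (agreement n d k (extend A) U₁ (fun j l => extend V'' l j) : ℝ) ≤
      agreement n d k (extend A) U V := by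
    have := hagr fun j l => extend V'' l j
    exact_mod_cast (by omega : agreement n d k (extend A) U₁ (fun j l => extend V'' l j) ≤
      agreement n d k (extend A) U V)
  linarith

open Polynomial in
/-- The polynomial in the exponent of the running time. -/
noncomputable def timePolynomial (q : ℕ) : ℝ[X] :=
  C (160 * q * 40 ^ 3 * 35 : ℝ) * X ^ 6 + C (160 * q * 40 ^ 3 * q : ℝ) * X ^ 7 +
    C (q + 32 : ℝ) * X + C (96 + 32 * q : ℝ)

/-- With `z = k / ε`, both `k ≤ z` and `⌈1 / ε⌉₊ ≤ 2 * z`, so the number of samples is `O(z ^ 6)`;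
the term `q * t * k` gives degree seven. -/
theorem timeExponent_le {k q : ℕ} (hk : 0 < k) {ε : ℝ} (hε : 0 < ε) (hε1 : ε < 1) :
    (timeExponent k (160 * q * (20 * ⌈1 / ε⌉₊) ^ 3 * k * k * k) q : ℝ) ≤
      (timePolynomial q).eval (k / ε) := by
  set z : ℝ := k / ε with hz
  have hk1 : (1 : ℝ) ≤ k := by exact_mod_cast hk
  have hkz : (k : ℝ) ≤ z := by
    rw [hz, le_div_iff₀ hε]; nlinarith
  have hEz : (⌈1 / ε⌉₊ : ℝ) ≤ 2 * z := by
    have h1 := (Nat.ceil_lt_add_one (by positivity : 0 ≤ 1 / ε)).le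
    have h2 : 1 / ε ≤ z := by rw [hz]; gcongr
    have h3 : 1 ≤ z := hk1.trans hkz
    linarith
  have hz0 : 0 ≤ z := by positivity
  set t : ℝ := 160 * q * (20 * ⌈1 / ε⌉₊) ^ 3 * k * k * k with ht
  have htz : t ≤ 160 * q * 40 ^ 3 * z ^ 6 := by
    calc t ≤ 160 * q * (20 * (2 * z)) ^ 3 * z * z * z := by rw [ht]; gcongr
      _ = _ := by ring
  have h1 : (timeExponent k (160 * q * (20 * ⌈1 / ε⌉₊) ^ 3 * k * k * k) q : ℝ) =
      3 * t + q * (t * k) + q * k + 32 * (3 + q + t + k) := by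
    unfold timeExponent
    push_cast
    rw [ht]
  have h2 : q * (t * k) ≤ q * (160 * q * 40 ^ 3 * z ^ 6 * z) := by gcongr
  have h3 : q * (k : ℝ) ≤ q * z := by gcongr
  rw [h1]
  simp only [timePolynomial, Polynomial.eval_add, Polynomial.eval_mul, Polynomial.eval_C,
    Polynomial.eval_pow, Polynomial.eval_X]
  nlinarith

theorem SolvesWithin.mono {F : Type*} [Field F] {q n d k : ℕ} {e : F ≃ Fin q} {p : RAM.Program}
    {α β T T' : ℝ} {A : Matrix (Fin n) (Fin d) F} (h : SolvesWithin e p α A k T) (hα : α ≤ β)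
    (hT : T ≤ T') : SolvesWithin e p β A k T' := by
  obtain ⟨t, s, U, V, hr, ht, hU, hV, hUV⟩ := h
  exact ⟨t, s, U, V, hr, ht.trans hT, hU, hV, fun U' V' => (hUV U' V').trans (by gcongr)⟩

end LowRank

theorem mainTheorem4 (q : ℕ) :
    ∃ P : ℝ[X],
      ∀ (F : Type*) [Field F] (e : F ≃ Fin q) (ε : ℝ), 0 < ε → ε < 1 →
        ∃ p : RAM.Program,
          ∀ (n d k : ℕ), 0 < n → 0 < d → 0 < k →
            ∀ A : Matrix (Fin n) (Fin d) F,
              LowRank.SolvesWithin e p (1 + ε) A k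
                ((n : ℝ) * (max d 2 : ℝ) ^ (P.eval ((k : ℝ) / ε))) := by
  refine ⟨LowRank.timePolynomial q, fun F _ e ε hε hε1 => ?_⟩
  -- Taking `N` as this ceiling gives `1 / N ≤ ε`; it enters the program only through a constant.
  have hN : 0 < ⌈1 / ε⌉₊ := Nat.ceil_pos.2 (by positivity)
  refine ⟨LowRank.lowRankProg e (160 * q * (20 * ⌈1 / ε⌉₊) ^ 3), fun n d k hn hd hk A =>
    (LowRank.solvesWithin_lowRankProg e hN hn hd hk A).mono ?_ ?_⟩
  · have h1 : 1 / (⌈1 / ε⌉₊ : ℝ) ≤ ε := by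
      rw [div_le_comm₀ (by exact_mod_cast hN) hε]
      exact Nat.le_ceil _
    linarith
  · push_cast
    refine mul_le_mul_of_nonneg_left ?_ (Nat.cast_nonneg n)
    rw [← Real.rpow_natCast]
    exact Real.rpow_le_rpow_of_exponent_le (le_max_of_le_right (by norm_num))
      (LowRank.timeExponent_le hk hε hε1)
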